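/- For a weight $\varphi\ge 0$ on $\mathbb R$, say that a measure $\mu$ is in $L^2(\varphi)$ if $\mu\ll\varphi\,dx$ and $\frac{d\mu}{dx}\in L^2(\varphi\,dx)$. An element $f$ of the complex space $L^2(\varphi\,dx)$ is regarded as the complex measure $1_{\{\varphi\neq0\}}f\,dx$, with moments $m_k(f)=\int_{\{\varphi\ne 0\}}x^kf(x)\,dx$. Let $\mathcal P_\varphi$ be the set of probability distributions in $L^2(\varphi)$ with mean $0$ and variance $1$. For $\chi\in\mathcal P_\varphi$ let $V_\chi\subset L^2(\varphi\,dx)$ be the closed complex linear span of the differences $\frac{d\mu}{dx}-\frac{d\chi}{dx}$, $\mu\in\mathcal P_\varphi$. (1) Classical case. Let $\varphi(x)=e^{x^2/2}$, let $\chi$ be the standard Gaussian law, and let $T\mu=(\mu*\mu)\circ S_{1/\sqrt2}$, where $\mu\circ S_r$ is the image of $\mu$ under $x\mapsto rx$. All moments of every $f\in L^2(\varphi\,dx)$ are finite, $\chi\in\mathcal P_\varphi$, $T\chi=\chi$, $T$ maps $\mathcal P_\varphi$ into itself, and $V_\chi=\{f\in L^2(\varphi\,dx):m_0(f)=m_1(f)=m_2(f)=0\}$.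 There is exactly one bounded complex linear operator $D:V_\chi\to V_\chi$ that is the differential of $T|_{\mathcal P_\varphi}$ at $\chi$, that is, $$\Big\|\tfrac{d(T\mu)}{dx}-\tfrac{d(T\chi)}{dx}-D\big(\tfrac{d\mu}{dx}-\tfrac{d\chi}{dx}\big)\Big\|=o\Big(\Big\|\tfrac{d\mu}{dx}-\tfrac{d\chi}{dx}\Big\|\Big)\qquad(\mu\in\mathcal P_\varphi,\ \mu\to\chi)$$ in $L^2(\varphi\,dx)$, and $\chi$ is strictly spectrally stable: the spectrum of $D$ is contained in the open unit disc $\{z\in\mathbb C:|z|<1\}$. (2) Free case. Let $\varphi(t)=1_{[-2,2]}(t)\sqrt{4-t^2}$ (so that all distributions in $L^2(\varphi)$ are supported in $[-2,2]$), and let $\chi$ be the semicircle law with density $\frac1{2\pi}\sqrt{4-t^2}$ on $[-2,2]$. Distributions are identified with their moment sequences. For sequences $m,m'\in\mathbb C^{\mathbb N}$ with $m_0=m'_0=1$, the free convolution $m\boxplus m'$ is the moment sequence of $a+b$, where $a$ and $b$ are freely independent elements, with moment sequences $m$ and $m'$, of a noncommutative probability space (a unital complex algebra with a unital linear functional); this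 sequence exists and depends only on $m$ and $m'$. Let $(Tm)_k=2^{-k/2}(m\boxplus m)_k$ be the free central limit operator. All moments of every $f\in L^2(\varphi\,dx)$ are finite, $\chi\in\mathcal P_\varphi$, $T$ fixes the moment sequence $m^\chi$ of $\chi$, and $V_\chi=\{f\in L^2(\varphi\,dx):m_0(f)=m_1(f)=m_2(f)=0\}$. There is exactly one bounded complex linear operator $D:V_\chi\to V_\chi$ that is the differential of $T$ at $\chi$ along $V_\chi$, that is, for all $v\in V_\chi$, with $m(v)=(m_k(v))_{k\ge0}$, $$\lim_{\varepsilon\to0,\ \varepsilon\in\mathbb R\setminus\{0\}}\frac{T(m^\chi+\varepsilon\,m(v))-T(m^\chi)}{\varepsilon}=m(Dv)$$ in the topology of entrywise convergence, and $\chi$ is strictly spectrally stable: the spectrum of $D$ is contained in the open unit disc. -/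

import Mathlib

open MeasureTheory ProbabilityTheory Filter Topology

noncomputable section

namespace CentralLimit

/-! ### Weighted spaces and distributions with densities in them -/

/-- The measure `φ(x) dx` on the line. -/
def weightMeasure (φ : ℝ → ℝ) : Measure ℝ :=
  volume.withDensity fun x => ENNReal.ofReal (φ x)

/-- The complex Hilbert space `L²(φ(x) dx)`. An element `f` is regarded as the density, with respect
to Lebesgue measure, of the complex measure `1_{φ ≠ 0} f dx`. -/
abbrev L2 (φ : ℝ → ℝ) : Type := Lp ℂ 2 (weightMeasure φ)

/-- The weight `e^{x²/2}`. -/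
def hermiteWeight (x : ℝ) : ℝ := Real.exp (x ^ 2 / 2)

/-- The weight `1_{[-2,2]}(t) √(4 - t²)`. -/
def chebyshevWeight : ℝ → ℝ :=
  Set.indicator (Set.Icc (-2) 2) fun t => Real.sqrt (4 - t ^ 2)

/-- A measure `μ` is in `L²(φ)` if `μ ≪ φ dx` and `dμ/dx ∈ L²(φ dx)`. -/
def InL2 (φ : ℝ → ℝ) (μ : Measure ℝ) : Prop :=
  μ ≪ weightMeasure φ ∧
    MemLp (fun x => ((μ.rnDeriv volume x).toReal : ℂ)) 2 (weightMeasure φ)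

/-- The set of probability distributions in `L²(φ)` with mean `0` and variance `1`. -/
def distributions (φ : ℝ → ℝ) : Set (Measure ℝ) :=
  {μ | IsProbabilityMeasure μ ∧ InL2 φ μ ∧ ∫ x, x ∂μ = 0 ∧ ∫ x, x ^ 2 ∂μ = 1}

open Classical in
/-- The density `dμ/dx` as an element of `L²(φ dx)`; only used for measures `μ` in `L²(φ)`. -/
def density (φ : ℝ → ℝ) (μ : Measure ℝ) : L2 φ :=
  if h : MemLp (fun x => ((μ.rnDeriv volume x).toReal : ℂ)) 2 (weightMeasure φ) then h.toLp
  else 0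

/-- The space of directions at `χ` inside `distributions φ`: the closed complex linear span in
`L²(φ dx)` of the differences of densities `dμ/dx - dχ/dx`, where `μ` is in `distributions φ`. -/
def tangentSpace (φ : ℝ → ℝ) (χ : Measure ℝ) : Submodule ℂ (L2 φ) :=
  (Submodule.span ℂ {v | ∃ μ ∈ distributions φ, v = density φ μ - density φ χ}).topologicalClosure

/-- The moments `∫ x^k dμ(x)`, `k = 0, 1, 2, …`, of a measure on the line. -/
def momentSeq (μ : Measure ℝ) (k : ℕ) : ℂ := ((∫ x, x ^ k ∂μ : ℝ) : ℂ)

/-- The moments `∫ x^k f(x) dx` of the complex measure with density `f ∈ L²(φ dx)`. -/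
def l2Moment (φ : ℝ → ℝ) (f : L2 φ) (k : ℕ) : ℂ :=
  ∫ x in Function.support φ, (x : ℂ) ^ k * f x

/-! ### The classical central limit operator -/

/-- The central limit operator `T μ = (μ ∗ μ) ∘ S_{1/√2}`, where `μ ∘ S_r` is the image of `μ` under
`x ↦ r x`. -/
def classicalT (μ : Measure ℝ) : Measure ℝ :=
  (Measure.conv μ μ).map fun x => x / Real.sqrt 2

/-- `D` is the (Fréchet) differential at `χ`, in the norm of `L²(φ dx)`, of the map `T` on the set
`distributions φ`. -/
def IsDifferential (φ : ℝ → ℝ) (T : Measure ℝ → Measure ℝ) (χ : Measure ℝ)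
    (D : tangentSpace φ χ →L[ℂ] tangentSpace φ χ) : Prop :=
  ∀ ε > 0, ∃ δ > 0, ∀ μ ∈ distributions φ, ∀ v : tangentSpace φ χ,
    (v : L2 φ) = density φ μ - density φ χ → ‖v‖ ≤ δ →
      ‖density φ (T μ) - density φ (T χ) - (D v : L2 φ)‖ ≤ ε * ‖v‖

/-! ### Free independence and the free central limit operator -/

/-- Free independence of a family of unital subalgebras of a noncommutative probability space
`(A, τ)`: a nonempty product of `τ`-centred elements, neighbouring ones from different subalgebras,
is `τ`-centred. -/
def FreelyIndependent {A : Type} [Ring A] [Algebra ℂ A] (τ : A →ₗ[ℂ] ℂ) {ι : Type}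
    (B : ι → Subalgebra ℂ A) : Prop :=
  ∀ (n : ℕ) (i : Fin (n + 1) → ι) (x : Fin (n + 1) → A),
    (∀ j, x j ∈ B (i j)) → (∀ j, τ (x j) = 0) →
    (∀ j : Fin n, i j.castSucc ≠ i j.succ) →
      τ (List.ofFn x).prod = 0

/-- `m` is the sequence of moments of `a + b`, for some freely independent elements `a`, `b` of a
noncommutative probability space whose moments are `m₁` and `m₂`. -/
def IsFreeConv (m₁ m₂ m : ℕ → ℂ) : Prop :=
  ∃ (A : Type) (_ : Ring A) (_ : Algebra ℂ A) (τ : A →ₗ[ℂ] ℂ) (a b : A),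
    τ 1 = 1 ∧
    FreelyIndependent τ (fun s : Bool => Algebra.adjoin ℂ {if s then a else b}) ∧
    (∀ k, τ (a ^ k) = m₁ k) ∧ (∀ k, τ (b ^ k) = m₂ k) ∧ ∀ k, τ ((a + b) ^ k) = m k

/-- The additive free convolution `m₁ ⊞ m₂` of moment sequences. -/
def freeConv (m₁ m₂ : ℕ → ℂ) : ℕ → ℂ := Classical.epsilon (IsFreeConv m₁ m₂)

/-- The free central limit operator `T m = (m ⊞ m) ∘ S_{1/√2}`; the dilation `S_r` multiplies the
`k`-th moment by `r ^ k`. -/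
def freeT (m : ℕ → ℂ) (k : ℕ) : ℂ := freeConv m m k / (Real.sqrt 2 : ℂ) ^ k

/-- The standard semicircle law, with density `√(4 - t²) / (2π)` on `[-2,2]`. -/
def semicircle : Measure ℝ :=
  (volume.restrict (Set.Icc (-2) 2)).withDensity fun t =>
    ENNReal.ofReal (Real.sqrt (4 - t ^ 2) / (2 * Real.pi))

/-- `D` is the linearization (Gâteaux derivative) at `χ` of the map `T` on moment sequences, in the
topology of entrywise convergence, along the directions in `tangentSpace φ χ`. -/
def IsMomentDifferential (φ : ℝ → ℝ) (T : (ℕ → ℂ) → ℕ → ℂ) (χ : Measure ℝ)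
    (D : tangentSpace φ χ →L[ℂ] tangentSpace φ χ) : Prop :=
  ∀ v : tangentSpace φ χ,
    Tendsto
      (fun ε : ℝ => ε⁻¹ • (T (momentSeq χ + ε • l2Moment φ (v : L2 φ)) - T (momentSeq χ)))
      (𝓝[≠] 0) (𝓝 (l2Moment φ (D v : L2 φ)))

end CentralLimit

end

/-!
Both halves rest on one description of the weighted space. For the two weights `φ` the functions
`x^k / φ` are in `L²(φ dx)` and represent the moments, and since the elements of `L²(φ dx)` have
exponential moments, they are determined by their moments (`AdmissibleWeight.ext_l2Moment`). The
closed span of the differences of distributions is the common kernel of the first three moments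
(`IsBasePoint.mem_tangentSpace_iff`): every element dominated by a multiple of the density of `χ`
and with vanishing first three moments is a combination of differences, and dominated elements are
dense. In both cases the differential is the restriction to this space of an operator that is
diagonal in a Hilbert basis, whose first three vectors span the orthogonal complement, with
eigenvalues `2 · 2^{-k/2}`. Only `k ≥ 3` remains on the space, so the norm is at most `2^{-1/2}`
(`exists_restriction_of_diagonal`).

*Classical case.* The density of `T μ` is the value on the diagonal of the bilinear form `convForm`,
`(f, g) ↦ ∫ f((u + v)/√2) g((u - v)/√2) dv`. The rotation of the plane in the integrand preserves
Lebesgue measure and the weight `φ(x) φ(y)`, so the form is bounded on `L²(φ dx)` by the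
Cauchy-Schwarz inequality. Hence `T` is quadratic and its differential at the Gaussian law is twice
the operator `gaussianOp`, `f ↦ convForm f χ`. This operator is symmetric, by the rotation
invariance of the Gaussian law, and by the binomial formula for moments it is triangular on the
vectors `x^k / φ`, with diagonal entries `2^{-k/2}`. The Gram-Schmidt orthogonalization of these
vectors, the Hermite basis, diagonalizes it (`exists_hilbertBasis_of_symmetric`), so that no
explicit Hermite polynomials are needed.

*Free case.* Free cumulants `κ_{n+1}` are introduced through the polynomials `P_n` with
`x P_n = P_{n+1} + ∑_{i ≤ n} κ_{i+1} P_{n-i}` that the functional annihilates for `n ≥ 1`. A pair of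
free elements with prescribed free cumulants lives on the algebraic full Fock space, where `P_n`
creates a word of `n` equal letters; and for every pair of free elements, the map from the Fock
space that sends a word to the alternating product of its `P_n` carries the sum of the Fock
operators to the sum of the elements and the vacuum coefficient to the functional. Thus free
cumulants add (`isFreeConv_momentsOfCumulants_iff`), and `T` multiplies `κ_n` by `2 · 2^{-n/2}`. For
the semicircle law the `P_n` are the Chebyshev polynomials `S_n` of the second kind, and the
derivative of `κ_n` there is the functional given by the Chebyshev polynomial `C_n = S_n - S_{n-2}`
of the first kind (`momentFunctional_deriv_C`). The vectors `C_n / φ` are orthogonal in `L²(φ dx)`,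
because `1 / φ` is the arcsine weight, and they are the basis in which the differential is diagonal.
-/

namespace CentralLimit

/-! ### Complex measures determined by their moments -/

/-- A real integrable function is determined by its Fourier transform. -/
theorem ae_eq_zero_of_forall_integral_mul_cexp {g : ℝ → ℝ} (hg : Integrable g)
    (h : ∀ t : ℝ, ∫ x, (g x : ℂ) * Complex.exp (t * x * Complex.I) = 0) : g =ᵐ[volume] 0 := by
  set μ := volume.withDensity fun x => ENNReal.ofReal (g x) with hμ
  set ν := volume.withDensity fun x => ENNReal.ofReal (-g x) with hν
  have i₁ : IsFiniteMeasure μ := isFiniteMeasure_withDensity_ofReal hg.2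
  have i₂ : IsFiniteMeasure ν := isFiniteMeasure_withDensity_ofReal hg.neg.2
  have hm : AEMeasurable g := hg.aestronglyMeasurable.aemeasurable
  have hexp : ∀ t : ℝ, ∀ f : ℝ → ℝ, Integrable f →
      Integrable fun x : ℝ => (f x : ℂ) * Complex.exp (t * x * Complex.I) := by
    intro t f hf
    refine (hf.ofReal (𝕜 := ℂ)).mul_bdd (c := 1)
      (Continuous.aestronglyMeasurable (by fun_prop)) (ae_of_all _ fun x => ?_)
    have : (t * x * Complex.I : ℂ) = ((t * x : ℝ) : ℂ) * Complex.I := by push_cast; ring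
    rw [this, Complex.norm_exp_ofReal_mul_I]
  -- The positive and the negative part of `g` have the same characteristic function.
  have hE : μ = ν := by
    refine Measure.ext_of_charFun (funext fun t => ?_)
    have key : ∀ f : ℝ → ℝ, Integrable f →
        charFun (volume.withDensity fun x => ENNReal.ofReal (f x)) t =
          ∫ x, ((max (f x) 0 : ℝ) : ℂ) * Complex.exp (t * x * Complex.I) := by
      intro f hf
      rw [charFun_apply_real, integral_withDensity_eq_integral_toReal_smul₀
        hf.aestronglyMeasurable.aemeasurable.ennreal_ofReal (by simp)]
      refine integral_congr_ae (ae_of_all _ fun x => ?_)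
      simp only [ENNReal.toReal_ofReal']
      rw [Complex.real_smul]
    have hn : Integrable fun x => max (-g x) 0 := hg.neg.pos_part
    rw [hμ, hν, key g hg, key (fun x => -g x) hg.neg, ← sub_eq_zero,
      ← integral_sub (hexp t _ hg.pos_part) (hexp t _ hn), ← h t]
    refine integral_congr_ae (ae_of_all _ fun x => ?_)
    beta_reduce
    rw [← sub_mul, ← Complex.ofReal_sub]
    congr 2
    rcases le_total (g x) 0 with h0 | h0
    · rw [max_eq_right h0, max_eq_left (by linarith)]; ring
    · rw [max_eq_left h0, max_eq_right (by linarith)]; ring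
  have h2 := (withDensity_eq_iff (hm.ennreal_ofReal) (hm.neg.ennreal_ofReal)
    (by rw [← lt_top_iff_ne_top]
        have := i₁.measure_univ_lt_top
        rwa [hμ, withDensity_apply _ MeasurableSet.univ, Measure.restrict_univ] at this)).1 hE
  filter_upwards [h2] with x hx
  rcases le_total (g x) 0 with h0 | h0
  · simp only [ENNReal.ofReal_of_nonpos h0, Pi.neg_apply] at hx
    have := ENNReal.ofReal_eq_zero.1 hx.symm
    simp only [Pi.zero_apply]; linarith
  · simp only [Pi.neg_apply, ENNReal.ofReal_of_nonpos (neg_nonpos.2 h0)] at hx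
    have := ENNReal.ofReal_eq_zero.1 hx
    simp only [Pi.zero_apply]; linarith

/-- A real function with all exponential moments is determined by its moments. -/
theorem ae_eq_zero_of_forall_moment_real {g : ℝ → ℝ} (hm : AEStronglyMeasurable g volume)
    (hg : ∀ a : ℝ, Integrable fun x => Real.exp (a * |x|) * |g x|)
    (h : ∀ k : ℕ, ∫ x, x ^ k * g x = 0) : g =ᵐ[volume] 0 := by
  have hg0 : Integrable g := by
    have := hg 0
    simp only [zero_mul, Real.exp_zero, one_mul] at this
    exact (integrable_norm_iff hm).1 (by simpa using this)
  refine ae_eq_zero_of_forall_integral_mul_cexp hg0 fun t => ?_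
  -- The exponential moments dominate the power series of the Fourier transform.
  have hs : HasSum (fun k : ℕ => ∫ x : ℝ, (g x : ℂ) * ((t * x * Complex.I) ^ k / k.factorial))
      (∫ x : ℝ, (g x : ℂ) * Complex.exp (t * x * Complex.I)) := by
    refine hasSum_integral_of_dominated_convergence
      (fun (k : ℕ) x => |g x| * ((|t| * |x|) ^ k / k.factorial)) ?_ ?_ ?_ ?_ ?_
    · intro k
      exact (Complex.continuous_ofReal.comp_aestronglyMeasurable hm).mul
        (Continuous.aestronglyMeasurable (by fun_prop))
    · intro k
      refine ae_of_all _ fun x => ?_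
      simp
    · refine ae_of_all _ fun x => ?_
      exact (Real.summable_pow_div_factorial _).mul_left _
    · have : (fun x => ∑' k : ℕ, |g x| * ((|t| * |x|) ^ k / k.factorial)) =
          fun x => Real.exp (|t| * |x|) * |g x| := by
        funext x
        rw [tsum_mul_left, Real.exp_eq_exp_ℝ, NormedSpace.exp_eq_tsum_div, mul_comm]
      rw [this]
      exact hg _
    · refine ae_of_all _ fun x => ?_
      rw [Complex.exp_eq_exp_ℂ]
      exact (NormedSpace.expSeries_div_hasSum_exp (t * x * Complex.I : ℂ)).mul_left _
  have hz : (fun k : ℕ => ∫ x : ℝ, (g x : ℂ) * ((t * x * Complex.I) ^ k / k.factorial)) =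
      fun _ => 0 := by
    funext k
    have : ∀ x : ℝ, (g x : ℂ) * ((t * x * Complex.I) ^ k / k.factorial) =
        ((t * Complex.I) ^ k / k.factorial) * ((x ^ k * g x : ℝ) : ℂ) := by
      intro x; push_cast; ring
    simp_rw [this]
    rw [integral_const_mul, integral_complex_ofReal, h k]; simp
  rw [hz] at hs
  exact hs.unique hasSum_zero

/-- A complex function with all exponential moments is determined by its moments. -/
theorem ae_eq_zero_of_forall_moment {f : ℝ → ℂ} (hm : AEStronglyMeasurable f volume)
    (hf : ∀ a : ℝ, Integrable fun x => Real.exp (a * |x|) * ‖f x‖)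
    (hint : ∀ k : ℕ, Integrable fun x : ℝ => (x : ℂ) ^ k * f x)
    (h : ∀ k : ℕ, ∫ x : ℝ, (x : ℂ) ^ k * f x = 0) : f =ᵐ[volume] 0 := by
  have hre : (fun x => (f x).re) =ᵐ[volume] 0 := by
    refine ae_eq_zero_of_forall_moment_real (Complex.continuous_re.comp_aestronglyMeasurable hm)
      (fun a => ?_) fun k => ?_
    · refine (hf a).mono ((Continuous.aestronglyMeasurable (by fun_prop)).mul
        (Complex.continuous_re.comp_aestronglyMeasurable hm).norm) (ae_of_all _ fun x => ?_)
      simp only [norm_mul, Real.norm_eq_abs, abs_abs, abs_norm]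
      gcongr
      exact Complex.abs_re_le_norm _
    · have := congrArg Complex.re (h k)
      rw [← RCLike.re_eq_complex_re, ← integral_re (hint k)] at this
      refine Eq.trans ?_ (this.trans (by simp))
      refine integral_congr_ae (ae_of_all _ fun x => ?_)
      simp only [RCLike.re_eq_complex_re, ← Complex.ofReal_pow, Complex.re_ofReal_mul]
  have him : (fun x => (f x).im) =ᵐ[volume] 0 := by
    refine ae_eq_zero_of_forall_moment_real (Complex.continuous_im.comp_aestronglyMeasurable hm)
      (fun a => ?_) fun k => ?_
    · refine (hf a).mono ((Continuous.aestronglyMeasurable (by fun_prop)).mul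
        (Complex.continuous_im.comp_aestronglyMeasurable hm).norm) (ae_of_all _ fun x => ?_)
      simp only [norm_mul, Real.norm_eq_abs, abs_abs, abs_norm]
      gcongr
      exact Complex.abs_im_le_norm _
    · have := congrArg Complex.im (h k)
      rw [← RCLike.im_eq_complex_im, ← integral_im (hint k)] at this
      refine Eq.trans ?_ (this.trans (by simp))
      refine integral_congr_ae (ae_of_all _ fun x => ?_)
      simp only [RCLike.im_eq_complex_im, ← Complex.ofReal_pow, Complex.im_ofReal_mul]
  filter_upwards [hre, him] with x h1 h2
  exact Complex.ext h1 h2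

/-! ### Admissible weights and moment vectors -/

/-- A weight on the line whose `L²` space has finite exponential moments: `e^{a|x|} / φ` is in
`L²(φ dx)` for all `a`. Off the support of `φ` the quotient is `0`. -/
structure AdmissibleWeight (φ : ℝ → ℝ) : Prop where
  measurable : Measurable φ
  nonneg : ∀ x, 0 ≤ φ x
  memLp_exp : ∀ a : ℝ, MemLp (fun x => Real.exp (a * |x|) / φ x) 2 (weightMeasure φ)

namespace AdmissibleWeight

variable {φ : ℝ → ℝ}

theorem ae_iff (hφ : AdmissibleWeight φ) {p : ℝ → Prop} :
    (∀ᵐ x ∂weightMeasure φ, p x) ↔ ∀ᵐ x, φ x ≠ 0 → p x := by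
  rw [weightMeasure, ae_withDensity_iff hφ.measurable.ennreal_ofReal]
  refine eventually_congr (ae_of_all _ fun x => ?_)
  rw [ne_eq, ENNReal.ofReal_eq_zero, ne_eq, (hφ.nonneg x).ge_iff_eq']

theorem absolutelyContinuous (φ : ℝ → ℝ) : weightMeasure φ ≪ volume :=
  withDensity_absolutelyContinuous _ _

theorem integrable_iff {E : Type*} [NormedAddCommGroup E] [NormedSpace ℝ E]
    (hφ : AdmissibleWeight φ) {g : ℝ → E} :
    Integrable g (weightMeasure φ) ↔ Integrable fun x => φ x • g x := by
  rw [weightMeasure, integrable_withDensity_iff_integrable_smul' hφ.measurable.ennreal_ofReal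
    (by simp)]
  simp_rw [ENNReal.toReal_ofReal (hφ.nonneg _)]

theorem integral_eq {E : Type*} [NormedAddCommGroup E] [NormedSpace ℝ E]
    (hφ : AdmissibleWeight φ) (g : ℝ → E) :
    ∫ x, g x ∂weightMeasure φ = ∫ x, φ x • g x := by
  rw [weightMeasure, integral_withDensity_eq_integral_toReal_smul hφ.measurable.ennreal_ofReal
    (by simp)]
  simp_rw [ENNReal.toReal_ofReal (hφ.nonneg _)]

theorem measurableSet_support (hφ : AdmissibleWeight φ) : MeasurableSet (Function.support φ) :=
  _root_.measurableSet_support hφ.measurable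

/-- Multiplying by the weight and dividing by it leaves the indicator of its support. -/
theorem smul_div_mul (h f : ℝ → ℂ) (x : ℝ) :
    φ x • (h x / φ x * f x) = (Function.support φ).indicator (fun x => h x * f x) x := by
  by_cases hx : φ x = 0
  · simp [hx]
  · have : (φ x : ℂ) ≠ 0 := by exact_mod_cast hx
    rw [Set.indicator_of_mem (by simpa using hx), Complex.real_smul]
    field_simp

theorem integrableOn_mul (hφ : AdmissibleWeight φ) {h f : ℝ → ℂ}
    (hh : MemLp (fun x => h x / φ x) 2 (weightMeasure φ)) (hf : MemLp f 2 (weightMeasure φ)) :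
    IntegrableOn (fun x => h x * f x) (Function.support φ) := by
  have := hφ.integrable_iff.1 (hh.integrable_mul hf)
  rw [← integrable_indicator_iff hφ.measurableSet_support]
  refine this.congr (ae_of_all _ fun x => ?_)
  exact smul_div_mul h f x

theorem setIntegral_mul (hφ : AdmissibleWeight φ) (h f : ℝ → ℂ) :
    ∫ x in Function.support φ, h x * f x = ∫ x, h x / φ x * f x ∂weightMeasure φ := by
  rw [hφ.integral_eq, ← integral_indicator hφ.measurableSet_support]
  exact integral_congr_ae (ae_of_all _ fun x => (smul_div_mul h f x).symm)

theorem memLp_of_le_exp (hφ : AdmissibleWeight φ) {h : ℝ → ℂ} (hm : Measurable h) {C a : ℝ}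
    (hC : ∀ x, ‖h x‖ ≤ C * Real.exp (a * |x|)) :
    MemLp (fun x => h x / φ x) 2 (weightMeasure φ) := by
  refine ((hφ.memLp_exp a).const_mul C).mono
    (hm.div (Complex.measurable_ofReal.comp hφ.measurable)).aestronglyMeasurable
    (ae_of_all _ fun x => ?_)
  rw [norm_div, Complex.norm_real, ← mul_div_assoc, norm_div]
  gcongr
  exact (hC x).trans (le_abs_self _)

theorem memLp_pow (hφ : AdmissibleWeight φ) (k : ℕ) :
    MemLp (fun x : ℝ => (x : ℂ) ^ k / φ x) 2 (weightMeasure φ) := by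
  refine hφ.memLp_of_le_exp (C := k.factorial) (a := 1) (by fun_prop) fun x => ?_
  have := Real.pow_div_factorial_le_exp |x| (abs_nonneg x) k
  rw [div_le_iff₀ (by positivity)] at this
  simpa [mul_comm] using this

/-- The vector `x^k / φ(x)` of `L²(φ dx)`, which represents the `k`-th moment. -/
noncomputable def monomialVec (hφ : AdmissibleWeight φ) (k : ℕ) : L2 φ :=
  (hφ.memLp_pow k).toLp

theorem coeFn_monomialVec (hφ : AdmissibleWeight φ) (k : ℕ) :
    hφ.monomialVec k =ᵐ[weightMeasure φ] fun x => (x : ℂ) ^ k / φ x :=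
  (hφ.memLp_pow k).coeFn_toLp

theorem inner_monomialVec (hφ : AdmissibleWeight φ) (k : ℕ) (f : L2 φ) :
    inner ℂ (hφ.monomialVec k) f = l2Moment φ f k := by
  rw [l2Moment, hφ.setIntegral_mul, L2.inner_def]
  refine integral_congr_ae ?_
  filter_upwards [hφ.coeFn_monomialVec k] with x hx
  rw [hx, RCLike.inner_apply, mul_comm]
  simp

theorem integrableOn_pow_mul (hφ : AdmissibleWeight φ) (f : L2 φ) (k : ℕ) :
    IntegrableOn (fun x : ℝ => (x : ℂ) ^ k * f x) (Function.support φ) :=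
  hφ.integrableOn_mul (hφ.memLp_pow k) (Lp.memLp f)

theorem l2Moment_add (hφ : AdmissibleWeight φ) (f g : L2 φ) :
    l2Moment φ (f + g) = l2Moment φ f + l2Moment φ g := by
  funext k; simp [← hφ.inner_monomialVec, inner_add_right]

theorem l2Moment_sub (hφ : AdmissibleWeight φ) (f g : L2 φ) :
    l2Moment φ (f - g) = l2Moment φ f - l2Moment φ g := by
  funext k; simp [← hφ.inner_monomialVec, inner_sub_right]

theorem l2Moment_smul (hφ : AdmissibleWeight φ) (c : ℂ) (f : L2 φ) :
    l2Moment φ (c • f) = c • l2Moment φ f := by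
  funext k; simp [← hφ.inner_monomialVec, inner_smul_right]

/-- An element of `L²(φ dx)` is determined by its moments. -/
theorem eq_zero_of_l2Moment_eq_zero (hφ : AdmissibleWeight φ) {f : L2 φ}
    (h : ∀ k, l2Moment φ f k = 0) : f = 0 := by
  set F : ℝ → ℂ := (Function.support φ).indicator f with hF
  have hind : ∀ h : ℝ → ℂ, (fun x => h x * F x) =
      (Function.support φ).indicator fun x => h x * f x := by
    intro h; funext x
    by_cases hx : x ∈ Function.support φ <;> simp [hF, hx]
  have hI : ∀ k : ℕ, Integrable fun x : ℝ => (x : ℂ) ^ k * F x := by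
    intro k
    rw [hind fun x => (x : ℂ) ^ k, integrable_indicator_iff hφ.measurableSet_support]
    exact hφ.integrableOn_pow_mul f k
  have hF0 : F =ᵐ[volume] 0 := by
    refine ae_eq_zero_of_forall_moment (by simpa using (hI 0).aestronglyMeasurable) (fun a => ?_)
      hI fun k => ?_
    · have hE : Integrable fun x : ℝ => (Real.exp (a * |x|) : ℂ) * F x := by
        rw [hind fun x => (Real.exp (a * |x|) : ℂ),
          integrable_indicator_iff hφ.measurableSet_support]
        refine hφ.integrableOn_mul (hφ.memLp_of_le_exp (C := 1) (a := a) (by fun_prop)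
          fun x => ?_) (Lp.memLp f)
        rw [Complex.norm_real, Real.norm_eq_abs, abs_of_pos (Real.exp_pos _), one_mul]
      refine hE.norm.congr (ae_of_all _ fun x => ?_)
      simp only [norm_mul, Complex.norm_real, Real.norm_eq_abs, abs_of_pos (Real.exp_pos _)]
    · rw [hind fun x => (x : ℂ) ^ k, integral_indicator hφ.measurableSet_support]
      exact h k
  rw [Lp.eq_zero_iff_ae_eq_zero, EventuallyEq, hφ.ae_iff]
  filter_upwards [hF0] with x hx h0
  rwa [hF, Set.indicator_of_mem (by simpa using h0)] at hx

theorem ext_l2Moment (hφ : AdmissibleWeight φ) {f g : L2 φ}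
    (h : l2Moment φ f = l2Moment φ g) : f = g := by
  rw [← sub_eq_zero]
  refine hφ.eq_zero_of_l2Moment_eq_zero fun k => ?_
  rw [hφ.l2Moment_sub, h, sub_self, Pi.zero_apply]

/-! ### Distributions in a weighted space -/

/-- A measure in `L²(φ)` has a density supported in the support of `φ`, and this density
represents it in `L²(φ dx)`. -/
theorem exists_density (hφ : AdmissibleWeight φ) {μ : Measure ℝ} [IsFiniteMeasure μ]
    (h : InL2 φ μ) : ∃ f : ℝ → ℝ, Measurable f ∧ (∀ x, 0 ≤ f x) ∧ (∀ x, φ x = 0 → f x = 0) ∧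
      μ = volume.withDensity (fun x => ENNReal.ofReal (f x)) ∧
      MemLp (fun x => (f x : ℂ)) 2 (weightMeasure φ) ∧
      density φ μ =ᵐ[weightMeasure φ] fun x => (f x : ℂ) := by
  obtain ⟨hac, hL⟩ := h
  have hz : ∀ᵐ x, φ x = 0 → μ.rnDeriv volume x = 0 := by
    have h0 : μ {x | φ x = 0} = 0 := by
      apply hac
      have : ∀ᵐ x ∂weightMeasure φ, φ x ≠ 0 := hφ.ae_iff.2 (ae_of_all _ fun x h => h)
      simpa using (MeasureTheory.ae_iff.1 this)
    have hS : MeasurableSet {x | φ x = 0} := hφ.measurable (measurableSet_singleton 0)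
    rw [← Measure.withDensity_rnDeriv_eq μ volume (hac.trans (absolutelyContinuous φ)),
      withDensity_apply _ hS, lintegral_eq_zero_iff (Measure.measurable_rnDeriv _ _)] at h0
    exact (ae_restrict_iff' hS).1 h0
  refine ⟨(Function.support φ).indicator fun x => (μ.rnDeriv volume x).toReal,
    (Measure.measurable_rnDeriv _ _).ennreal_toReal.indicator hφ.measurableSet_support,
    fun x => Set.indicator_nonneg (fun _ _ => ENNReal.toReal_nonneg) x,
    fun x hx => by simp [hx], ?_, ?_⟩
  · conv_lhs => rw [← Measure.withDensity_rnDeriv_eq μ volume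
      (hac.trans (absolutelyContinuous φ))]
    refine withDensity_congr_ae ?_
    filter_upwards [hz, Measure.rnDeriv_lt_top μ volume] with x hx hx'
    by_cases h0 : φ x = 0
    · simp [h0, hx h0]
    · rw [Set.indicator_of_mem (by simpa using h0), ENNReal.ofReal_toReal hx'.ne]
  · have he : (fun x => ((μ.rnDeriv volume x).toReal : ℂ)) =ᵐ[weightMeasure φ] fun x =>
        (((Function.support φ).indicator (fun x => (μ.rnDeriv volume x).toReal) x : ℝ) : ℂ) := by
      rw [EventuallyEq, hφ.ae_iff]
      refine ae_of_all _ fun x hx => ?_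
      rw [Set.indicator_of_mem (by simpa using hx)]
    refine ⟨(memLp_congr_ae he).1 hL, ?_⟩
    rw [density, dif_pos hL]
    exact hL.coeFn_toLp.trans he

theorem inL2_withDensity (hφ : AdmissibleWeight φ) {f : ℝ → ℝ} (hf : Measurable f)
    (h0 : ∀ x, 0 ≤ f x) (hz : ∀ x, φ x = 0 → f x = 0)
    (hL : MemLp (fun x => (f x : ℂ)) 2 (weightMeasure φ)) :
    InL2 φ (volume.withDensity fun x => ENNReal.ofReal (f x)) ∧
      density φ (volume.withDensity fun x => ENNReal.ofReal (f x)) =ᵐ[weightMeasure φ]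
        fun x => (f x : ℂ) := by
  have he : (fun x => (((volume.withDensity fun x => ENNReal.ofReal (f x)).rnDeriv
      volume x).toReal : ℂ)) =ᵐ[weightMeasure φ] fun x => (f x : ℂ) := by
    refine (absolutelyContinuous φ).ae_le ?_
    filter_upwards [Measure.rnDeriv_withDensity volume hf.ennreal_ofReal] with x hx
    rw [hx, ENNReal.toReal_ofReal (h0 x)]
  have hL' := (memLp_congr_ae he).2 hL
  refine ⟨⟨?_, hL'⟩, ?_⟩
  · refine Measure.AbsolutelyContinuous.mk fun s hs h => ?_
    rw [weightMeasure, withDensity_apply _ hs,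
      lintegral_eq_zero_iff hφ.measurable.ennreal_ofReal] at h
    rw [withDensity_apply _ hs, lintegral_eq_zero_iff hf.ennreal_ofReal]
    filter_upwards [h] with x hx
    simp only [Pi.zero_apply, ENNReal.ofReal_eq_zero] at hx ⊢
    exact (hz x (le_antisymm hx (hφ.nonneg x))).le
  · rw [density, dif_pos hL']
    exact hL'.coeFn_toLp.trans he

theorem integral_withDensity_ofReal {f : ℝ → ℝ} (hf : Measurable f) (h0 : ∀ x, 0 ≤ f x)
    (g : ℝ → ℝ) :
    ∫ x, g x ∂(volume.withDensity fun x => ENNReal.ofReal (f x)) = ∫ x, g x * f x := by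
  rw [integral_withDensity_eq_integral_toReal_smul hf.ennreal_ofReal (by simp)]
  refine integral_congr_ae (ae_of_all _ fun x => ?_)
  simp [ENNReal.toReal_ofReal (h0 x), mul_comm]

/-- Moments of an element of `L²(φ dx)` that is represented by a function supported in the
support of `φ`. -/
theorem l2Moment_eq_integral (hφ : AdmissibleWeight φ) {f : L2 φ} {g : ℝ → ℂ}
    (hfg : f =ᵐ[weightMeasure φ] g) (hz : ∀ x, φ x = 0 → g x = 0) (k : ℕ) :
    l2Moment φ f k = ∫ x : ℝ, (x : ℂ) ^ k * g x := by
  rw [l2Moment, ← integral_indicator hφ.measurableSet_support]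
  rw [EventuallyEq, hφ.ae_iff] at hfg
  refine integral_congr_ae ?_
  filter_upwards [hfg] with x hx
  by_cases h0 : φ x = 0
  · simp [h0, hz x h0]
  · rw [Set.indicator_of_mem (by simpa using h0), hx h0]

theorem integrable_pow_mul (hφ : AdmissibleWeight φ) {g : ℝ → ℂ}
    (hg : MemLp g 2 (weightMeasure φ)) (hz : ∀ x, φ x = 0 → g x = 0) (k : ℕ) :
    Integrable fun x : ℝ => (x : ℂ) ^ k * g x := by
  have := hφ.integrableOn_mul (hφ.memLp_pow k) hg
  rw [← integrable_indicator_iff hφ.measurableSet_support] at this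
  refine this.congr (ae_of_all _ fun x => ?_)
  by_cases h0 : φ x = 0
  · simp [h0, hz x h0]
  · rw [Set.indicator_of_mem (by simpa using h0)]

theorem l2Moment_density (hφ : AdmissibleWeight φ) {μ : Measure ℝ} [IsFiniteMeasure μ]
    (h : InL2 φ μ) : l2Moment φ (density φ μ) = momentSeq μ := by
  obtain ⟨f, hf, h0, hz, hμ, hL, hd⟩ := hφ.exists_density h
  funext k
  rw [hφ.l2Moment_eq_integral hd (fun x hx => by simp [hz x hx]), momentSeq, hμ,
    integral_withDensity_ofReal hf h0, ← integral_complex_ofReal]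
  refine integral_congr_ae (ae_of_all _ fun x => ?_)
  push_cast; rfl

theorem momentSeq_zero {μ : Measure ℝ} [IsProbabilityMeasure μ] : momentSeq μ 0 = 1 := by
  simp [momentSeq]

end AdmissibleWeight

theorem momentSeq_of_mem_distributions {φ : ℝ → ℝ} {μ : Measure ℝ} (h : μ ∈ distributions φ) :
    momentSeq μ 0 = 1 ∧ momentSeq μ 1 = 0 ∧ momentSeq μ 2 = 1 := by
  obtain ⟨h1, -, h2, h3⟩ := h
  simp [momentSeq, h2, h3]

/-! ### The space of directions at a distribution -/

namespace AdmissibleWeight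

variable {φ : ℝ → ℝ}

/-- A nonnegative function in `L²(φ dx)` with the right first three moments is the density of a
distribution. -/
theorem mem_distributions_of_l2Moment (hφ : AdmissibleWeight φ) {f : ℝ → ℝ} (hf : Measurable f)
    (h0 : ∀ x, 0 ≤ f x) (hz : ∀ x, φ x = 0 → f x = 0) {u : L2 φ}
    (hu : u =ᵐ[weightMeasure φ] fun x => (f x : ℂ)) (m0 : l2Moment φ u 0 = 1)
    (m1 : l2Moment φ u 1 = 0) (m2 : l2Moment φ u 2 = 1) :
    (volume.withDensity fun x => ENNReal.ofReal (f x)) ∈ distributions φ ∧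
      density φ (volume.withDensity fun x => ENNReal.ofReal (f x)) = u := by
  have hfL : MemLp (fun x => (f x : ℂ)) 2 (weightMeasure φ) := (memLp_congr_ae hu).1 (Lp.memLp u)
  set μ := volume.withDensity fun x => ENNReal.ofReal (f x) with hμ
  obtain ⟨hμL, hμd⟩ := hφ.inL2_withDensity hf h0 hz hfL
  have hfi : Integrable f := by
    have := hφ.integrable_pow_mul hfL (fun x hx => by simp [hz x hx]) 0
    simpa using this.re
  have hfin : IsFiniteMeasure μ := isFiniteMeasure_withDensity_ofReal hfi.2
  have hd : density φ μ = u := Lp.ext (hμd.trans hu.symm)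
  rw [← hd, hφ.l2Moment_density hμL] at m0 m1 m2
  refine ⟨⟨?_, hμL, ?_, ?_⟩, hd⟩
  · simp only [momentSeq, pow_zero, integral_const, smul_eq_mul, mul_one] at m0
    have : μ.real Set.univ = 1 := by exact_mod_cast m0
    exact ⟨by rwa [measureReal_def, ENNReal.toReal_eq_one_iff] at this⟩
  · simp only [momentSeq, pow_one] at m1
    exact_mod_cast m1
  · simp only [momentSeq] at m2
    exact_mod_cast m2

/-- A density `c` that vanishes exactly where the weight `φ` does, and that represents a
distribution in `L²(φ)` with mean `0` and variance `1`. -/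
structure IsBasePoint (φ c : ℝ → ℝ) : Prop where
  measurable : Measurable c
  nonneg : ∀ x, 0 ≤ c x
  eq_zero_iff : ∀ x, c x = 0 ↔ φ x = 0
  memLp : MemLp (fun x => (c x : ℂ)) 2 (weightMeasure φ)
  mem_distributions : (volume.withDensity fun x => ENNReal.ofReal (c x)) ∈ distributions φ

namespace IsBasePoint

variable {c : ℝ → ℝ}

theorem density_ae (hφ : AdmissibleWeight φ) (hc : IsBasePoint φ c) :
    density φ (volume.withDensity fun x => ENNReal.ofReal (c x)) =ᵐ[weightMeasure φ]
      fun x => (c x : ℂ) :=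
  (hφ.inL2_withDensity hc.measurable hc.nonneg (fun x => (hc.eq_zero_iff x).2) hc.memLp).2

/-- A real direction dominated by a multiple of the base point is a multiple of a difference of
distributions. -/
theorem mem_span_of_real (hφ : AdmissibleWeight φ) (hc : IsBasePoint φ c) {h : ℝ → ℝ}
    (hm : Measurable h) {C : ℝ} (hC : ∀ x, |h x| ≤ C * c x) {u : L2 φ}
    (hu : u =ᵐ[weightMeasure φ] fun x => (h x : ℂ)) (hmom : ∀ k < 3, l2Moment φ u k = 0) :
    u ∈ Submodule.span ℂ {v | ∃ μ ∈ distributions φ, v = density φ μ -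
      density φ (volume.withDensity fun x => ENNReal.ofReal (c x))} := by
  set χ := volume.withDensity fun x => ENNReal.ofReal (c x) with hχ
  set R := |C| + 1 with hR
  have hR0 : 0 < R := by positivity
  have hb : ∀ x, |h x| ≤ R * c x := fun x => (hC x).trans
    (mul_le_mul_of_nonneg_right ((le_abs_self C).trans (by linarith)) (hc.nonneg x))
  -- As `|h| ≤ R c`, adding `R⁻¹ h` to `c` keeps it nonnegative.
  set f : ℝ → ℝ := fun x => c x + R⁻¹ * h x with hf
  have hfm : Measurable f := hc.measurable.add (hm.const_mul _)
  have hf0 : ∀ x, 0 ≤ f x := by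
    intro x
    have h1 : R⁻¹ * |h x| ≤ c x := by
      rw [inv_mul_le_iff₀ hR0]; exact hb x
    have h2 : R⁻¹ * -h x ≤ R⁻¹ * |h x| :=
      mul_le_mul_of_nonneg_left (neg_le_abs _) (inv_nonneg.2 hR0.le)
    simp only [hf]; linarith
  have hfz : ∀ x, φ x = 0 → f x = 0 := by
    intro x hx
    have h0 := (hc.eq_zero_iff x).2 hx
    have : h x = 0 := by
      have := hb x
      rw [h0, mul_zero] at this
      exact abs_eq_zero.1 (le_antisymm this (abs_nonneg _))
    simp [hf, h0, this]
  have hprob : IsProbabilityMeasure χ := hc.mem_distributions.1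
  have hmom : ∀ k < 3, l2Moment φ (density φ χ + (R⁻¹ : ℂ) • u) k = momentSeq χ k := by
    intro k hk
    rw [hφ.l2Moment_add, hφ.l2Moment_smul, Pi.add_apply,
      Pi.smul_apply, hmom k hk, hφ.l2Moment_density hc.mem_distributions.2.1, smul_zero, add_zero]
  obtain ⟨c0, c1, c2⟩ := momentSeq_of_mem_distributions hc.mem_distributions
  obtain ⟨hμmem, hd⟩ := hφ.mem_distributions_of_l2Moment hfm hf0 hfz
    (u := density φ χ + (R⁻¹ : ℂ) • u) (by
      filter_upwards [hc.density_ae hφ, hu, Lp.coeFn_add (density φ χ) ((R⁻¹ : ℂ) • u),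
        Lp.coeFn_smul (R⁻¹ : ℂ) u] with x h2 h3 h4 h5
      rw [h4, Pi.add_apply, h5, Pi.smul_apply, h2, h3, hf]
      simp) ((hmom 0 (by norm_num)).trans c0) ((hmom 1 (by norm_num)).trans c1)
    ((hmom 2 (by norm_num)).trans c2)
  set μ := volume.withDensity fun x => ENNReal.ofReal (f x) with hμ
  have hu' : u = (R : ℂ) • (density φ μ - density φ χ) := by
    rw [hd, add_sub_cancel_left, smul_smul, mul_inv_cancel₀ (by exact_mod_cast hR0.ne'), one_smul]
  rw [hu']
  exact Submodule.smul_mem _ _ (Submodule.subset_span ⟨μ, hμmem, rfl⟩)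

/-- A complex direction dominated by a multiple of the base point is a combination of differences
of distributions. -/
theorem mem_span_of_bounded (hφ : AdmissibleWeight φ) (hc : IsBasePoint φ c) {u : L2 φ} {C : ℝ}
    (hC : ∀ᵐ x ∂weightMeasure φ, ‖u x‖ ≤ C * c x) (hmom : ∀ k < 3, l2Moment φ u k = 0) :
    u ∈ Submodule.span ℂ {v | ∃ μ ∈ distributions φ, v = density φ μ -
      density φ (volume.withDensity fun x => ENNReal.ofReal (c x))} := by
  have hum : Measurable u := (Lp.stronglyMeasurable u).measurable
  have hS : MeasurableSet {x | ‖u x‖ ≤ C * c x} :=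
    measurableSet_le hum.norm (hc.measurable.const_mul C)
  set F : ℝ → ℂ := {x | ‖u x‖ ≤ C * c x}.indicator u with hF
  have hFm : Measurable F := hum.indicator hS
  have huF : u =ᵐ[weightMeasure φ] F := by
    filter_upwards [hC] with x hx
    rw [hF, Set.indicator_of_mem (by exact hx)]
  have hFb : ∀ x, ‖F x‖ ≤ |C| * c x := by
    intro x
    by_cases hx : x ∈ {x | ‖u x‖ ≤ C * c x}
    · rw [hF, Set.indicator_of_mem hx]
      exact (show ‖u x‖ ≤ C * c x from hx).trans
        (mul_le_mul_of_nonneg_right (le_abs_self C) (hc.nonneg x))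
    · rw [hF, Set.indicator_of_notMem hx, norm_zero]
      exact mul_nonneg (abs_nonneg _) (hc.nonneg x)
  have hFL : MemLp F 2 (weightMeasure φ) := (memLp_congr_ae huF).1 (Lp.memLp u)
  have hFz : ∀ x, φ x = 0 → F x = 0 := by
    intro x hx
    have := hFb x
    rw [(hc.eq_zero_iff x).2 hx, mul_zero] at this
    exact norm_eq_zero.1 (le_antisymm this (norm_nonneg _))
  have hre : MemLp (fun x => ((F x).re : ℂ)) 2 (weightMeasure φ) :=
    hFL.mono (by fun_prop) (ae_of_all _ fun x => by
      simpa using Complex.abs_re_le_norm (F x))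
  have him : MemLp (fun x => ((F x).im : ℂ)) 2 (weightMeasure φ) :=
    hFL.mono (by fun_prop) (ae_of_all _ fun x => by
      simpa using Complex.abs_im_le_norm (F x))
  have hmF : ∀ k < 3, ∫ x : ℝ, (x : ℂ) ^ k * F x = 0 := fun k hk => by
    rw [← hφ.l2Moment_eq_integral huF hFz, hmom k hk]
  have hiF := fun k => hφ.integrable_pow_mul hFL hFz k
  have e : u = hre.toLp + Complex.I • him.toLp := by
    refine Lp.ext ?_
    filter_upwards [huF, hre.coeFn_toLp, him.coeFn_toLp,
      Lp.coeFn_add hre.toLp (Complex.I • him.toLp),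
      Lp.coeFn_smul Complex.I him.toLp] with x h1 h2 h3 h4 h5
    rw [h1, h4, Pi.add_apply, h5, Pi.smul_apply, h2, h3, smul_eq_mul, mul_comm, Complex.re_add_im]
  rw [e]
  refine Submodule.add_mem _ ?_ (Submodule.smul_mem _ _ ?_)
  · refine hc.mem_span_of_real hφ (h := fun x => (F x).re) (by fun_prop)
      (fun x => (Complex.abs_re_le_norm _).trans (hFb x)) hre.coeFn_toLp fun k hk => ?_
    rw [hφ.l2Moment_eq_integral hre.coeFn_toLp fun x hx => by simp [hFz x hx]]
    have := congrArg Complex.re (hmF k hk)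
    rw [← RCLike.re_eq_complex_re, ← integral_re (hiF k)] at this
    have h2 := congrArg Complex.ofReal (this.trans (by simp : RCLike.re (0 : ℂ) = (0 : ℝ)))
    rw [← integral_complex_ofReal] at h2
    refine Eq.trans (integral_congr_ae (ae_of_all _ fun x => ?_)) (h2.trans (by simp))
    simp only [RCLike.re_eq_complex_re, ← Complex.ofReal_pow, Complex.re_ofReal_mul]
    push_cast; rfl
  · refine hc.mem_span_of_real hφ (h := fun x => (F x).im) (by fun_prop)
      (fun x => (Complex.abs_im_le_norm _).trans (hFb x)) him.coeFn_toLp fun k hk => ?_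
    rw [hφ.l2Moment_eq_integral him.coeFn_toLp fun x hx => by simp [hFz x hx]]
    have := congrArg Complex.im (hmF k hk)
    rw [← RCLike.im_eq_complex_im, ← integral_im (hiF k)] at this
    have h2 := congrArg Complex.ofReal (this.trans (by simp : RCLike.im (0 : ℂ) = (0 : ℝ)))
    rw [← integral_complex_ofReal] at h2
    refine Eq.trans (integral_congr_ae (ae_of_all _ fun x => ?_)) (h2.trans (by simp))
    simp only [RCLike.im_eq_complex_im, ← Complex.ofReal_pow, Complex.im_ofReal_mul]
    push_cast; rfl

/-- The elements of `L²(φ dx)` dominated by a multiple of `c`. -/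
def dominated (φ c : ℝ → ℝ) : Submodule ℂ (L2 φ) where
  carrier := {f | ∃ C : ℝ, ∀ᵐ x ∂weightMeasure φ, ‖f x‖ ≤ C * c x}
  add_mem' := by
    rintro f g ⟨C, hC⟩ ⟨C', hC'⟩
    refine ⟨C + C', ?_⟩
    filter_upwards [hC, hC', Lp.coeFn_add f g] with x h1 h2 h3
    rw [h3, Pi.add_apply, add_mul]
    exact (norm_add_le _ _).trans (add_le_add h1 h2)
  zero_mem' := by
    refine ⟨0, ?_⟩
    filter_upwards [Lp.coeFn_zero ℂ 2 (weightMeasure φ)] with x h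
    rw [h]; simp
  smul_mem' := by
    rintro a f ⟨C, hC⟩
    refine ⟨‖a‖ * C, ?_⟩
    filter_upwards [hC, Lp.coeFn_smul a f] with x h1 h2
    rw [h2, Pi.smul_apply, norm_smul, mul_assoc]
    gcongr

/-- The dominated elements are dense: they contain the truncations of `g` to the sets
`{‖g‖ ≤ n c}`, which exhaust the support of the weight. -/
theorem eq_zero_of_orthogonal_dominated (hφ : AdmissibleWeight φ) (hc : IsBasePoint φ c)
    {g : L2 φ} (hg : ∀ f ∈ dominated φ c, inner ℂ g f = 0) : g = 0 := by
  have hgm : Measurable g := (Lp.stronglyMeasurable g).measurable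
  have hS : ∀ n : ℕ, MeasurableSet {x | ‖g x‖ ≤ n * c x} := fun n =>
    measurableSet_le hgm.norm (hc.measurable.const_mul _)
  have hz : ∀ n : ℕ, ∀ᵐ x ∂weightMeasure φ, ‖g x‖ ≤ n * c x → g x = 0 := by
    intro n
    have hL : MemLp ({x | ‖g x‖ ≤ n * c x}.indicator g) 2 (weightMeasure φ) :=
      (Lp.memLp g).indicator (hS n)
    have hd : hL.toLp ∈ dominated φ c := by
      refine ⟨n, ?_⟩
      filter_upwards [hL.coeFn_toLp] with x hx
      rw [hx]
      by_cases h : x ∈ {x | ‖g x‖ ≤ n * c x}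
      · rw [Set.indicator_of_mem h]; exact h
      · rw [Set.indicator_of_notMem h, norm_zero]
        exact mul_nonneg n.cast_nonneg (hc.nonneg x)
    have h0 : inner ℂ hL.toLp hL.toLp = inner ℂ g hL.toLp := by
      rw [L2.inner_def, L2.inner_def]
      refine integral_congr_ae ?_
      filter_upwards [hL.coeFn_toLp] with x hx
      rw [hx]
      by_cases h : x ∈ {x | ‖g x‖ ≤ n * c x}
      · rw [Set.indicator_of_mem h]
      · rw [Set.indicator_of_notMem h]; simp
    rw [hg _ hd, inner_self_eq_zero, Lp.eq_zero_iff_ae_eq_zero] at h0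
    filter_upwards [h0, hL.coeFn_toLp] with x h1 h2 h3
    rw [h2, Set.indicator_of_mem (by exact h3)] at h1
    exact h1
  rw [Lp.eq_zero_iff_ae_eq_zero]
  have hne : ∀ᵐ x ∂weightMeasure φ, φ x ≠ 0 := hφ.ae_iff.2 (ae_of_all _ fun x h => h)
  filter_upwards [ae_all_iff.2 hz, hne] with x hx h0
  have hcx : 0 < c x := lt_of_le_of_ne (hc.nonneg x)
    fun h => h0 ((hc.eq_zero_iff x).1 h.symm)
  obtain ⟨n, hn⟩ := exists_nat_ge (‖g x‖ / c x)
  exact hx n ((div_le_iff₀ hcx).1 hn)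

/-- The closed span of the differences of distributions consists of the elements of `L²(φ dx)`
whose first three moments vanish. A vector `g` orthogonal to the differences defines a functional
that vanishes on the dominated elements with vanishing moments; on dominated elements it is then a
combination of the three moments, and by density so it is everywhere. -/
theorem mem_tangentSpace_iff (hφ : AdmissibleWeight φ) (hc : IsBasePoint φ c) (v : L2 φ) :
    v ∈ tangentSpace φ (volume.withDensity fun x => ENNReal.ofReal (c x)) ↔
      ∀ k < 3, l2Moment φ v k = 0 := by
  set χ := volume.withDensity fun x => ENNReal.ofReal (c x) with hχ
  constructor
  · intro hv k hk
    have hle : tangentSpace φ χ ≤ (innerSL ℂ (hφ.monomialVec k)).ker := by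
      refine Submodule.topologicalClosure_minimal _ (Submodule.span_le.2 ?_)
        (ContinuousLinearMap.isClosed_ker _)
      rintro _ ⟨μ, hμ, rfl⟩
      have i1 : IsProbabilityMeasure μ := hμ.1
      have i2 : IsProbabilityMeasure χ := hc.mem_distributions.1
      obtain ⟨a0, a1, a2⟩ := momentSeq_of_mem_distributions hμ
      obtain ⟨c0, c1, c2⟩ := momentSeq_of_mem_distributions hc.mem_distributions
      simp only [SetLike.mem_coe, LinearMap.mem_ker, ContinuousLinearMap.coe_coe,
        innerSL_apply_apply, hφ.inner_monomialVec]
      rw [hφ.l2Moment_sub, hφ.l2Moment_density hμ.2.1,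
        hφ.l2Moment_density hc.mem_distributions.2.1, Pi.sub_apply]
      interval_cases k
      · rw [a0, c0, sub_self]
      · rw [a1, c1, sub_self]
      · rw [a2, c2, sub_self]
    have := hle hv
    simpa [hφ.inner_monomialVec] using this
  · intro hv
    have hcl : IsClosed (tangentSpace φ χ : Set (L2 φ)) := Submodule.isClosed_topologicalClosure _
    have : CompleteSpace (tangentSpace φ χ) := hcl.completeSpace_coe
    rw [← Submodule.orthogonal_orthogonal (tangentSpace φ χ), Submodule.mem_orthogonal]
    intro g hg
    rw [Submodule.mem_orthogonal'] at hg
    let L : Fin 3 → dominated φ c →ₗ[ℂ] ℂ := fun i =>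
      (innerSL ℂ (hφ.monomialVec i)).toLinearMap ∘ₗ (dominated φ c).subtype
    let K : dominated φ c →ₗ[ℂ] ℂ := (innerSL ℂ g).toLinearMap ∘ₗ (dominated φ c).subtype
    have hK : K ∈ Submodule.span ℂ (Set.range L) := by
      refine mem_span_of_iInf_ker_le_ker fun f hf => ?_
      obtain ⟨C, hC⟩ := f.2
      simp only [Submodule.mem_iInf, LinearMap.mem_ker] at hf ⊢
      refine hg _ (Submodule.le_topologicalClosure _ (hc.mem_span_of_bounded hφ hC fun k hk => ?_))
      rw [← hφ.inner_monomialVec]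
      exact hf ⟨k, hk⟩
    obtain ⟨a, ha⟩ := (Submodule.mem_span_range_iff_exists_fun ℂ).1 hK
    have hg0 : g - ∑ i, (starRingEnd ℂ (a i)) • hφ.monomialVec (i : Fin 3) = 0 := by
      refine hc.eq_zero_of_orthogonal_dominated hφ fun f hf => ?_
      have := congrArg (fun T : dominated φ c →ₗ[ℂ] ℂ => T ⟨f, hf⟩) ha
      simp only [LinearMap.sum_apply, LinearMap.smul_apply, L, K, LinearMap.comp_apply,
        Submodule.subtype_apply, ContinuousLinearMap.coe_coe, innerSL_apply_apply] at this
      rw [inner_sub_left, sum_inner, ← this, sub_eq_zero]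
      refine Finset.sum_congr rfl fun i _ => ?_
      rw [inner_smul_left, RingHomCompTriple.comp_apply, RingHom.id_apply, smul_eq_mul]
    rw [sub_eq_zero.1 hg0, sum_inner]
    refine Finset.sum_eq_zero fun i _ => ?_
    rw [inner_smul_left, hφ.inner_monomialVec, hv i i.2, mul_zero]

/-- Distributions near the base point in the direction of a given distribution. -/
theorem exists_density_sub_eq_smul (hφ : AdmissibleWeight φ) (hc : IsBasePoint φ c)
    {μ : Measure ℝ} (hμ : μ ∈ distributions φ) {t : ℝ} (ht0 : 0 ≤ t) (ht1 : t ≤ 1) :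
    ∃ ν ∈ distributions φ,
      density φ ν - density φ (volume.withDensity fun x => ENNReal.ofReal (c x)) =
        (t : ℂ) • (density φ μ - density φ (volume.withDensity fun x => ENNReal.ofReal (c x))) := by
  set χ := volume.withDensity fun x => ENNReal.ofReal (c x) with hχ
  have i1 : IsProbabilityMeasure μ := hμ.1
  have i2 : IsProbabilityMeasure χ := hc.mem_distributions.1
  obtain ⟨f, hf, hf0, hfz, -, -, hd⟩ := hφ.exists_density hμ.2.1
  obtain ⟨a0, a1, a2⟩ := momentSeq_of_mem_distributions hμ
  obtain ⟨c0, c1, c2⟩ := momentSeq_of_mem_distributions hc.mem_distributions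
  have hmom : ∀ k, l2Moment φ (density φ χ + (t : ℂ) • (density φ μ - density φ χ)) k =
      momentSeq χ k + t * (momentSeq μ k - momentSeq χ k) := fun k => by
    rw [hφ.l2Moment_add, hφ.l2Moment_smul, hφ.l2Moment_sub, hφ.l2Moment_density hμ.2.1,
      hφ.l2Moment_density hc.mem_distributions.2.1]
    rfl
  obtain ⟨h1, h2⟩ := hφ.mem_distributions_of_l2Moment (f := fun x => (1 - t) * c x + t * f x)
    (u := density φ χ + (t : ℂ) • (density φ μ - density φ χ))
    ((hc.measurable.const_mul _).add (hf.const_mul _))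
    (fun x => add_nonneg (mul_nonneg (by linarith) (hc.nonneg x)) (mul_nonneg ht0 (hf0 x)))
    (fun x hx => by rw [(hc.eq_zero_iff x).2 hx, hfz x hx]; ring) (by
      filter_upwards [hc.density_ae hφ, hd,
        Lp.coeFn_add (density φ χ) ((t : ℂ) • (density φ μ - density φ χ)),
        Lp.coeFn_smul (t : ℂ) (density φ μ - density φ χ),
        Lp.coeFn_sub (density φ μ) (density φ χ)] with x h1 h2 h3 h4 h5
      rw [h3, Pi.add_apply, h4, Pi.smul_apply, h5, Pi.sub_apply, h1, h2, smul_eq_mul]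
      push_cast
      ring)
    (by rw [hmom, a0, c0]; ring) (by rw [hmom, a1, c1]; ring) (by rw [hmom, a2, c2]; ring)
  exact ⟨_, h1, by rw [h2, add_sub_cancel_left]⟩

/-- A Fréchet differential at the base point is determined on the differences of distributions,
which can be scaled down, and therefore on their closed span. -/
theorem isDifferential_unique (hφ : AdmissibleWeight φ) (hc : IsBasePoint φ c)
    {χ : Measure ℝ} (hχ : χ = volume.withDensity fun x => ENNReal.ofReal (c x))
    {T : Measure ℝ → Measure ℝ} {D D' : tangentSpace φ χ →L[ℂ] tangentSpace φ χ}
    (h : IsDifferential φ T χ D) (h' : IsDifferential φ T χ D') : D' = D := by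
  have key : ∀ μ ∈ distributions φ, ∀ v : tangentSpace φ χ,
      (v : L2 φ) = density φ μ - density φ χ → D' v = D v := by
    intro μ hμ v hv
    rw [← sub_eq_zero, ← norm_eq_zero]
    refine le_antisymm (le_of_forall_pos_le_add fun η hη => ?_) (norm_nonneg _)
    set ε := η / (2 * (‖v‖ + 1)) with hε
    have hε0 : 0 < ε := by positivity
    obtain ⟨δ, hδ, H⟩ := h ε hε0
    obtain ⟨δ', hδ', H'⟩ := h' ε hε0
    -- The scaling factor that brings `v` within reach of both `δ` and `δ'`.
    set t := min 1 (min δ δ' / (‖v‖ + 1)) with ht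
    have hmin : 0 < min δ δ' := lt_min hδ hδ'
    have ht0 : 0 < t := lt_min one_pos (by positivity)
    obtain ⟨ν, hν, hνt⟩ := hc.exists_density_sub_eq_smul hφ hμ ht0.le (min_le_left _ _)
    rw [← hχ] at hνt
    have hvt : (((t : ℂ) • v : tangentSpace φ χ) : L2 φ) = density φ ν - density φ χ := by
      rw [hνt, Submodule.coe_smul, hv]
    have hnorm : ‖(t : ℂ) • v‖ = t * ‖v‖ := by
      rw [norm_smul, Complex.norm_real, Real.norm_of_nonneg ht0.le]
    have hsmall : ‖(t : ℂ) • v‖ ≤ min δ δ' := by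
      rw [hnorm]
      calc t * ‖v‖ ≤ min δ δ' / (‖v‖ + 1) * (‖v‖ + 1) := by
            gcongr
            · exact min_le_right _ _
            · linarith
        _ = min δ δ' := by field_simp
    have b1 := H ν hν _ hvt (hsmall.trans (min_le_left _ _))
    have b2 := H' ν hν _ hvt (hsmall.trans (min_le_right _ _))
    have b3 : ‖(D' ((t : ℂ) • v) : L2 φ) - (D ((t : ℂ) • v) : L2 φ)‖ ≤ 2 * ε * ‖(t : ℂ) • v‖ := by
      rw [show (D' ((t : ℂ) • v) : L2 φ) - (D ((t : ℂ) • v) : L2 φ) =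
        (density φ (T ν) - density φ (T χ) - (D ((t : ℂ) • v) : L2 φ)) -
        (density φ (T ν) - density φ (T χ) - (D' ((t : ℂ) • v) : L2 φ)) by abel]
      refine (norm_sub_le _ _).trans ?_
      linarith
    rw [map_smul, map_smul, Submodule.coe_smul, Submodule.coe_smul, ← smul_sub, norm_smul,
      Complex.norm_real, Real.norm_of_nonneg ht0.le, hnorm, mul_left_comm,
      mul_le_mul_iff_right₀ ht0] at b3
    change ‖((D' v - D v : tangentSpace φ χ) : L2 φ)‖ ≤ _
    rw [Submodule.coe_sub, zero_add]
    refine b3.trans ?_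
    calc 2 * ε * ‖v‖ ≤ 2 * ε * (‖v‖ + 1) := by gcongr; linarith
      _ = η := by rw [hε]; field_simp
  have hcl : IsClosed (tangentSpace φ χ : Set (L2 φ)) := Submodule.isClosed_topologicalClosure _
  -- The kernel of `D' - D` is closed in the closed subspace, hence closed in the whole space.
  have hle : tangentSpace φ χ ≤
      ((D' - D).ker.map (tangentSpace φ χ).subtype : Submodule ℂ (L2 φ)) := by
    refine Submodule.topologicalClosure_minimal _ (Submodule.span_le.2 ?_) ?_
    · rintro w ⟨μ, hμ, rfl⟩
      refine ⟨⟨_, Submodule.le_topologicalClosure _ (Submodule.subset_span ⟨μ, hμ, rfl⟩)⟩, ?_, rfl⟩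
      rw [SetLike.mem_coe, LinearMap.mem_ker, ContinuousLinearMap.coe_coe,
        sub_apply, key μ hμ _ rfl, sub_self]
    · rw [Submodule.map_coe]
      exact hcl.isClosedEmbedding_subtypeVal.isClosedMap _ (ContinuousLinearMap.isClosed_ker _)
  ext1 v
  obtain ⟨w, hw, hwv⟩ := hle v.2
  rw [← Subtype.ext hwv, ← sub_eq_zero]
  exact hw

end IsBasePoint

end AdmissibleWeight

/-! ### Diagonal operators on a Hilbert space -/

section Diagonal

variable {H : Type*} [NormedAddCommGroup H] [InnerProductSpace ℂ H]

theorem hasSum_norm_inner_sq (b : HilbertBasis ℕ ℂ H) (x : H) :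
    HasSum (fun k => ‖inner ℂ (b k) x‖ ^ 2) (‖x‖ ^ 2) := by
  have h := b.hasSum_inner_mul_inner x x
  have e : (fun k => inner ℂ x (b k) * inner ℂ (b k) x) =
      fun k => ((‖inner ℂ (b k) x‖ ^ 2 : ℝ) : ℂ) := by
    funext k
    rw [← inner_conj_symm x (b k), RCLike.conj_mul]
    push_cast; rfl
  rw [e, inner_self_eq_norm_sq_to_K] at h
  exact Complex.hasSum_ofReal.1 (by simpa using h)

theorem inner_apply_of_diagonal {b : HilbertBasis ℕ ℂ H} {A : H →L[ℂ] H} {l : ℕ → ℂ}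
    (hA : ∀ k, A (b k) = l k • b k) (k : ℕ) (x : H) :
    inner ℂ (b k) (A x) = l k * inner ℂ (b k) x := by
  have h1 := ((b.hasSum_repr x).mapL A).mapL (innerSL ℂ (b k))
  have h2 := hasSum_single (f := fun i => innerSL ℂ (b k) (A (b.repr x i • b i))) k
    (fun i hi => by
      simp only [map_smul, hA, innerSL_apply_apply, smul_eq_mul]
      rw [b.orthonormal.2 hi.symm]; simp)
  have h3 := h1.unique h2
  simp only [innerSL_apply_apply, map_smul, hA, smul_eq_mul] at h3
  rw [h3, inner_self_eq_norm_sq_to_K, b.orthonormal.1 k, b.repr_apply_apply]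
  simp [mul_comm]

theorem exists_diagonal [CompleteSpace H] (b : HilbertBasis ℕ ℂ H) {l : ℕ → ℂ}
    (hl : Summable fun k => ‖l k‖) : ∃ A : H →L[ℂ] H, ∀ k, A (b k) = l k • b k := by
  have hs : Summable fun k => l k • InnerProductSpace.rankOne ℂ (b k) (b k) := by
    refine Summable.of_norm (hl.congr fun k => ?_)
    rw [norm_smul, InnerProductSpace.norm_rankOne, b.orthonormal.1 k, mul_one, mul_one]
  refine ⟨∑' k, l k • InnerProductSpace.rankOne ℂ (b k) (b k), fun k => ?_⟩
  have h1 := hs.hasSum.mapL (ContinuousLinearMap.apply ℂ H (b k))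
  refine h1.unique ?_
  have h2 := hasSum_single (f := fun i => ContinuousLinearMap.apply ℂ H (b k)
    (l i • InnerProductSpace.rankOne ℂ (b i) (b i))) k (fun i hi => by
      simp [b.orthonormal.2 hi])
  convert h2 using 1
  simp [b.orthonormal.1 k]

theorem spectrum_subset_ball_of_norm_le {E : Type*} [NormedAddCommGroup E] [NormedSpace ℂ E]
    [CompleteSpace E] {D : E →L[ℂ] E} {r : ℝ} (hr : r < 1) (h : ‖D‖ ≤ r) :
    spectrum ℂ D ⊆ Metric.ball 0 1 := by
  intro z hz
  rw [mem_ball_zero_iff]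
  have h1 := spectrum.norm_le_norm_mul_of_mem hz
  have h2 : ‖(1 : E →L[ℂ] E)‖ ≤ 1 := ContinuousLinearMap.norm_id_le
  have h3 : ‖D‖ * ‖(1 : E →L[ℂ] E)‖ ≤ ‖D‖ * 1 := mul_le_mul_of_nonneg_left h2 (norm_nonneg _)
  linarith

/-- A diagonal operator restricts to the orthogonal complement `V` of the first `n` basis vectors,
and the restriction has spectrum in the open unit disc when the remaining diagonal entries are
bounded by some `r < 1`. -/
theorem exists_restriction_of_diagonal {b : HilbertBasis ℕ ℂ H} {A : H →L[ℂ] H} {l : ℕ → ℂ}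
    (hA : ∀ k, A (b k) = l k • b k) {n : ℕ} {r : ℝ} (hr0 : 0 ≤ r) (hr : r < 1)
    (hl : ∀ k, n ≤ k → ‖l k‖ ≤ r) (V : Submodule ℂ H) [CompleteSpace V]
    (hV : ∀ v, v ∈ V ↔ ∀ k < n, inner ℂ (b k) v = 0) :
    ∃ D : V →L[ℂ] V, (∀ v, (D v : H) = A v) ∧ spectrum ℂ D ⊆ Metric.ball 0 1 := by
  have hmaps : ∀ v : V, A v ∈ V := fun v => (hV _).2 fun k hk => by
    rw [inner_apply_of_diagonal hA, (hV v).1 v.2 k hk, mul_zero]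
  let D : V →L[ℂ] V := (A.comp V.subtypeL).codRestrict V hmaps
  have hD : ∀ v, (D v : H) = A v := fun v => rfl
  refine ⟨D, hD, ?_⟩
  have hnorm : ‖D‖ ≤ r := by
    refine D.opNorm_le_bound hr0 fun v => ?_
    change ‖A v‖ ≤ r * ‖(v : H)‖
    refine (sq_le_sq₀ (norm_nonneg _) (by positivity)).1 ?_
    rw [mul_pow]
    refine hasSum_le (fun k => ?_) (hasSum_norm_inner_sq b (A v))
      ((hasSum_norm_inner_sq b (v : H)).mul_left (r ^ 2))
    rw [inner_apply_of_diagonal hA, norm_mul, mul_pow]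
    rcases lt_or_ge k n with hk | hk
    · rw [(hV v).1 v.2 k hk]; simp
    · gcongr
      exact hl k hk
  exact spectrum_subset_ball_of_norm_le hr hnorm

end Diagonal

/-! ### Free cumulants -/

/-- The polynomials `P_n` in an element `a` of an algebra attached to free cumulants
`κ_{i+1} = k i`: they satisfy `a P_n = P_{n+1} + ∑_{i ≤ n} κ_{i+1} P_{n-i}`, and a functional for
which the moments of `a` have these free cumulants annihilates all of them but `P_0 = 1`. -/
noncomputable def cumulantPoly {A : Type*} [Ring A] [Algebra ℂ A] (k : ℕ → ℂ) (a : A) : ℕ → A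
  | 0 => 1
  | n + 1 => a * cumulantPoly k a n - ∑ i : Fin (n + 1), k i • cumulantPoly k a (n - i)
  decreasing_by all_goals omega

section Ring

variable {A : Type*} [Ring A] [Algebra ℂ A]

@[simp] theorem cumulantPoly_zero (k : ℕ → ℂ) (a : A) : cumulantPoly k a 0 = 1 := by
  rw [cumulantPoly]

theorem mul_cumulantPoly (k : ℕ → ℂ) (a : A) (n : ℕ) :
    a * cumulantPoly k a n =
      cumulantPoly k a (n + 1) + ∑ i ∈ Finset.range (n + 1), k i • cumulantPoly k a (n - i) := by
  conv_rhs => rw [cumulantPoly]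
  rw [Finset.sum_range fun i => k i • cumulantPoly k a (n - i), sub_add_cancel]

theorem cumulantPoly_succ (k : ℕ → ℂ) (a : A) (n : ℕ) :
    cumulantPoly k a (n + 1) =
      a * cumulantPoly k a n - ∑ i ∈ Finset.range (n + 1), k i • cumulantPoly k a (n - i) := by
  rw [mul_cumulantPoly, add_sub_cancel_right]

/-- A sequence satisfying the recursion of the polynomials `P_n` is obtained from them. -/
theorem cumulantPoly_apply_eq {F M : Type*} [AddCommGroup M] [Module ℂ M] [FunLike F A M]
    [LinearMapClass F ℂ A M] (k : ℕ → ℂ) (a : A) (T : F) (L : M → M) (y : ℕ → M)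
    (hT : ∀ x, T (a * x) = L (T x)) (h0 : T 1 = y 0)
    (hL : ∀ n, L (y n) = y (n + 1) + ∑ i ∈ Finset.range (n + 1), k i • y (n - i)) (n : ℕ) :
    T (cumulantPoly k a n) = y n := by
  induction n using Nat.strong_induction_on with
  | _ n ih =>
    cases n with
    | zero => rw [cumulantPoly_zero, h0]
    | succ n =>
      rw [cumulantPoly_succ, map_sub, hT, ih n (by omega), hL, map_sum, sub_eq_iff_eq_add]
      congr 1
      refine Finset.sum_congr rfl fun i _ => ?_
      rw [map_smul, ih (n - i) (by omega)]

theorem mem_span_cumulantPoly (k : ℕ → ℂ) {a x : A} (hx : x ∈ Algebra.adjoin ℂ {a}) :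
    x ∈ Submodule.span ℂ (Set.range (cumulantPoly k a)) := by
  set S := Submodule.span ℂ (Set.range (cumulantPoly k a)) with hS
  have hmul : ∀ y ∈ S, a * y ∈ S := by
    intro y hy
    induction hy using Submodule.span_induction with
    | mem y hy =>
      obtain ⟨n, rfl⟩ := hy
      rw [mul_cumulantPoly]
      exact S.add_mem (Submodule.subset_span ⟨_, rfl⟩)
        (S.sum_mem fun i _ => S.smul_mem _ (Submodule.subset_span ⟨_, rfl⟩))
    | zero => rw [mul_zero]; exact S.zero_mem
    | add y z _ _ hy hz => rw [mul_add]; exact S.add_mem hy hz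
    | smul c y _ hy => rw [mul_smul_comm]; exact S.smul_mem _ hy
  rw [Algebra.adjoin_singleton_eq_range_aeval] at hx
  obtain ⟨p, rfl⟩ := hx
  induction p using Polynomial.induction_on' with
  | add p q hp hq => rw [map_add]; exact S.add_mem hp hq
  | monomial n c =>
    change Polynomial.aeval a _ ∈ S
    rw [Polynomial.aeval_monomial, ← Algebra.smul_def]
    refine S.smul_mem _ ?_
    induction n with
    | zero => rw [pow_zero]; exact Submodule.subset_span ⟨0, cumulantPoly_zero k a⟩
    | succ n ih => rw [pow_succ']; exact hmul _ ih

theorem cumulantPoly_mem_adjoin (k : ℕ → ℂ) (a : A) (n : ℕ) :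
    cumulantPoly k a n ∈ Algebra.adjoin ℂ {a} := by
  induction n using Nat.strong_induction_on with
  | _ n ih =>
    cases n with
    | zero => rw [cumulantPoly_zero]; exact one_mem _
    | succ n =>
      rw [cumulantPoly_succ]
      exact sub_mem (mul_mem (Algebra.subset_adjoin rfl) (ih n (by omega)))
        (sum_mem fun i _ => Subalgebra.smul_mem _ (ih (n - i) (by omega)) _)

end Ring

/-- The numbers `L(x^j P_n)`, where `L` is the functional with free cumulants `κ_{i+1} = k i` and
the `P_n` are its polynomials. -/
def momentArray (k : ℕ → ℂ) : ℕ → ℕ → ℂ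
  | 0, n => if n = 0 then 1 else 0
  | j + 1, n => momentArray k j (n + 1) +
      ∑ i ∈ Finset.range (n + 1), k i * momentArray k j (n - i)

/-- The moments as functions of the free cumulants `κ_{i+1} = k i`. -/
def momentsOfCumulants (k : ℕ → ℂ) (j : ℕ) : ℂ := momentArray k j 0

theorem momentsOfCumulants_zero (k : ℕ → ℂ) : momentsOfCumulants k 0 = 1 := by
  simp [momentsOfCumulants, momentArray]

theorem apply_pow_mul_cumulantPoly {A : Type*} [Ring A] [Algebra ℂ A] {τ : A →ₗ[ℂ] ℂ} {a : A}
    {k : ℕ → ℂ} (h : ∀ n, τ (cumulantPoly k a n) = if n = 0 then 1 else 0) (j n : ℕ) :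
    τ (a ^ j * cumulantPoly k a n) = momentArray k j n := by
  induction j generalizing n with
  | zero => rw [pow_zero, one_mul, h, momentArray]
  | succ j ih =>
    rw [pow_succ, mul_assoc, mul_cumulantPoly, mul_add, map_add, ih, momentArray,
      Finset.mul_sum, map_sum]
    congr 1
    refine Finset.sum_congr rfl fun i _ => ?_
    rw [mul_smul_comm, map_smul, ih, smul_eq_mul]

theorem apply_pow_eq_momentsOfCumulants {A : Type*} [Ring A] [Algebra ℂ A] {τ : A →ₗ[ℂ] ℂ} {a : A}
    {k : ℕ → ℂ} (h : ∀ n, τ (cumulantPoly k a n) = if n = 0 then 1 else 0) (j : ℕ) :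
    τ (a ^ j) = momentsOfCumulants k j := by
  rw [momentsOfCumulants, ← apply_pow_mul_cumulantPoly h, cumulantPoly_zero, mul_one]

/-! ### Free variables on the full Fock space -/

/-- The algebraic full Fock space over two letters. -/
abbrev Fock : Type := List Bool →₀ ℂ

namespace Fock

/-- The vacuum vector. -/
noncomputable def vacuum : Fock := Finsupp.single [] 1

/-- The creation operator of the letter `c`. -/
noncomputable def create (c : Bool) : Fock →ₗ[ℂ] Fock := Finsupp.lmapDomain ℂ ℂ (List.cons c)

/-- The operator `∑ i, k i • l^i` on basis vectors, where `l` removes a leading letter `c` from a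
word and annihilates the other words. -/
noncomputable def annihilateWord (c : Bool) : (ℕ → ℂ) → List Bool → Fock
  | k, [] => Finsupp.single [] (k 0)
  | k, d :: w => Finsupp.single (d :: w) (k 0) +
      if d = c then annihilateWord c (fun i => k (i + 1)) w else 0

/-- The operator `∑ i, k i • l^i`, where `l` is the annihilation operator of the letter `c`. -/
noncomputable def annihilate (c : Bool) (k : ℕ → ℂ) : Fock →ₗ[ℂ] Fock :=
  Finsupp.linearCombination ℂ (annihilateWord c k)

/-- The variable with free cumulants `κ_{i+1} = k i` in the letter `c`. -/
noncomputable def letterOp (c : Bool) (k : ℕ → ℂ) : Module.End ℂ Fock :=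
  create c + annihilate c k

theorem create_single (c : Bool) (w : List Bool) (z : ℂ) :
    create c (Finsupp.single w z) = Finsupp.single (c :: w) z := by
  simp [create]

theorem annihilate_single (c : Bool) (k : ℕ → ℂ) (w : List Bool) :
    annihilate c k (Finsupp.single w 1) = annihilateWord c k w := by
  simp [annihilate]

theorem annihilateWord_of_head_ne {c : Bool} {w : List Bool} (hw : w.head? ≠ some c)
    (k : ℕ → ℂ) : annihilateWord c k w = k 0 • Finsupp.single w 1 := by
  cases w with
  | nil => simp [annihilateWord]
  | cons d w =>
    have : d ≠ c := by simpa using hw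
    simp [annihilateWord, this]

theorem annihilateWord_replicate {c : Bool} {w : List Bool} (hw : w.head? ≠ some c)
    (k : ℕ → ℂ) (n : ℕ) : annihilateWord c k (List.replicate n c ++ w) =
      ∑ i ∈ Finset.range (n + 1), k i • Finsupp.single (List.replicate (n - i) c ++ w) 1 := by
  induction n generalizing k with
  | zero => simpa using annihilateWord_of_head_ne hw k
  | succ n ih =>
    rw [Finset.sum_range_succ', List.replicate_succ, List.cons_append, annihilateWord,
      if_pos rfl, ih, add_comm]
    congr 1
    · refine Finset.sum_congr rfl fun i _ => ?_
      rw [Nat.add_sub_add_right]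
    · simp [List.replicate_succ]

/-- The polynomials of a variable create words of one letter. -/
theorem cumulantPoly_apply_single {c : Bool} {w : List Bool} (hw : w.head? ≠ some c)
    (k : ℕ → ℂ) (n : ℕ) :
    cumulantPoly k (letterOp c k) n (Finsupp.single w 1) =
      Finsupp.single (List.replicate n c ++ w) 1 := by
  refine cumulantPoly_apply_eq k (letterOp c k)
    (LinearMap.applyₗ (Finsupp.single w 1 : Fock) : Module.End ℂ Fock →ₗ[ℂ] Fock) (letterOp c k)
    (fun n => Finsupp.single (List.replicate n c ++ w) 1) (fun x => rfl) rfl (fun n => ?_) n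
  rw [letterOp, LinearMap.add_apply, create_single, annihilate_single,
    annihilateWord_replicate hw, List.replicate_succ, List.cons_append]

/-- The sum of all words of length `n`. -/
noncomputable def wordSum : ℕ → Fock
  | 0 => vacuum
  | n + 1 => create true (wordSum n) + create false (wordSum n)

theorem annihilate_create (c d : Bool) (k : ℕ → ℂ) (x : Fock) :
    annihilate c k (create d x) =
      k 0 • create d x + if d = c then annihilate c (fun i => k (i + 1)) x else 0 := by
  induction x using Finsupp.induction_linear with
  | zero => simp
  | add x y hx hy =>
    rw [map_add, map_add, hx, hy, smul_add]
    split_ifs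
    · rw [map_add]; abel
    · abel
  | single w z =>
    rw [create_single, ← mul_one z, ← smul_eq_mul, ← Finsupp.smul_single, ← Finsupp.smul_single,
      map_smul, annihilate_single, annihilateWord, map_smul, annihilate_single, smul_add]
    congr 1
    · simp [mul_comm]
    · split_ifs
      · rfl
      · rw [smul_zero]

theorem annihilate_wordSum (c : Bool) (k : ℕ → ℂ) (n : ℕ) :
    annihilate c k (wordSum n) = ∑ i ∈ Finset.range (n + 1), k i • wordSum (n - i) := by
  induction n generalizing k with
  | zero =>
    rw [wordSum, vacuum, annihilate_single, annihilateWord]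
    simp [wordSum, vacuum]
  | succ n ih =>
    rw [Finset.sum_range_succ', wordSum, map_add, annihilate_create, annihilate_create, ih]
    simp only [Nat.add_sub_add_right, Nat.sub_zero, wordSum, smul_add]
    cases c <;> simp <;> abel

theorem letterOp_add_letterOp_wordSum (k k' : ℕ → ℂ) (n : ℕ) :
    letterOp true k (wordSum n) + letterOp false k' (wordSum n) = wordSum (n + 1) +
      ∑ i ∈ Finset.range (n + 1), (k + k') i • wordSum (n - i) := by
  simp only [letterOp, LinearMap.add_apply, annihilate_wordSum, Pi.add_apply, add_smul,
    Finset.sum_add_distrib]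
  rw [wordSum]
  abel

theorem wordSum_apply_nil (n : ℕ) : wordSum n [] = if n = 0 then 1 else 0 := by
  cases n with
  | zero => simp [wordSum, vacuum]
  | succ n =>
    have : ∀ c, create c (wordSum n) [] = 0 := fun c => by
      rw [create, Finsupp.lmapDomain_apply]
      exact Finsupp.mapDomain_of_notMem_range _ _ (by simp)
    simp [wordSum, this]

/-- The vacuum state. -/
noncomputable def vacuumState : Module.End ℂ Fock →ₗ[ℂ] ℂ :=
  Finsupp.lapply [] ∘ₗ LinearMap.applyₗ vacuum

theorem vacuumState_apply (x : Module.End ℂ Fock) : vacuumState x = x vacuum [] := rfl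

theorem vacuumState_one : vacuumState 1 = 1 := by
  simp [vacuumState_apply, vacuum]

theorem vacuumState_cumulantPoly (c : Bool) (k : ℕ → ℂ) (n : ℕ) :
    vacuumState (cumulantPoly k (letterOp c k) n) = if n = 0 then 1 else 0 := by
  rw [vacuumState_apply, vacuum, cumulantPoly_apply_single (by simp)]
  cases n <;> simp

/-- The span of the words that begin with `c`. -/
def beginning (c : Bool) : Submodule ℂ Fock := Finsupp.supported ℂ ℂ {w | w.head? = some c}

/-- The span of the words that do not begin with `c`. -/
def notBeginning (c : Bool) : Submodule ℂ Fock := Finsupp.supported ℂ ℂ {w | w.head? ≠ some c}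

theorem apply_nil_of_mem_beginning {c : Bool} {x : Fock} (hx : x ∈ beginning c) : x [] = 0 := by
  rw [beginning, Finsupp.mem_supported'] at hx
  exact hx _ (by simp)

/-- On words that do not begin with `c`, an element of the algebra of the letter `c` creates words
that begin with `c`, apart from a multiple of the identity. -/
theorem exists_sub_smul_mem_beginning (c : Bool) (k : ℕ → ℂ) {x : Module.End ℂ Fock}
    (hx : x ∈ Algebra.adjoin ℂ {letterOp c k}) :
    ∃ s : ℂ, ∀ y ∈ notBeginning c, x y - s • y ∈ beginning c := by
  have h := mem_span_cumulantPoly (A := Module.End ℂ Fock) (a := letterOp c k) k hx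
  clear hx
  induction h using Submodule.span_induction with
  | mem x hx =>
    obtain ⟨n, rfl⟩ := hx
    cases n with
    | zero => exact ⟨1, fun y _ => by simp⟩
    | succ n =>
      refine ⟨0, fun y hy => ?_⟩
      rw [zero_smul, sub_zero]
      have hle : notBeginning c ≤ (beginning c).comap
          (cumulantPoly k (letterOp c k) (n + 1)) := by
        rw [notBeginning, Finsupp.supported_eq_span_single, Submodule.span_le]
        rintro _ ⟨w, hw, rfl⟩
        rw [SetLike.mem_coe, Submodule.mem_comap, cumulantPoly_apply_single hw]
        refine Finsupp.single_mem_supported ℂ _ ?_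
        simp [List.replicate_succ]
      exact hle hy
  | zero => exact ⟨0, fun y _ => by simp⟩
  | add x x' _ _ h h' =>
    obtain ⟨s, hs⟩ := h
    obtain ⟨s', hs'⟩ := h'
    refine ⟨s + s', fun y hy => ?_⟩
    have := Submodule.add_mem _ (hs y hy) (hs' y hy)
    rw [LinearMap.add_apply, add_smul, add_sub_add_comm]
    exact this
  | smul a x _ h =>
    obtain ⟨s, hs⟩ := h
    refine ⟨a * s, fun y hy => ?_⟩
    have := Submodule.smul_mem _ a (hs y hy)
    rwa [smul_sub, smul_smul] at this

theorem apply_mem_beginning_of_centred {c : Bool} {k : ℕ → ℂ} {x : Module.End ℂ Fock}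
    (hx : x ∈ Algebra.adjoin ℂ {letterOp c k}) (h0 : vacuumState x = 0) {y : Fock}
    (hy : y ∈ notBeginning c) : x y ∈ beginning c := by
  obtain ⟨s, hs⟩ := exists_sub_smul_mem_beginning c k hx
  have h1 := apply_nil_of_mem_beginning (hs vacuum (Finsupp.single_mem_supported ℂ _ (by simp)))
  rw [Finsupp.sub_apply, ← vacuumState_apply, h0] at h1
  have : s = 0 := by simpa [vacuum] using h1
  simpa [this] using hs y hy

/-- The algebras of the two letters are free with respect to the vacuum state. -/
theorem freelyIndependent (k : Bool → ℕ → ℂ) :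
    FreelyIndependent vacuumState fun s : Bool => Algebra.adjoin ℂ {letterOp s (k s)} := by
  have key : ∀ (n : ℕ) (i : Fin (n + 1) → Bool) (x : Fin (n + 1) → Module.End ℂ Fock),
      (∀ j, x j ∈ Algebra.adjoin ℂ {letterOp (i j) (k (i j))}) → (∀ j, vacuumState (x j) = 0) →
      (∀ j : Fin n, i j.castSucc ≠ i j.succ) →
        (List.ofFn x).prod vacuum ∈ beginning (i 0) := by
    intro n
    induction n with
    | zero =>
      intro i x hx h0 _
      simp only [List.ofFn_succ, List.ofFn_zero, List.prod_cons, List.prod_nil, mul_one]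
      exact apply_mem_beginning_of_centred (hx 0) (h0 0)
        (Finsupp.single_mem_supported ℂ _ (by simp))
    | succ n ih =>
      intro i x hx h0 hi
      rw [List.ofFn_succ, List.prod_cons, Module.End.mul_apply]
      refine apply_mem_beginning_of_centred (hx 0) (h0 0) ?_
      refine Finsupp.supported_mono ?_ (ih (fun j => i j.succ) (fun j => x j.succ)
        (fun j => hx _) (fun j => h0 _) fun j => ?_)
      · intro w hw
        simp only [Set.mem_ofPred_eq] at hw ⊢
        rw [hw]
        intro h
        exact hi 0 (Option.some_injective _ h).symm
      · exact hi j.succ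
  intro n i x hx h0 hi
  rw [vacuumState_apply]
  exact apply_nil_of_mem_beginning (key n i x hx h0 hi)

end Fock

/-! ### Free convolution adds free cumulants -/

theorem Fock.vacuumState_pow (c : Bool) (k : ℕ → ℂ) (j : ℕ) :
    vacuumState (letterOp c k ^ j) = momentsOfCumulants k j :=
  apply_pow_eq_momentsOfCumulants (A := Module.End ℂ Fock) (τ := vacuumState)
    (a := letterOp c k) (vacuumState_cumulantPoly c k) j

theorem aeval_cumulantPoly {A : Type*} [Ring A] [Algebra ℂ A] (k : ℕ → ℂ) (a : A) (n : ℕ) :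
    Polynomial.aeval a (cumulantPoly k (Polynomial.X : Polynomial ℂ) n) = cumulantPoly k a n :=
  cumulantPoly_apply_eq k (Polynomial.X : Polynomial ℂ) (Polynomial.aeval a)
    (LinearMap.mulLeft ℂ a) (cumulantPoly k a) (fun x => by simp) (by simp)
    (fun n => mul_cumulantPoly k a n) n

/-- Moments determine the values on the polynomials `P_n`. -/
theorem apply_cumulantPoly {A : Type*} [Ring A] [Algebra ℂ A] {τ : A →ₗ[ℂ] ℂ} {a : A}
    {k : ℕ → ℂ} (h : ∀ j, τ (a ^ j) = momentsOfCumulants k j) (n : ℕ) :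
    τ (cumulantPoly k a n) = if n = 0 then 1 else 0 := by
  have hE : τ ∘ₗ (Polynomial.aeval a).toLinearMap =
      Fock.vacuumState ∘ₗ (Polynomial.aeval (Fock.letterOp true k)).toLinearMap := by
    refine Polynomial.lhom_ext' fun j => LinearMap.ext_ring ?_
    simp only [LinearMap.comp_apply, AlgHom.toLinearMap_apply, Polynomial.aeval_monomial, map_one,
      one_mul]
    rw [h, Fock.vacuumState_pow]
  have := congrArg (fun T : Polynomial ℂ →ₗ[ℂ] ℂ => T (cumulantPoly k Polynomial.X n)) hE
  simp only [LinearMap.comp_apply, AlgHom.toLinearMap_apply] at this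
  rw [aeval_cumulantPoly] at this
  rw [this, aeval_cumulantPoly (A := Module.End ℂ Fock), Fock.vacuumState_cumulantPoly]

section Uniqueness

variable {A : Type} [Ring A] [Algebra ℂ A]

/-- The product of polynomials `P_n` in the letters `a c` that corresponds to the word
`c ⋯ c w`, with `n` letters `c` in front: each maximal block of `m` letters `d` stands for
`P_m (a d)`. -/
noncomputable def blockProd (k : Bool → ℕ → ℂ) (a : Bool → A) : List Bool → Bool → ℕ → A
  | [], c, n => cumulantPoly (k c) (a c) n
  | d :: w, c, n => if d = c then blockProd k a w c (n + 1)
      else cumulantPoly (k c) (a c) n * blockProd k a w d 1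

variable (k : Bool → ℕ → ℂ) (a : Bool → A)

/-- An empty block in front does not matter, whatever its letter. -/
theorem blockProd_zero (w : List Bool) (c : Bool) :
    blockProd k a w c 0 = blockProd k a w true 0 := by
  have : ∀ c, blockProd k a w c 0 = match w with
      | [] => 1
      | d :: w => blockProd k a w d 1 := by
    intro c
    cases w with
    | nil => simp [blockProd]
    | cons d w =>
      by_cases h : d = c
      · subst h; simp [blockProd]
      · simp [blockProd, h]
  rw [this, this]

theorem blockProd_cons (w : List Bool) (d c : Bool) :
    blockProd k a (d :: w) c 0 = blockProd k a w d 1 := by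
  rw [blockProd_zero, ← blockProd_zero k a _ d, blockProd, if_pos rfl]

theorem blockProd_of_head_ne {w : List Bool} {c : Bool} (hw : w.head? ≠ some c) (n : ℕ) :
    blockProd k a w c n = cumulantPoly (k c) (a c) n * blockProd k a w true 0 := by
  cases w with
  | nil => simp [blockProd]
  | cons d w =>
    have : d ≠ c := by simpa using hw
    rw [blockProd, if_neg this, blockProd_cons]

theorem blockProd_replicate {w : List Bool} {c : Bool} (m n : ℕ) :
    blockProd k a (List.replicate m c ++ w) c n = blockProd k a w c (n + m) := by
  induction m generalizing n with
  | zero => simp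
  | succ m ih =>
    rw [List.replicate_succ, List.cons_append, blockProd, if_pos rfl, ih]
    congr 1; omega

theorem exists_replicate_append (c : Bool) (w : List Bool) :
    ∃ (n : ℕ) (w' : List Bool), w = List.replicate n c ++ w' ∧ w'.head? ≠ some c := by
  induction w with
  | nil => exact ⟨0, [], by simp⟩
  | cons d w ih =>
    by_cases h : d = c
    · obtain ⟨n, w', rfl, hw'⟩ := ih
      exact ⟨n + 1, w', by simp [h, List.replicate_succ], hw'⟩
    · exact ⟨0, d :: w, by simp, by simpa using h⟩

/-- The map from the Fock space that sends words to products of polynomials `P_n`. -/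
noncomputable def ofFock : Fock →ₗ[ℂ] A :=
  Finsupp.linearCombination ℂ fun w => blockProd k a w true 0

theorem ofFock_single_replicate {w : List Bool} {c : Bool} (hw : w.head? ≠ some c) (n : ℕ) :
    ofFock k a (Finsupp.single (List.replicate n c ++ w) 1) =
      cumulantPoly (k c) (a c) n * blockProd k a w true 0 := by
  rw [ofFock, Finsupp.linearCombination_single, one_smul, ← blockProd_zero k a _ c,
    blockProd_replicate, zero_add, blockProd_of_head_ne k a hw]

/-- The map from the Fock space intertwines its variables with multiplication by the letters. -/
theorem ofFock_letterOp (c : Bool) (x : Fock) :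
    ofFock k a (Fock.letterOp c (k c) x) = a c * ofFock k a x := by
  induction x using Finsupp.induction_linear with
  | zero => simp
  | add x y hx hy => rw [map_add, map_add, hx, hy, map_add, mul_add]
  | single w z =>
    rw [← mul_one z, ← smul_eq_mul, ← Finsupp.smul_single, map_smul, map_smul, map_smul,
      mul_smul_comm]
    congr 1
    obtain ⟨n, w', rfl, hw⟩ := exists_replicate_append c w
    rw [ofFock_single_replicate k a hw, ← mul_assoc, mul_cumulantPoly, add_mul, Finset.sum_mul,
      Fock.letterOp, LinearMap.add_apply, Fock.create_single, Fock.annihilate_single,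
      Fock.annihilateWord_replicate hw, map_add, map_sum, ← List.cons_append,
      ← List.replicate_succ, ofFock_single_replicate k a hw]
    congr 1
    refine Finset.sum_congr rfl fun i _ => ?_
    rw [map_smul, ofFock_single_replicate k a hw, smul_mul_assoc]

variable {k a} {τ : A →ₗ[ℂ] ℂ}

/-- A product of blocks is an alternating product of centred elements. -/
theorem exists_alternating_eq_blockProd
    (hτ : ∀ c n, τ (cumulantPoly (k c) (a c) (n + 1)) = 0) (w : List Bool) (c : Bool) (n : ℕ) :
    ∃ (m : ℕ) (i : Fin (m + 1) → Bool) (x : Fin (m + 1) → A),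
      i 0 = c ∧ (∀ j, x j ∈ Algebra.adjoin ℂ {a (i j)}) ∧ (∀ j, τ (x j) = 0) ∧
      (∀ j : Fin m, i j.castSucc ≠ i j.succ) ∧
      (List.ofFn x).prod = blockProd k a w c (n + 1) := by
  induction w generalizing c n with
  | nil =>
    refine ⟨0, fun _ => c, fun _ => cumulantPoly (k c) (a c) (n + 1), rfl,
      fun _ => cumulantPoly_mem_adjoin _ _ _, fun _ => hτ c n, fun j => j.elim0, ?_⟩
    simp [blockProd]
  | cons d w ih =>
    by_cases h : d = c
    · rw [blockProd, if_pos h]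
      exact ih c (n + 1)
    · obtain ⟨m, i, x, hi0, hx, hx0, hi, hp⟩ := ih d 0
      refine ⟨m + 1, Fin.cons c i, Fin.cons (cumulantPoly (k c) (a c) (n + 1)) x, rfl,
        Fin.cases (cumulantPoly_mem_adjoin _ _ _) (fun j => hx j), Fin.cases (hτ c n) hx0,
        fun j => ?_, ?_⟩
      · refine Fin.cases ?_ (fun j => ?_) j
        · simpa [hi0] using Ne.symm h
        · exact hi j
      · rw [List.ofFn_succ, List.prod_cons, blockProd, if_neg h, ← hp]
        simp

/-- Freeness identifies the functional with the vacuum coefficient on the Fock space. -/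
theorem apply_ofFock (h1 : τ 1 = 1)
    (hfree : FreelyIndependent τ fun s => Algebra.adjoin ℂ {a s})
    (hτ : ∀ c n, τ (cumulantPoly (k c) (a c) (n + 1)) = 0) (x : Fock) :
    τ (ofFock k a x) = x [] := by
  induction x using Finsupp.induction_linear with
  | zero => simp
  | add x y hx hy => rw [map_add, map_add, hx, hy, Finsupp.add_apply]
  | single w z =>
    rw [ofFock, Finsupp.linearCombination_single, map_smul, smul_eq_mul]
    cases w with
    | nil => simp [blockProd, h1]
    | cons d w =>
      obtain ⟨m, i, x, -, hx, hx0, hi, hp⟩ := exists_alternating_eq_blockProd hτ w d 0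
      rw [blockProd_cons, ← hp, hfree m i x hx hx0 hi]
      simp

/-- The free cumulants of a sum of two free elements are the sums of the free cumulants. -/
theorem apply_cumulantPoly_add (h1 : τ 1 = 1)
    (hfree : FreelyIndependent τ fun s => Algebra.adjoin ℂ {a s})
    (hτ : ∀ c n, τ (cumulantPoly (k c) (a c) (n + 1)) = 0) (n : ℕ) :
    τ (cumulantPoly (k true + k false) (a true + a false) n) = if n = 0 then 1 else 0 := by
  have h : cumulantPoly (k true + k false) (a true + a false) n =
      ofFock k a (Fock.wordSum n) := by
    refine cumulantPoly_apply_eq (k true + k false) (a true + a false) (LinearMap.id : A →ₗ[ℂ] A)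
      (LinearMap.mulLeft ℂ (a true + a false)) (fun n => ofFock k a (Fock.wordSum n))
      (fun x => rfl) ?_ (fun n => ?_) n
    · simp [Fock.wordSum, Fock.vacuum, ofFock, blockProd]
    · rw [LinearMap.mulLeft_apply, add_mul, ← ofFock_letterOp, ← ofFock_letterOp, ← map_add,
        Fock.letterOp_add_letterOp_wordSum, map_add, map_sum]
      simp_rw [map_smul]
  rw [h, apply_ofFock h1 hfree hτ, Fock.wordSum_apply_nil]

end Uniqueness

/-- Free convolution is characterized by the addition of free cumulants. -/
theorem isFreeConv_momentsOfCumulants_iff (k k' m : ℕ → ℂ) :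
    IsFreeConv (momentsOfCumulants k) (momentsOfCumulants k') m ↔
      m = momentsOfCumulants (k + k') := by
  have key : ∀ m, IsFreeConv (momentsOfCumulants k) (momentsOfCumulants k') m →
      m = momentsOfCumulants (k + k') := by
    rintro m ⟨A, _, _, τ, a, b, h1, hfree, ha, hb, hab⟩
    funext j
    let K : Bool → ℕ → ℂ := fun s => if s then k else k'
    let g : Bool → A := fun s => if s then a else b
    have hτ : ∀ c n, τ (cumulantPoly (K c) (g c) (n + 1)) = 0 := by
      intro c n
      cases c
      · exact (apply_cumulantPoly hb (n + 1)).trans (by simp)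
      · exact (apply_cumulantPoly ha (n + 1)).trans (by simp)
    rw [← hab]
    exact apply_pow_eq_momentsOfCumulants (apply_cumulantPoly_add (k := K) (a := g) h1 hfree hτ) j
  refine ⟨key m, ?_⟩
  have hex : IsFreeConv (momentsOfCumulants k) (momentsOfCumulants k') fun j =>
      Fock.vacuumState ((Fock.letterOp true k + Fock.letterOp false k') ^ j) := by
    refine ⟨Module.End ℂ Fock, inferInstance, inferInstance, Fock.vacuumState,
      Fock.letterOp true k, Fock.letterOp false k', Fock.vacuumState_one, ?_,
      Fock.vacuumState_pow true k, Fock.vacuumState_pow false k', fun _ => rfl⟩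
    convert Fock.freelyIndependent (fun s : Bool => if s then k else k') using 3 with s
    cases s <;> rfl
  rintro rfl
  rwa [← key _ hex]

theorem freeConv_momentsOfCumulants (k k' : ℕ → ℂ) :
    freeConv (momentsOfCumulants k) (momentsOfCumulants k') = momentsOfCumulants (k + k') :=
  (isFreeConv_momentsOfCumulants_iff k k' _).1
    (Classical.epsilon_spec (p := IsFreeConv (momentsOfCumulants k) (momentsOfCumulants k'))
      ⟨_, (isFreeConv_momentsOfCumulants_iff k k' _).2 rfl⟩)

/-! ### Free cumulants as functions of the moments -/

theorem momentArray_congr {k k' : ℕ → ℂ} (j n : ℕ) (h : ∀ i < n + j, k i = k' i) :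
    momentArray k j n = momentArray k' j n := by
  induction j generalizing n with
  | zero => rfl
  | succ j ih =>
    rw [momentArray, momentArray, ih (n + 1) fun i hi => h i (by omega)]
    congr 1
    refine Finset.sum_congr rfl fun i hi => ?_
    rw [Finset.mem_range] at hi
    rw [h i (by omega), ih (n - i) fun i' hi' => h i' (by omega)]

/-- The entries of the moment array depend on the last free cumulant that occurs in them through
a summand with coefficient `1`. -/
theorem momentArray_succ_eq (k : ℕ → ℂ) (j n : ℕ) : momentArray k (j + 1) n =
    k (n + j) + momentArray (fun i => if i < n + j then k i else 0) (j + 1) n := by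
  induction j generalizing n with
  | zero =>
    have : ∀ k : ℕ → ℂ, momentArray k (0 + 1) n = k n := by
      intro k
      rw [momentArray, Finset.sum_range_succ, Finset.sum_eq_zero]
      · simp [momentArray]
      · intro i hi
        rw [Finset.mem_range] at hi
        have : n - i ≠ 0 := by omega
        simp [momentArray, this]
    rw [this, this]
    simp
  | succ j ih =>
    have e : n + 1 + j = n + (j + 1) := by omega
    rw [momentArray, ih (n + 1), e, add_assoc]
    congr 1
    conv_rhs => rw [momentArray]
    congr 1
    refine Finset.sum_congr rfl fun i hi => ?_
    rw [Finset.mem_range] at hi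
    rw [if_pos (by omega)]
    congr 1
    exact momentArray_congr _ _ fun i' hi' => by rw [if_pos (by omega)]

theorem momentsOfCumulants_succ_eq (k : ℕ → ℂ) (n : ℕ) : momentsOfCumulants k (n + 1) =
    k n + momentsOfCumulants (fun i => if i < n then k i else 0) (n + 1) := by
  have := momentArray_succ_eq k n 0
  simpa [momentsOfCumulants] using this

/-- The free cumulants `κ_{n+1}` of a sequence of moments. -/
noncomputable def freeCumulants (m : ℕ → ℂ) : ℕ → ℂ
  | n => m (n + 1) -
      momentsOfCumulants (fun i => if _h : i < n then freeCumulants m i else 0) (n + 1)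

theorem freeCumulants_eq (m : ℕ → ℂ) (n : ℕ) : freeCumulants m n = m (n + 1) -
    momentsOfCumulants (fun i => if i < n then freeCumulants m i else 0) (n + 1) := by
  rw [freeCumulants]
  simp

theorem momentsOfCumulants_freeCumulants {m : ℕ → ℂ} (h : m 0 = 1) :
    momentsOfCumulants (freeCumulants m) = m := by
  funext j
  cases j with
  | zero => rw [momentsOfCumulants_zero, h]
  | succ n => rw [momentsOfCumulants_succ_eq, freeCumulants_eq, sub_add_cancel]

theorem freeCumulants_momentsOfCumulants (k : ℕ → ℂ) :
    freeCumulants (momentsOfCumulants k) = k := by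
  funext n
  induction n using Nat.strong_induction_on with
  | _ n ih =>
    rw [freeCumulants_eq, momentsOfCumulants_succ_eq, sub_eq_iff_eq_add]
    congr 2
    funext i
    split_ifs with h
    · rw [ih i h]
    · rfl

/-- The free convolution of two sequences of moments exists and is unique. -/
theorem isFreeConv_iff_eq_freeConv {m₁ m₂ : ℕ → ℂ} (h₁ : m₁ 0 = 1) (h₂ : m₂ 0 = 1) (m : ℕ → ℂ) :
    IsFreeConv m₁ m₂ m ↔ m = freeConv m₁ m₂ := by
  rw [← momentsOfCumulants_freeCumulants h₁, ← momentsOfCumulants_freeCumulants h₂,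
    isFreeConv_momentsOfCumulants_iff, freeConv_momentsOfCumulants]

/-! ### The free central limit operator in terms of free cumulants -/

theorem momentArray_scale (r : ℂ) (k : ℕ → ℂ) (j n : ℕ) :
    momentArray (fun i => r ^ (i + 1) * k i) j n = r ^ (n + j) * momentArray k j n := by
  induction j generalizing n with
  | zero => by_cases h : n = 0 <;> simp [momentArray, h]
  | succ j ih =>
    rw [momentArray, momentArray, ih, mul_add, Finset.mul_sum]
    congr 1
    · congr 2; omega
    · refine Finset.sum_congr rfl fun i hi => ?_
      rw [Finset.mem_range] at hi
      rw [ih, show n + (j + 1) = (i + 1) + (n - i + j) by omega, pow_add]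
      ring

/-- The factor by which the free central limit operator multiplies the free cumulant `κ_{i+1}`,
and which is also its eigenvalue. -/
noncomputable def cltFactor (i : ℕ) : ℂ := 2 / (Real.sqrt 2 : ℂ) ^ (i + 1)

theorem freeT_eq {m : ℕ → ℂ} (h : m 0 = 1) :
    freeT m = momentsOfCumulants fun i => cltFactor i * freeCumulants m i := by
  funext j
  have h2 : (fun i => cltFactor i * freeCumulants m i) =
      fun i => ((Real.sqrt 2 : ℂ)⁻¹) ^ (i + 1) * (freeCumulants m + freeCumulants m) i := by
    funext i
    rw [cltFactor, inv_pow, Pi.add_apply]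
    ring
  rw [freeT, h2, momentsOfCumulants, momentArray_scale, ← momentsOfCumulants,
    ← freeConv_momentsOfCumulants, momentsOfCumulants_freeCumulants h, zero_add, inv_pow,
    div_eq_inv_mul]

/-! ### Derivatives of moments and free cumulants -/

/-- The derivative of `momentArray` at `k` in the direction `k'`. -/
noncomputable def momentArrayDeriv (k k' : ℕ → ℂ) : ℕ → ℕ → ℂ
  | 0, _ => 0
  | j + 1, n => momentArrayDeriv k k' j (n + 1) + ∑ i ∈ Finset.range (n + 1),
      (k' i * momentArray k j (n - i) + k i * momentArrayDeriv k k' j (n - i))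

theorem hasDerivAt_momentArray {k : ℝ → ℕ → ℂ} {k' : ℕ → ℂ} {t : ℝ}
    (hk : ∀ i, HasDerivAt (fun ε => k ε i) (k' i) t) (j n : ℕ) :
    HasDerivAt (fun ε => momentArray (k ε) j n) (momentArrayDeriv (k t) k' j n) t := by
  induction j generalizing n with
  | zero => exact hasDerivAt_const _ _
  | succ j ih =>
    simp only [momentArray, momentArrayDeriv]
    exact (ih (n + 1)).add (HasDerivAt.fun_sum fun i _ => (hk i).mul (ih (n - i)))

theorem differentiableAt_freeCumulants {m : ℝ → ℕ → ℂ} {t : ℝ}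
    (hm : ∀ j, DifferentiableAt ℝ (fun ε => m ε j) t) (n : ℕ) :
    DifferentiableAt ℝ (fun ε => freeCumulants (m ε) n) t := by
  induction n using Nat.strong_induction_on with
  | _ n ih =>
    simp_rw [freeCumulants_eq (m _) n]
    refine (hm (n + 1)).sub ?_
    refine (hasDerivAt_momentArray
      (k' := fun i => deriv (fun ε => if i < n then freeCumulants (m ε) i else 0) t)
      (fun i => DifferentiableAt.hasDerivAt ?_) (n + 1) 0).differentiableAt
    by_cases h : i < n
    · simpa only [if_pos h] using ih i h
    · simp only [if_neg h]; exact differentiableAt_const _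

/-- The derivative of `cumulantPoly` at `k` in the direction `k'`. -/
noncomputable def cumulantPolyDeriv (k k' : ℕ → ℂ) : ℕ → Polynomial ℂ
  | 0 => 0
  | n + 1 => Polynomial.X * cumulantPolyDeriv k k' n - ∑ i : Fin (n + 1),
      (k' i • cumulantPoly k Polynomial.X (n - i) + k i • cumulantPolyDeriv k k' (n - i))
  decreasing_by all_goals omega

theorem cumulantPolyDeriv_succ (k k' : ℕ → ℂ) (n : ℕ) : cumulantPolyDeriv k k' (n + 1) =
    Polynomial.X * cumulantPolyDeriv k k' n - ∑ i ∈ Finset.range (n + 1),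
      (k' i • cumulantPoly k Polynomial.X (n - i) + k i • cumulantPolyDeriv k k' (n - i)) := by
  rw [cumulantPolyDeriv, Finset.sum_range fun i =>
    (k' i • cumulantPoly k Polynomial.X (n - i) + k i • cumulantPolyDeriv k k' (n - i))]

/-- The linear functional on polynomials with the moments `m`. -/
noncomputable def momentFunctional (m : ℕ → ℂ) : Polynomial ℂ →ₗ[ℂ] ℂ :=
  Polynomial.lsum fun j => (LinearMap.id : ℂ →ₗ[ℂ] ℂ).smulRight (m j)

@[simp] theorem momentFunctional_X_pow (m : ℕ → ℂ) (j : ℕ) :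
    momentFunctional m (Polynomial.X ^ j) = m j := by
  simp [momentFunctional, Polynomial.lsum_apply, Polynomial.X_pow_eq_monomial,
    Polynomial.sum_monomial_index]

/-- The product rule for `L(x^j P_n)`, where both the functional `L` and the polynomials `P_n`
depend on the free cumulants. -/
theorem momentArrayDeriv_eq (k k' : ℕ → ℂ) (j n : ℕ) : momentArrayDeriv k k' j n =
    momentFunctional (fun j => momentArrayDeriv k k' j 0)
        (Polynomial.X ^ j * cumulantPoly k Polynomial.X n) +
      momentFunctional (momentsOfCumulants k) (Polynomial.X ^ j * cumulantPolyDeriv k k' n) := by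
  have hP := fun j n => apply_pow_mul_cumulantPoly (apply_cumulantPoly
    (momentFunctional_X_pow (momentsOfCumulants k))) j n
  induction n using Nat.strong_induction_on generalizing j with
  | _ n ih =>
    cases n with
    | zero => simp [cumulantPolyDeriv]
    | succ n =>
      have h1 : momentArrayDeriv k k' j (n + 1) = momentArrayDeriv k k' (j + 1) n -
          ∑ i ∈ Finset.range (n + 1),
            (k' i * momentArray k j (n - i) + k i * momentArrayDeriv k k' j (n - i)) := by
        conv_rhs => rw [momentArrayDeriv]
        ring
      rw [h1, ih n (by omega), cumulantPoly_succ, cumulantPolyDeriv_succ, mul_sub, mul_sub,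
        map_sub, map_sub, ← mul_assoc, ← pow_succ, ← mul_assoc, ← pow_succ, Finset.mul_sum,
        Finset.mul_sum, map_sum, map_sum, sub_add_sub_comm, ← Finset.sum_add_distrib]
      congr 1
      refine Finset.sum_congr rfl fun i hi => ?_
      rw [ih (n - i) (by omega), ← hP]
      simp only [mul_add, mul_smul_comm, map_add, map_smul, smul_eq_mul]
      ring

/-! ### Linearization at the semicircle law -/

/-- The free cumulants of the semicircle law: only `κ_2 = 1` does not vanish. -/
def semicircleCumulants (i : ℕ) : ℂ := if i = 1 then 1 else 0

theorem sum_semicircleCumulants {M : Type*} [AddCommGroup M] [Module ℂ M] (y : ℕ → M) (n : ℕ) :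
    ∑ i ∈ Finset.range (n + 1), semicircleCumulants i • y (n - i) =
      if n = 0 then 0 else y (n - 1) := by
  cases n with
  | zero => simp [semicircleCumulants]
  | succ n =>
    rw [Finset.sum_eq_single 1]
    · simp [semicircleCumulants]
    · intro i _ hi; simp [semicircleCumulants, hi]
    · intro h; simp at h

open Polynomial Chebyshev

/-- The polynomials of the semicircle law are the Chebyshev polynomials of the second kind. -/
theorem cumulantPoly_semicircle (n : ℕ) :
    cumulantPoly semicircleCumulants (X : ℂ[X]) n = S ℂ n := by
  refine cumulantPoly_apply_eq semicircleCumulants (X : ℂ[X]) (LinearMap.id : ℂ[X] →ₗ[ℂ] ℂ[X])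
    (LinearMap.mulLeft ℂ X) (fun n => S ℂ n) (fun x => rfl) (by simp) (fun n => ?_) n
  rw [sum_semicircleCumulants fun n : ℕ => S ℂ n]
  cases n with
  | zero => simp
  | succ n =>
    have := S_add_two ℂ (n : ℤ)
    simp only [LinearMap.mulLeft_apply, Nat.add_eq_zero_iff, one_ne_zero, and_false, if_false,
      Nat.add_sub_cancel]
    push_cast
    rw [add_assoc, show (1 + 1 : ℤ) = 2 from rfl, this, sub_add_cancel]

/-- The convolution `∑_{j < N} S_{N-1-j} S_j` of Chebyshev polynomials of the second kind. -/
noncomputable def sConv (N : ℕ) : ℂ[X] := ∑ j ∈ Finset.range N, S ℂ (N - 1 - j) * S ℂ j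

theorem sConv_add_two (N : ℕ) : sConv (N + 2) = X * sConv (N + 1) - sConv N + S ℂ (N + 1) := by
  have h : sConv N = ∑ j ∈ Finset.range (N + 1), S ℂ (N - 1 - j) * S ℂ j := by
    rw [Finset.sum_range_succ, sConv]
    simp
  rw [h, sConv, Finset.sum_range_succ, sConv, Finset.mul_sum, ← Finset.sum_sub_distrib]
  congr 1
  · refine Finset.sum_congr rfl fun j _ => ?_
    have := S_add_two ℂ ((N : ℤ) - 1 - j)
    rw [← mul_assoc, ← sub_mul]
    congr 1
    push_cast
    rw [show (N : ℤ) + 2 - 1 - j = N - 1 - j + 2 by ring, this]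
    congr 3; ring
  · push_cast
    rw [show (N : ℤ) + 2 - 1 - (N + 1) = 0 by ring, S_zero, one_mul]

/-- The derivatives of the polynomials `P_n` at the semicircle law, where `P_n = S_n`. -/
theorem cumulantPolyDeriv_semicircle (k' : ℕ → ℂ) (n : ℕ) :
    cumulantPolyDeriv semicircleCumulants k' n =
      -∑ i ∈ Finset.range n, k' i • sConv (n - i) := by
  induction n using Nat.strong_induction_on with
  | _ n ih =>
    match n with
    | 0 => simp [cumulantPolyDeriv]
    | 1 =>
      rw [cumulantPolyDeriv_succ]
      simp [cumulantPolyDeriv, sConv]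
    | n + 2 =>
      have h0 : ∀ N, ∑ i ∈ Finset.range N, k' i • sConv (N - i) =
          ∑ i ∈ Finset.range (N + 1), k' i • sConv (N - i) := fun N => by
        rw [Finset.sum_range_succ]; simp [sConv]
      rw [cumulantPolyDeriv_succ, Finset.sum_add_distrib, sum_semicircleCumulants,
        if_neg (by omega), ih (n + 1) (by omega), Nat.add_sub_cancel, ih n (by omega), h0 n,
        Finset.sum_range_succ (fun i => k' i • sConv (n + 2 - i)) (n + 1), h0 (n + 1),
        Finset.sum_range_succ (fun i => k' i • sConv (n + 1 - i)) (n + 1),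
        Finset.sum_range_succ (fun i => k' i • cumulantPoly semicircleCumulants X (n + 1 - i))
          (n + 1)]
      have e : ∀ i ∈ Finset.range (n + 1), k' i • sConv (n + 2 - i) =
          X * (k' i • sConv (n + 1 - i)) - k' i • sConv (n - i) +
            k' i • cumulantPoly semicircleCumulants X (n + 1 - i) := by
        intro i hi
        rw [Finset.mem_range] at hi
        rw [show n + 2 - i = (n - i) + 2 by omega, sConv_add_two, cumulantPoly_semicircle,
          show n + 1 - i = n - i + 1 by omega, smul_add, smul_sub, mul_smul_comm]
        push_cast
        rfl
      rw [Finset.sum_congr rfl e, Finset.sum_add_distrib, Finset.sum_sub_distrib, mul_neg, mul_add,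
        Finset.mul_sum]
      have e1 : sConv 1 = 1 := by simp [sConv]
      have e0 : sConv 0 = 0 := by simp [sConv]
      rw [Nat.sub_self, e0, show n + 2 - (n + 1) = 1 by omega, e1, cumulantPoly_zero, smul_zero,
        mul_zero]
      ring

/-- The Chebyshev polynomials of the second kind are orthonormal for the semicircle law. -/
theorem apply_S_mul_S {L : ℂ[X] →ₗ[ℂ] ℂ} (hL : ∀ n : ℕ, L (S ℂ n) = if n = 0 then 1 else 0)
    (a b : ℕ) : L (S ℂ a * S ℂ b) = if a = b then 1 else 0 := by
  have hX : ∀ b : ℕ, X * S ℂ (b + 1 : ℕ) = S ℂ (b + 2 : ℕ) + S ℂ (b : ℕ) := fun b => by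
    push_cast
    rw [S_add_two, sub_add_cancel]
  induction a using Nat.strong_induction_on generalizing b with
  | _ a ih =>
    match a with
    | 0 => simp [hL, eq_comm]
    | 1 =>
      cases b with
      | zero => simpa using hL 1
      | succ b =>
        have : S ℂ ((1 : ℕ) : ℤ) = X := by simp
        rw [this, hX, map_add, hL, hL]
        by_cases h : b = 0 <;> simp [h]
    | a + 2 =>
      have h1 : S ℂ (a + 2 : ℕ) = X * S ℂ (a + 1 : ℕ) - S ℂ a := by rw [hX]; ring
      rw [h1, sub_mul, map_sub, ih a (by omega), mul_comm X, mul_assoc]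
      cases b with
      | zero =>
        have e : X * S ℂ ((0 : ℕ) : ℤ) = S ℂ ((1 : ℕ) : ℤ) := by simp
        rw [e, ih (a + 1) (by omega)]
        by_cases h : a = 0 <;> simp [h]
      | succ b =>
        rw [hX, mul_add, map_add, ih (a + 1) (by omega), ih (a + 1) (by omega)]
        have e1 : a + 1 = b + 2 ↔ a = b + 1 := by omega
        have e2 : a + 2 = b + 1 ↔ a + 1 = b := by omega
        simp only [e1, e2]
        ring

theorem apply_sConv {L : ℂ[X] →ₗ[ℂ] ℂ} (hL : ∀ n : ℕ, L (S ℂ n) = if n = 0 then 1 else 0)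
    (N : ℕ) : L (sConv N) = if Odd N then 1 else 0 := by
  have h : ∀ j ∈ Finset.range N, L (S ℂ (N - 1 - j) * S ℂ j) = if N = 2 * j + 1 then 1 else 0 := by
    intro j hj
    rw [Finset.mem_range] at hj
    have : (N : ℤ) - 1 - j = ((N - 1 - j : ℕ) : ℤ) := by omega
    rw [this, apply_S_mul_S hL]
    congr 1
    rw [eq_iff_iff]; omega
  rw [sConv, map_sum, Finset.sum_congr rfl h]
  by_cases hN : Odd N
  · obtain ⟨j, rfl⟩ := hN
    rw [if_pos ⟨j, rfl⟩, Finset.sum_eq_single j]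
    · simp
    · intro i _ hi; rw [if_neg (by omega)]
    · intro hj; rw [Finset.mem_range] at hj; omega
  · rw [if_neg hN]
    exact Finset.sum_eq_zero fun j _ => if_neg fun e => hN ⟨j, e⟩

theorem momentFunctional_semicircle_S (n : ℕ) :
    momentFunctional (momentsOfCumulants semicircleCumulants) (S ℂ n) = if n = 0 then 1 else 0 := by
  rw [← cumulantPoly_semicircle]
  exact apply_cumulantPoly (momentFunctional_X_pow _) n

theorem momentFunctional_deriv_S (k' : ℕ → ℂ) (n : ℕ) :
    momentFunctional (fun j => momentArrayDeriv semicircleCumulants k' j 0) (S ℂ n) =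
      ∑ i ∈ Finset.range n, if Odd (n - i) then k' i else 0 := by
  have h := momentArrayDeriv_eq semicircleCumulants k' 0 n
  rw [pow_zero, one_mul, one_mul, momentArrayDeriv, cumulantPoly_semicircle,
    cumulantPolyDeriv_semicircle, map_neg, ← sub_eq_add_neg, eq_comm, sub_eq_zero] at h
  rw [h, map_sum]
  refine Finset.sum_congr rfl fun i _ => ?_
  rw [map_smul, apply_sConv momentFunctional_semicircle_S, smul_eq_mul, mul_ite, mul_one, mul_zero]

theorem C_add_two_eq (n : ℕ) : C ℂ (n + 2 : ℕ) = S ℂ (n + 2 : ℕ) - S ℂ n := by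
  rw [C_eq_S_sub_X_mul_S]
  push_cast
  have := S_add_two ℂ (n : ℤ)
  rw [show (n : ℤ) + 2 - 1 = n + 1 by ring]
  linear_combination this

/-- At the semicircle law, the derivative of the free cumulant `κ_{n+1}` with respect to the
moments is the Chebyshev polynomial `C_{n+1}` of the first kind. -/
theorem momentFunctional_deriv_C (k' : ℕ → ℂ) (n : ℕ) :
    momentFunctional (fun j => momentArrayDeriv semicircleCumulants k' j 0) (C ℂ (n + 1 : ℕ)) =
      k' n := by
  cases n with
  | zero =>
    have := momentFunctional_deriv_S k' 1
    simpa using this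
  | succ n =>
    rw [C_add_two_eq, map_sub, momentFunctional_deriv_S, momentFunctional_deriv_S,
      Finset.sum_range_succ, Finset.sum_range_succ, sub_eq_iff_eq_add, add_comm (k' _)]
    have e1 : ¬ Odd (n + 2 - n) := by
      rw [Nat.add_sub_cancel_left]; decide
    have e2 : Odd (n + 2 - (n + 1)) := by
      rw [show n + 2 - (n + 1) = 1 by omega]; decide
    rw [if_neg e1, if_pos e2, add_zero]
    congr 1
    refine Finset.sum_congr rfl fun i hi => ?_
    rw [Finset.mem_range] at hi
    rw [show n + 2 - i = n - i + 2 by omega]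
    have : Odd (n - i + 2) ↔ Odd (n - i) := by
      rw [Nat.odd_add]; simp
    simp only [this]

/-- The Chebyshev polynomials of the first kind span the polynomials. -/
theorem functional_eq_zero_of_C {L : ℂ[X] →ₗ[ℂ] ℂ} (h0 : L 1 = 0)
    (h : ∀ n : ℕ, L (C ℂ (n + 1 : ℕ)) = 0) : L = 0 := by
  have hS : ∀ n : ℕ, L (S ℂ n) = 0 := by
    intro n
    induction n using Nat.strong_induction_on with
    | _ n ih =>
      match n with
      | 0 => simpa using h0
      | 1 => simpa using h 0
      | n + 2 =>
        have := h (n + 1)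
        rwa [C_add_two_eq, map_sub, ih n (by omega), sub_zero] at this
  refine LinearMap.ext fun p => ?_
  have hp : p ∈ Algebra.adjoin ℂ {(X : ℂ[X])} := by rw [Polynomial.adjoin_X]; trivial
  have := mem_span_cumulantPoly semicircleCumulants hp
  have hle :
      Submodule.span ℂ (Set.range (cumulantPoly semicircleCumulants (X : ℂ[X]))) ≤ L.ker := by
    rw [Submodule.span_le]
    rintro _ ⟨n, rfl⟩
    rw [cumulantPoly_semicircle]
    exact hS n
  exact hle this

/-- The factor of `κ_2` is `1`. -/
theorem cltFactor_mul_semicircleCumulants :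
    (fun i => cltFactor i * semicircleCumulants i) = semicircleCumulants := by
  funext i
  by_cases h : i = 1
  · subst h
    have : (Real.sqrt 2 : ℂ) ^ 2 = 2 := by
      rw [← Complex.ofReal_pow, Real.sq_sqrt (by norm_num)]; norm_num
    simp [semicircleCumulants, cltFactor, this]
  · simp [semicircleCumulants, h]

theorem freeT_momentsOfCumulants_semicircle :
    freeT (momentsOfCumulants semicircleCumulants) = momentsOfCumulants semicircleCumulants := by
  rw [freeT_eq (momentsOfCumulants_zero _), freeCumulants_momentsOfCumulants,
    cltFactor_mul_semicircleCumulants]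

/-- The linearization of the free central limit operator at the semicircle law is diagonal in the
Chebyshev polynomials of the first kind. -/
theorem hasDerivAt_freeT {m : ℝ → ℕ → ℂ} {m' m'' : ℕ → ℂ} (hm1 : ∀ ε, m ε 0 = 1)
    (hm0 : m 0 = momentsOfCumulants semicircleCumulants)
    (hm : ∀ j, HasDerivAt (fun ε => m ε j) (m' j) 0) (h0 : m'' 0 = 0)
    (h : ∀ n : ℕ, momentFunctional m'' (C ℂ (n + 1 : ℕ)) =
      cltFactor n * momentFunctional m' (C ℂ (n + 1 : ℕ))) (j : ℕ) :
    HasDerivAt (fun ε => freeT (m ε) j) (m'' j) 0 := by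
  set k' : ℕ → ℂ := fun i => deriv (fun ε => freeCumulants (m ε) i) 0 with hk'
  have hk : ∀ i, HasDerivAt (fun ε => freeCumulants (m ε) i) (k' i) 0 := fun i =>
    (differentiableAt_freeCumulants (fun j => (hm j).differentiableAt) i).hasDerivAt
  have hk0 : freeCumulants (m 0) = semicircleCumulants := by
    rw [hm0, freeCumulants_momentsOfCumulants]
  have hmd : m' = fun j => momentArrayDeriv semicircleCumulants k' j 0 := by
    funext j
    have h1 := hasDerivAt_momentArray hk j 0
    rw [hk0] at h1
    refine (hm j).unique (h1.congr_of_eventuallyEq (Eventually.of_forall fun ε => ?_))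
    exact (congrFun (momentsOfCumulants_freeCumulants (hm1 ε)) j).symm
  have hT : HasDerivAt (fun ε => freeT (m ε) j)
      (momentArrayDeriv semicircleCumulants (fun i => cltFactor i * k' i) j 0) 0 := by
    have h1 := hasDerivAt_momentArray (fun i => (hk i).const_mul (cltFactor i)) j 0
    rw [hk0, cltFactor_mul_semicircleCumulants] at h1
    refine h1.congr_of_eventuallyEq (Eventually.of_forall fun ε => ?_)
    exact congrFun (freeT_eq (hm1 ε)) j
  convert hT using 1
  have hL : momentFunctional m'' - momentFunctional
      (fun j => momentArrayDeriv semicircleCumulants (fun i => cltFactor i * k' i) j 0) = 0 := by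
    refine functional_eq_zero_of_C ?_ fun n => ?_
    · rw [LinearMap.sub_apply, ← pow_zero X, momentFunctional_X_pow, momentFunctional_X_pow, h0,
        momentArrayDeriv, sub_zero]
    · rw [LinearMap.sub_apply, h n, momentFunctional_deriv_C, hmd, momentFunctional_deriv_C,
        sub_self]
  have := congrArg (fun L : ℂ[X] →ₗ[ℂ] ℂ => L (X ^ j)) hL
  simpa [sub_eq_zero] using this

end CentralLimit

namespace CentralLimit

/-! ### Polynomials as vectors and functionals -/

open Polynomial

theorem momentFunctional_momentSeq {μ : Measure ℝ} (hμ : ∀ k : ℕ, Integrable (fun x => x ^ k) μ)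
    (p : ℝ[X]) : momentFunctional (momentSeq μ) (p.map Complex.ofRealHom) =
      ((∫ x, p.eval x ∂μ : ℝ) : ℂ) := by
  have hi : ∀ p : ℝ[X], Integrable (fun x => p.eval x) μ := by
    intro p
    induction p using Polynomial.induction_on' with
    | add p q hp hq => simpa using! hp.add hq
    | monomial n a => simpa using (hμ n).const_mul a
  induction p using Polynomial.induction_on' with
  | add p q hp hq =>
    simp_rw [eval_add]
    rw [Polynomial.map_add, map_add, hp, hq, integral_add (hi p) (hi q), Complex.ofReal_add]
  | monomial n a =>
    rw [map_monomial, ← smul_X_eq_monomial, map_smul, momentFunctional_X_pow]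
    simp_rw [eval_monomial]
    rw [integral_const_mul, Complex.ofReal_mul]
    rfl

namespace AdmissibleWeight

variable {φ : ℝ → ℝ}

/-- The vector `p / φ` of `L²(φ dx)`, for a polynomial `p`. -/
noncomputable def polyVec (hφ : AdmissibleWeight φ) : ℂ[X] →ₗ[ℂ] L2 φ :=
  Polynomial.lsum fun k => (LinearMap.id : ℂ →ₗ[ℂ] ℂ).smulRight (hφ.monomialVec k)

theorem polyVec_monomial (hφ : AdmissibleWeight φ) (k : ℕ) (a : ℂ) :
    hφ.polyVec (monomial k a) = a • hφ.monomialVec k := by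
  simp [polyVec, Polynomial.lsum_apply, Polynomial.sum_monomial_index]

theorem coeFn_polyVec (hφ : AdmissibleWeight φ) (p : ℂ[X]) :
    hφ.polyVec p =ᵐ[weightMeasure φ] fun x => p.eval (x : ℂ) / φ x := by
  induction p using Polynomial.induction_on' with
  | add p q hp hq =>
    rw [map_add]
    filter_upwards [Lp.coeFn_add (hφ.polyVec p) (hφ.polyVec q), hp, hq] with x h1 h2 h3
    rw [h1, Pi.add_apply, h2, h3, eval_add, add_div]
  | monomial n a =>
    rw [polyVec_monomial]
    filter_upwards [Lp.coeFn_smul a (hφ.monomialVec n), hφ.coeFn_monomialVec n] with x h1 h2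
    rw [h1, Pi.smul_apply, h2, eval_monomial, smul_eq_mul, mul_div_assoc]

theorem inner_polyVec (hφ : AdmissibleWeight φ) (p : ℝ[X]) (f : L2 φ) :
    inner ℂ (hφ.polyVec (p.map Complex.ofRealHom)) f =
      momentFunctional (l2Moment φ f) (p.map Complex.ofRealHom) := by
  induction p using Polynomial.induction_on' with
  | add p q hp hq => rw [Polynomial.map_add, map_add, map_add, inner_add_left, hp, hq]
  | monomial n a =>
    rw [map_monomial, polyVec_monomial, inner_smul_left, hφ.inner_monomialVec,
      ← smul_X_eq_monomial, map_smul, momentFunctional_X_pow, smul_eq_mul]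
    simp

theorem inner_polyVec_polyVec (hφ : AdmissibleWeight φ) (p q : ℝ[X]) :
    inner ℂ (hφ.polyVec (p.map Complex.ofRealHom)) (hφ.polyVec (q.map Complex.ofRealHom)) =
      ((∫ x, p.eval x * q.eval x / φ x : ℝ) : ℂ) := by
  rw [L2.inner_def, ← integral_complex_ofReal]
  have : ∫ x, inner ℂ (hφ.polyVec (p.map Complex.ofRealHom) x)
      (hφ.polyVec (q.map Complex.ofRealHom) x) ∂weightMeasure φ =
      ∫ x, ((p.eval x * q.eval x / φ x ^ 2 : ℝ) : ℂ) ∂weightMeasure φ := by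
    refine integral_congr_ae ?_
    filter_upwards [hφ.coeFn_polyVec (p.map Complex.ofRealHom),
      hφ.coeFn_polyVec (q.map Complex.ofRealHom)] with x h1 h2
    have e : ∀ p : ℝ[X], (p.map Complex.ofRealHom).eval (x : ℂ) = ((p.eval x : ℝ) : ℂ) :=
      fun p => by
        rw [eval_map, ← Complex.ofRealHom_eq_coe, eval₂_at_apply, Complex.ofRealHom_eq_coe]
    rw [h1, h2, e, e, RCLike.inner_apply, map_div₀, Complex.conj_ofReal, Complex.conj_ofReal]
    push_cast
    rw [div_mul_div_comm, pow_two, mul_comm ((p.eval x : ℝ) : ℂ)]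
  rw [this, hφ.integral_eq]
  refine integral_congr_ae (ae_of_all _ fun x => ?_)
  by_cases h : φ x = 0
  · simp [h]
  · have h' : (φ x : ℂ) ≠ 0 := by exact_mod_cast h
    simp only [Complex.real_smul]
    push_cast
    field_simp

end AdmissibleWeight

/-! ### The Chebyshev weight and the semicircle law -/

theorem chebyshevWeight_nonneg (x : ℝ) : 0 ≤ chebyshevWeight x :=
  Set.indicator_nonneg (fun _ _ => Real.sqrt_nonneg _) x

theorem measurable_chebyshevWeight : Measurable chebyshevWeight :=
  Measurable.indicator (by fun_prop) measurableSet_Icc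

theorem div_chebyshevWeight (f : ℝ → ℝ) (x : ℝ) : f x / chebyshevWeight x =
    (Set.Icc (-2) 2).indicator (fun x => f x * (Real.sqrt (4 - x ^ 2))⁻¹) x := by
  by_cases hx : x ∈ Set.Icc (-2 : ℝ) 2
  · rw [chebyshevWeight, Set.indicator_of_mem hx, Set.indicator_of_mem hx, div_eq_mul_inv]
  · rw [chebyshevWeight, Set.indicator_of_notMem hx, Set.indicator_of_notMem hx, div_zero]

theorem sqrt_four_sub_sq (y : ℝ) : Real.sqrt (4 - (2 * y) ^ 2) = 2 * Real.sqrt (1 - y ^ 2) := by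
  rw [show 4 - (2 * y) ^ 2 = 2 ^ 2 * (1 - y ^ 2) by ring, Real.sqrt_mul (by norm_num),
    Real.sqrt_sq (by norm_num)]

/-- The arcsine weight `1 / √(4 - x²)` on `[-2,2]` is, up to scaling, the weight of the Chebyshev
polynomials of the first kind. -/
theorem integral_div_chebyshevWeight (f : ℝ → ℝ) :
    ∫ x, f x / chebyshevWeight x = ∫ y, f (2 * y) ∂Chebyshev.measureT := by
  simp_rw [div_chebyshevWeight]
  rw [integral_indicator measurableSet_Icc, integral_Icc_eq_integral_Ioc,
    ← intervalIntegral.integral_of_le (by norm_num), Chebyshev.integral_measureT]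
  have h := intervalIntegral.integral_comp_mul_left (a := -1) (b := 1)
    (fun x => f x * (Real.sqrt (4 - x ^ 2))⁻¹) (c := 2) (by norm_num)
  simp_rw [sqrt_four_sub_sq, mul_inv, smul_eq_mul] at h
  norm_num at h
  have e : ∀ y : ℝ, f (2 * y) * Real.sqrt (1 - y ^ 2)⁻¹ =
      2 * (f (2 * y) * (1 / 2 * (Real.sqrt (1 - y ^ 2))⁻¹)) := by
    intro y; rw [Real.sqrt_inv]; ring
  simp_rw [e]
  rw [intervalIntegral.integral_const_mul, h]
  ring

theorem integrable_div_chebyshevWeight {f : ℝ → ℝ} (hf : Continuous f) :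
    Integrable fun x => f x / chebyshevWeight x := by
  have h := Chebyshev.intervalIntegrable_sqrt_one_sub_sq_inv.comp_mul_left (c := 1 / 2)
  norm_num at h
  have h2 := (h.continuousOn_mul hf.continuousOn).const_mul (1 / 2)
  rw [intervalIntegrable_iff_integrableOn_Icc_of_le (by norm_num),
    ← integrable_indicator_iff measurableSet_Icc] at h2
  refine h2.congr (ae_of_all _ fun x => ?_)
  beta_reduce
  rw [div_chebyshevWeight]
  refine congrFun (congrArg _ (funext fun x => ?_)) x
  have : Real.sqrt (4 - x ^ 2) = 2 * Real.sqrt (1 - (1 / 2 * x) ^ 2) := by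
    rw [← sqrt_four_sub_sq]; congr 3; ring
  rw [this, mul_inv]
  ring

theorem chebyshevWeight_mul_div_sq (f : ℝ → ℝ) (x : ℝ) :
    chebyshevWeight x • (f x / chebyshevWeight x ^ 2) = f x / chebyshevWeight x := by
  by_cases h : chebyshevWeight x = 0
  · simp [h]
  · rw [smul_eq_mul]; field_simp

theorem admissibleWeight_chebyshevWeight : AdmissibleWeight chebyshevWeight where
  measurable := measurable_chebyshevWeight
  nonneg := chebyshevWeight_nonneg
  memLp_exp a := by
    have hm : Measurable fun x => Real.exp (a * |x|) / chebyshevWeight x :=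
      Measurable.div (by fun_prop) measurable_chebyshevWeight
    rw [memLp_two_iff_integrable_sq hm.aestronglyMeasurable, weightMeasure,
      integrable_withDensity_iff_integrable_smul' measurable_chebyshevWeight.ennreal_ofReal
      (by simp)]
    refine (integrable_div_chebyshevWeight (f := fun x => Real.exp (a * |x|) ^ 2)
      (by fun_prop)).congr (ae_of_all _ fun x => ?_)
    beta_reduce
    rw [ENNReal.toReal_ofReal (chebyshevWeight_nonneg x), div_pow]
    exact (chebyshevWeight_mul_div_sq (fun x => Real.exp (a * |x|) ^ 2) x).symm

/-- The density of the semicircle law. -/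
noncomputable def semicircleDensity (x : ℝ) : ℝ := chebyshevWeight x / (2 * Real.pi)

theorem measurable_semicircleDensity : Measurable semicircleDensity :=
  measurable_chebyshevWeight.div_const _

theorem semicircleDensity_nonneg (x : ℝ) : 0 ≤ semicircleDensity x :=
  div_nonneg (chebyshevWeight_nonneg x) (by positivity)

theorem semicircle_eq :
    semicircle = volume.withDensity fun x => ENNReal.ofReal (semicircleDensity x) := by
  rw [semicircle, ← withDensity_indicator measurableSet_Icc]
  congr 1
  funext x
  by_cases hx : x ∈ Set.Icc (-2 : ℝ) 2
  · rw [Set.indicator_of_mem hx, semicircleDensity, chebyshevWeight, Set.indicator_of_mem hx]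
  · rw [Set.indicator_of_notMem hx, semicircleDensity, chebyshevWeight,
      Set.indicator_of_notMem hx, zero_div, ENNReal.ofReal_zero]

theorem chebyshevWeight_sq_div (f : ℝ → ℝ) (x : ℝ) : f x * semicircleDensity x =
    (f x * (4 - x ^ 2) / (2 * Real.pi)) / chebyshevWeight x := by
  rw [semicircleDensity]
  by_cases hx : x ∈ Set.Icc (-2 : ℝ) 2
  · rw [chebyshevWeight, Set.indicator_of_mem hx]
    have h0 : 0 ≤ 4 - x ^ 2 := by nlinarith [hx.1, hx.2]
    by_cases hs : Real.sqrt (4 - x ^ 2) = 0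
    · simp [hs]
    · rw [eq_div_iff hs]
      nth_rewrite 3 [← Real.sq_sqrt h0]
      ring
  · rw [chebyshevWeight, Set.indicator_of_notMem hx]; simp

theorem integral_semicircle (f : ℝ → ℝ) : ∫ x, f x ∂semicircle =
    (∫ y, f (2 * y) * (1 - y ^ 2) ∂Chebyshev.measureT) * (2 / Real.pi) := by
  rw [semicircle_eq, AdmissibleWeight.integral_withDensity_ofReal measurable_semicircleDensity
    semicircleDensity_nonneg]
  simp_rw [chebyshevWeight_sq_div]
  rw [integral_div_chebyshevWeight, ← integral_mul_const]
  refine integral_congr_ae (ae_of_all _ fun y => ?_)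
  have := Real.pi_ne_zero
  field_simp
  ring

theorem integrable_semicircle {f : ℝ → ℝ} (hf : Continuous f) : Integrable f semicircle := by
  rw [semicircle_eq, integrable_withDensity_iff_integrable_smul'
    measurable_semicircleDensity.ennreal_ofReal (by simp)]
  refine (integrable_div_chebyshevWeight (f := fun x => f x * (4 - x ^ 2) / (2 * Real.pi))
    (by fun_prop)).congr (ae_of_all _ fun x => ?_)
  beta_reduce
  rw [ENNReal.toReal_ofReal (semicircleDensity_nonneg x), smul_eq_mul,
    mul_comm (semicircleDensity x)]
  exact (chebyshevWeight_sq_div f x).symm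

theorem integral_S_semicircle (n : ℕ) :
    ∫ x, (Chebyshev.S ℝ n).eval x ∂semicircle = if n = 0 then 1 else 0 := by
  have e : ∀ y : ℝ, (Chebyshev.S ℝ n).eval (2 * y) * (1 - y ^ 2) =
      ((Chebyshev.T ℝ n).eval y - (Chebyshev.T ℝ (n + 2)).eval y) * (1 / 2) := by
    intro y
    have h1 := congrArg (Polynomial.eval y) (Chebyshev.S_comp_two_mul_X ℝ n)
    have h2 := congrArg (Polynomial.eval y) (Chebyshev.one_sub_X_sq_mul_U_eq_pol_in_T ℝ n)
    have h3 := congrArg (Polynomial.eval y) (Chebyshev.T_add_two ℝ n)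
    simp only [eval_comp, eval_mul, eval_sub, eval_pow, eval_X, eval_one, eval_ofNat] at h1 h2 h3
    rw [h1]
    linarith
  have hi : ∀ n : ℤ, Integrable (fun y => (Chebyshev.T ℝ n).eval y) Chebyshev.measureT := fun n =>
    Chebyshev.integrable_measureT (by fun_prop)
  rw [integral_semicircle]
  simp_rw [e]
  rw [integral_mul_const, integral_sub (hi _) (hi _),
    Chebyshev.integral_eval_T_real_measureT_of_ne_zero (n := (n : ℤ) + 2) (by omega)]
  have := Real.pi_ne_zero
  by_cases h : n = 0
  · subst h
    rw [Nat.cast_zero, Chebyshev.integral_eval_T_real_measureT_zero, if_pos rfl]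
    field_simp
    ring
  · rw [Chebyshev.integral_eval_T_real_measureT_of_ne_zero (by omega), if_neg h]
    ring

/-- The free cumulants of the semicircle law. -/
theorem momentSeq_semicircle : momentSeq semicircle = momentsOfCumulants semicircleCumulants := by
  have hL : ∀ n, momentFunctional (momentSeq semicircle)
      (cumulantPoly semicircleCumulants X n) = if n = 0 then 1 else 0 := by
    intro n
    rw [cumulantPoly_semicircle, ← Chebyshev.map_S Complex.ofRealHom,
      momentFunctional_momentSeq (fun k => integrable_semicircle (by fun_prop)),
      integral_S_semicircle]
    split_ifs <;> simp
  funext j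
  rw [← apply_pow_eq_momentsOfCumulants hL, momentFunctional_X_pow]

theorem isBasePoint_semicircle :
    AdmissibleWeight.IsBasePoint chebyshevWeight semicircleDensity := by
  have hL : MemLp (fun x => (semicircleDensity x : ℂ)) 2 (weightMeasure chebyshevWeight) := by
    refine (admissibleWeight_chebyshevWeight.memLp_exp 0).mono
      (Complex.measurable_ofReal.comp measurable_semicircleDensity).aestronglyMeasurable
      (ae_of_all _ fun x => ?_)
    rw [Complex.norm_real]
    rw [Real.norm_of_nonneg (semicircleDensity_nonneg x), zero_mul, Real.exp_zero,
      Real.norm_of_nonneg (div_nonneg zero_le_one (chebyshevWeight_nonneg x)),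
      ← one_mul (semicircleDensity x), chebyshevWeight_sq_div fun _ => 1]
    refine div_le_div_of_nonneg_right ?_ (chebyshevWeight_nonneg x)
    rw [div_le_one (by positivity)]
    nlinarith [Real.pi_gt_three, sq_nonneg x]
  have hz : ∀ x, semicircleDensity x = 0 ↔ chebyshevWeight x = 0 := fun x => by
    rw [semicircleDensity, div_eq_zero_iff, or_iff_left (by positivity)]
  refine ⟨measurable_semicircleDensity, semicircleDensity_nonneg, hz, hL, ?_⟩
  rw [← semicircle_eq]
  have h0 := integral_S_semicircle 0
  have h1 := integral_S_semicircle 1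
  have h2 := integral_S_semicircle 2
  simp only [Nat.cast_zero, Nat.cast_one, Nat.cast_ofNat, Chebyshev.S_zero, Chebyshev.S_one,
    Chebyshev.S_two, eval_one, eval_X, eval_sub, eval_pow] at h0 h1 h2
  have hp : IsProbabilityMeasure semicircle := by
    have : semicircle.real Set.univ = 1 := by simpa using h0
    exact ⟨by rwa [measureReal_def, ENNReal.toReal_eq_one_iff] at this⟩
  refine ⟨hp, ?_, by simpa using h1, ?_⟩
  · rw [semicircle_eq]
    exact (admissibleWeight_chebyshevWeight.inL2_withDensity measurable_semicircleDensity
      semicircleDensity_nonneg (fun x => (hz x).2) hL).1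
  · rw [integral_sub (integrable_semicircle (by fun_prop)) (integrable_const _)] at h2
    simpa [sub_eq_zero] using h2

/-! ### The differential in the free case -/

/-- The vector `C_n / φ` of the Chebyshev weight `φ`, for the Chebyshev polynomial `C_n` of the
first kind. -/
noncomputable def chebyshevVec (n : ℕ) : L2 chebyshevWeight :=
  admissibleWeight_chebyshevWeight.polyVec (Chebyshev.C ℂ n)

theorem inner_chebyshevVec (n : ℕ) (f : L2 chebyshevWeight) :
    inner ℂ (chebyshevVec n) f =
      momentFunctional (l2Moment chebyshevWeight f) (Chebyshev.C ℂ n) := by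
  rw [chebyshevVec, ← Chebyshev.map_C Complex.ofRealHom,
    AdmissibleWeight.inner_polyVec]

theorem inner_chebyshevVec_chebyshevVec (m n : ℕ) : inner ℂ (chebyshevVec m) (chebyshevVec n) =
    ((4 * ∫ y, (Chebyshev.T ℝ m).eval y * (Chebyshev.T ℝ n).eval y ∂Chebyshev.measureT : ℝ) :
      ℂ) := by
  rw [chebyshevVec, chebyshevVec, ← Chebyshev.map_C Complex.ofRealHom,
    ← Chebyshev.map_C Complex.ofRealHom, AdmissibleWeight.inner_polyVec_polyVec,
    integral_div_chebyshevWeight fun x => (Chebyshev.C ℝ m).eval x * (Chebyshev.C ℝ n).eval x,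
    ← integral_const_mul]
  congr 2
  funext y
  have h : ∀ n : ℕ, (Chebyshev.C ℝ n).eval (2 * y) = 2 * (Chebyshev.T ℝ n).eval y := by
    intro n
    have := congrArg (Polynomial.eval y) (Chebyshev.C_comp_two_mul_X ℝ n)
    simpa only [eval_comp, eval_mul, eval_X, eval_ofNat] using this
  rw [h, h]
  ring

theorem chebyshevVec_ne_zero (n : ℕ) : chebyshevVec n ≠ 0 := by
  intro h
  have h1 := inner_chebyshevVec_chebyshevVec n n
  rw [h, inner_zero_left, eq_comm, Complex.ofReal_eq_zero] at h1
  have hpi := Real.pi_pos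
  by_cases hn : n = 0
  · subst hn
    rw [Nat.cast_zero, Chebyshev.integral_eval_T_real_mul_self_measureT_zero] at h1
    linarith
  · rw [Chebyshev.integral_T_real_mul_self_measureT_of_ne_zero hn] at h1
    linarith

theorem orthonormal_chebyshevVec :
    Orthonormal ℂ fun n => ((‖chebyshevVec n‖⁻¹ : ℝ) : ℂ) • chebyshevVec n := by
  constructor
  · intro n
    rw [norm_smul, Complex.norm_real, norm_inv, norm_norm,
      inv_mul_cancel₀ (norm_ne_zero_iff.2 (chebyshevVec_ne_zero n))]
  · intro m n hmn
    simp only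
    rw [inner_smul_left, inner_smul_right, inner_chebyshevVec_chebyshevVec,
      Chebyshev.integral_eval_T_real_mul_eval_T_real_measureT_of_ne hmn]
    simp

theorem eq_zero_of_inner_chebyshevVec {f : L2 chebyshevWeight}
    (h : ∀ n, inner ℂ (chebyshevVec n) f = 0) : f = 0 := by
  simp_rw [inner_chebyshevVec] at h
  have h0 : momentFunctional (l2Moment chebyshevWeight f) 1 = 0 := by
    have := h 0
    rwa [Nat.cast_zero, Chebyshev.C_zero, ← one_add_one_eq_two, map_add, add_self_eq_zero] at this
  have hL := functional_eq_zero_of_C h0 fun n => h (n + 1)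
  refine admissibleWeight_chebyshevWeight.eq_zero_of_l2Moment_eq_zero fun k => ?_
  rw [← momentFunctional_X_pow (l2Moment chebyshevWeight f), hL, LinearMap.zero_apply]

/-- The Hilbert basis of normalized vectors `C_n / φ`. -/
noncomputable def chebyshevBasis : HilbertBasis ℕ ℂ (L2 chebyshevWeight) :=
  HilbertBasis.mkOfOrthogonalEqBot orthonormal_chebyshevVec (by
    rw [Submodule.eq_bot_iff]
    intro f hf
    refine eq_zero_of_inner_chebyshevVec fun n => ?_
    have := (Submodule.mem_orthogonal _ _).1 hf _ (Submodule.subset_span ⟨n, rfl⟩)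
    rw [inner_smul_left, mul_eq_zero] at this
    refine this.resolve_left ?_
    rw [Complex.conj_ofReal, Complex.ofReal_eq_zero]
    exact inv_ne_zero (norm_ne_zero_iff.2 (chebyshevVec_ne_zero n)))

theorem chebyshevBasis_apply (n : ℕ) :
    chebyshevBasis n = ((‖chebyshevVec n‖⁻¹ : ℝ) : ℂ) • chebyshevVec n := by
  rw [chebyshevBasis, HilbertBasis.coe_mkOfOrthogonalEqBot]

theorem inner_chebyshevBasis (n : ℕ) (f : L2 chebyshevWeight) :
    inner ℂ (chebyshevBasis n) f = ((‖chebyshevVec n‖⁻¹ : ℝ) : ℂ) *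
      momentFunctional (l2Moment chebyshevWeight f) (Chebyshev.C ℂ n) := by
  rw [chebyshevBasis_apply, inner_smul_left, Complex.conj_ofReal, inner_chebyshevVec]

theorem inv_norm_chebyshevVec_ne_zero (n : ℕ) : ((‖chebyshevVec n‖⁻¹ : ℝ) : ℂ) ≠ 0 := by
  rw [Complex.ofReal_ne_zero]
  exact inv_ne_zero (norm_ne_zero_iff.2 (chebyshevVec_ne_zero n))

theorem forall_l2Moment_eq_zero_iff (f : L2 chebyshevWeight) :
    (∀ k < 3, l2Moment chebyshevWeight f k = 0) ↔
      ∀ k < 3, inner ℂ (chebyshevBasis k) f = 0 := by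
  have e : ∀ k, inner ℂ (chebyshevBasis k) f = 0 ↔
      momentFunctional (l2Moment chebyshevWeight f) (Chebyshev.C ℂ k) = 0 := fun k => by
    rw [inner_chebyshevBasis, mul_eq_zero, or_iff_right (inv_norm_chebyshevVec_ne_zero k)]
  set L := momentFunctional (l2Moment chebyshevWeight f) with hL
  have h2 : (2 : ℂ[X]) = (2 : ℂ) • X ^ 0 := by
    rw [pow_zero, smul_eq_C_mul, mul_one]; rfl
  have e0 : L (Chebyshev.C ℂ (0 : ℕ)) = 2 * l2Moment chebyshevWeight f 0 := by
    rw [Nat.cast_zero, Chebyshev.C_zero, h2, map_smul, hL, momentFunctional_X_pow, smul_eq_mul]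
  have e1 : L (Chebyshev.C ℂ (1 : ℕ)) = l2Moment chebyshevWeight f 1 := by
    rw [Nat.cast_one, Chebyshev.C_one, ← pow_one X, hL, momentFunctional_X_pow]
  have e2 : L (Chebyshev.C ℂ (2 : ℕ)) =
      l2Moment chebyshevWeight f 2 - 2 * l2Moment chebyshevWeight f 0 := by
    rw [Nat.cast_ofNat, Chebyshev.C_two, map_sub, h2, map_smul, hL, momentFunctional_X_pow,
      momentFunctional_X_pow, smul_eq_mul]
  simp_rw [e]
  constructor
  · intro h k hk
    interval_cases k
    · rw [e0, h 0 (by norm_num), mul_zero]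
    · rw [e1, h 1 (by norm_num)]
    · rw [e2, h 2 (by norm_num), h 0 (by norm_num), mul_zero, sub_zero]
  · intro h k hk
    have a0 := h 0 (by norm_num)
    have a1 := h 1 (by norm_num)
    have a2 := h 2 (by norm_num)
    rw [e0, mul_eq_zero, or_iff_right two_ne_zero] at a0
    rw [e1] at a1
    rw [e2, a0, mul_zero, sub_zero] at a2
    interval_cases k <;> assumption

theorem norm_two_div_sqrt_two_pow (k : ℕ) :
    ‖(2 / (Real.sqrt 2 : ℂ) ^ k : ℂ)‖ = 2 * ((Real.sqrt 2)⁻¹) ^ k := by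
  rw [norm_div, norm_pow, Complex.norm_real, Real.norm_of_nonneg (Real.sqrt_nonneg _), inv_pow,
    div_eq_mul_inv]
  norm_num

theorem inv_sqrt_two_lt_one : (Real.sqrt 2)⁻¹ < 1 :=
  inv_lt_one_of_one_lt₀ (by rw [Real.lt_sqrt] <;> norm_num)

theorem norm_two_div_sqrt_two_pow_le {k : ℕ} (hk : 3 ≤ k) :
    ‖(2 / (Real.sqrt 2 : ℂ) ^ k : ℂ)‖ ≤ (Real.sqrt 2)⁻¹ := by
  rw [norm_two_div_sqrt_two_pow]
  have h0 : (0 : ℝ) ≤ (Real.sqrt 2)⁻¹ := by positivity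
  have h2 : ((Real.sqrt 2)⁻¹) ^ 2 = (2 : ℝ)⁻¹ := by
    rw [inv_pow, Real.sq_sqrt (by norm_num)]
  calc 2 * ((Real.sqrt 2)⁻¹) ^ k ≤ 2 * ((Real.sqrt 2)⁻¹) ^ 3 := by
        gcongr 2 * ?_
        exact pow_le_pow_of_le_one h0 inv_sqrt_two_lt_one.le hk
    _ = (Real.sqrt 2)⁻¹ := by rw [pow_succ, h2]; ring

/-- In the free case the differential exists, and it is the restriction of an operator that is
diagonal in the Hilbert basis of Chebyshev vectors. -/
theorem exists_freeDifferential :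
    ∃ D : tangentSpace chebyshevWeight semicircle →L[ℂ] tangentSpace chebyshevWeight semicircle,
      (∀ D', IsMomentDifferential chebyshevWeight freeT semicircle D' ↔ D' = D) ∧
        spectrum ℂ D ⊆ Metric.ball 0 1 := by
  have hφ := admissibleWeight_chebyshevWeight
  have hmem : ∀ v, v ∈ tangentSpace chebyshevWeight semicircle ↔
      ∀ k < 3, l2Moment chebyshevWeight v k = 0 := by
    rw [semicircle_eq]
    exact isBasePoint_semicircle.mem_tangentSpace_iff hφ
  have hcl : IsClosed (tangentSpace chebyshevWeight semicircle : Set (L2 chebyshevWeight)) :=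
    Submodule.isClosed_topologicalClosure _
  have : CompleteSpace (tangentSpace chebyshevWeight semicircle) := hcl.completeSpace_coe
  obtain ⟨A, hA⟩ := exists_diagonal chebyshevBasis (l := fun k => 2 / (Real.sqrt 2 : ℂ) ^ k) (by
    simp_rw [norm_two_div_sqrt_two_pow]
    exact (summable_geometric_of_lt_one (by positivity) inv_sqrt_two_lt_one).mul_left 2)
  obtain ⟨D, hD, hspec⟩ := exists_restriction_of_diagonal hA (n := 3) (by positivity)
    inv_sqrt_two_lt_one (fun k hk => norm_two_div_sqrt_two_pow_le hk)
    (tangentSpace chebyshevWeight semicircle)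
    (fun v => (hmem v).trans (forall_l2Moment_eq_zero_iff v))
  have hdiff : IsMomentDifferential chebyshevWeight freeT semicircle D := by
    intro v
    rw [tendsto_pi_nhds]
    intro j
    have hp : IsProbabilityMeasure semicircle := by
      rw [semicircle_eq]; exact isBasePoint_semicircle.mem_distributions.1
    have hder := hasDerivAt_freeT
      (m := fun ε : ℝ => momentSeq semicircle + ε • l2Moment chebyshevWeight (v : L2 _))
      (m' := l2Moment chebyshevWeight (v : L2 _))
      (m'' := l2Moment chebyshevWeight (D v : L2 _)) ?_ ?_ ?_ ?_ ?_ j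
    · rw [hasDerivAt_iff_tendsto_slope_zero] at hder
      refine hder.congr fun ε => ?_
      simp
    · intro ε
      simp [AdmissibleWeight.momentSeq_zero, (hmem v).1 v.2 0 (by norm_num)]
    · simp [momentSeq_semicircle]
    · intro j
      have := ((hasDerivAt_id (0 : ℝ)).smul_const
        (l2Moment chebyshevWeight (v : L2 chebyshevWeight) j)).const_add (momentSeq semicircle j)
      simpa using! this
    · exact (hmem _).1 (D v).2 0 (by norm_num)
    · intro n
      have h1 := inner_apply_of_diagonal hA (n + 1) (v : L2 chebyshevWeight)
      rw [← hD, inner_chebyshevBasis, inner_chebyshevBasis, mul_left_comm] at h1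
      exact mul_left_cancel₀ (inv_norm_chebyshevVec_ne_zero _) h1
  refine ⟨D, fun D' => ⟨fun h => ?_, fun h => h ▸ hdiff⟩, hspec⟩
  ext1 v
  exact Subtype.ext (hφ.ext_l2Moment (tendsto_nhds_unique (h v) (hdiff v)))

end CentralLimit

namespace CentralLimit

/-! ### Symmetric triangular operators -/

section Triangular

open InnerProductSpace Submodule

variable {H : Type*} [NormedAddCommGroup H] [InnerProductSpace ℂ H]

/-- An operator that is symmetric on the span of a sequence and triangular with respect to it is
diagonal with respect to its Gram-Schmidt orthogonalization. -/
theorem apply_gramSchmidt_of_symmetric {e : ℕ → H} {A : H →L[ℂ] H} {l : ℕ → ℝ}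
    (hsymm : ∀ i j, inner ℂ (e i) (A (e j)) = inner ℂ (A (e i)) (e j))
    (htri : ∀ k, A (e k) - (l k : ℂ) • e k ∈ span ℂ (e '' Set.Iio k)) (k : ℕ) :
    A (gramSchmidt ℂ e k) = (l k : ℂ) • gramSchmidt ℂ e k := by
  have hmaps : ∀ x ∈ span ℂ (e '' Set.Iio k), A x ∈ span ℂ (e '' Set.Iio k) := by
    intro x hx
    induction hx using span_induction with
    | mem x hx =>
      obtain ⟨i, hi, rfl⟩ := hx
      rw [← sub_add_cancel (A (e i)) ((l i : ℂ) • e i)]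
      refine add_mem (span_mono (Set.image_mono (Set.Iio_subset_Iio (le_of_lt hi))) (htri i)) ?_
      exact smul_mem _ _ (subset_span ⟨i, hi, rfl⟩)
    | zero => rw [map_zero]; exact zero_mem _
    | add x y _ _ hx hy => rw [map_add]; exact add_mem hx hy
    | smul a x _ hx => rw [map_smul]; exact smul_mem _ _ hx
  have hs1 : ∀ i, ∀ y ∈ span ℂ (Set.range e), inner ℂ (e i) (A y) = inner ℂ (A (e i)) y := by
    intro i y hy
    induction hy using span_induction with
    | mem y hy => obtain ⟨j, rfl⟩ := hy; exact hsymm i j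
    | zero => simp
    | add x y _ _ hx hy => rw [map_add, inner_add_right, inner_add_right, hx, hy]
    | smul a x _ hx => rw [map_smul, inner_smul_right, inner_smul_right, hx]
  have hs2 : ∀ x ∈ span ℂ (Set.range e), ∀ y ∈ span ℂ (Set.range e),
      inner ℂ x (A y) = inner ℂ (A x) y := by
    intro x hx y hy
    induction hx using span_induction with
    | mem x hx => obtain ⟨i, rfl⟩ := hx; exact hs1 i y hy
    | zero => simp
    | add x z _ _ hx hz => rw [map_add, inner_add_left, inner_add_left, hx, hz]
    | smul a x _ hx => rw [map_smul, inner_smul_left, inner_smul_left, hx]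
  set g := gramSchmidt ℂ e k with hg
  have hge : e k - g ∈ span ℂ (e '' Set.Iio k) := by
    rw [hg, gramSchmidt_def, sub_sub_cancel, ← span_gramSchmidt_Iio ℂ e k]
    refine sum_mem fun i hi => ?_
    have hle : span ℂ {gramSchmidt ℂ e i} ≤ span ℂ (gramSchmidt ℂ e '' Set.Iio k) :=
      span_mono (Set.singleton_subset_iff.2 ⟨i, Finset.mem_Iio.1 hi, rfl⟩)
    exact hle (Submodule.coe_mem _)
  have hFle : span ℂ (e '' Set.Iio k) ≤ span ℂ (Set.range e) :=
    span_mono (Set.image_subset_range _ _)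
  have hgmem : g ∈ span ℂ (Set.range e) := by
    rw [← sub_sub_cancel (e k) g]
    exact sub_mem (subset_span ⟨k, rfl⟩) (hFle hge)
  have horth : ∀ x ∈ span ℂ (e '' Set.Iio k), inner ℂ x g = 0 := by
    intro x hx
    rw [← span_gramSchmidt_Iio ℂ e k] at hx
    induction hx using span_induction with
    | mem x hx =>
      obtain ⟨i, hi, rfl⟩ := hx
      exact gramSchmidt_orthogonal ℂ e (ne_of_lt hi)
    | zero => simp
    | add x y _ _ hx hy => rw [inner_add_left, hx, hy, add_zero]
    | smul a x _ hx => rw [inner_smul_left, hx, mul_zero]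
  set d := A g - (l k : ℂ) • g with hd
  have hdmem : d ∈ span ℂ (e '' Set.Iio k) := by
    have : d = (A (e k) - (l k : ℂ) • e k) - (A (e k - g) - (l k : ℂ) • (e k - g)) := by
      rw [hd, map_sub, smul_sub]; abel
    rw [this]
    exact sub_mem (htri k) (sub_mem (hmaps _ hge) (smul_mem _ _ hge))
  have hdd : inner ℂ d d = 0 := by
    conv_lhs => rw [hd]
    rw [inner_sub_right, inner_smul_right, horth d hdmem, mul_zero, sub_zero,
      hs2 d (hFle hdmem) g hgmem, horth _ (hmaps d hdmem)]
  rw [← sub_eq_zero, ← hd]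
  exact inner_self_eq_zero.1 hdd

/-- The diagonalization of a symmetric triangular operator by a Hilbert basis. -/
theorem exists_hilbertBasis_of_symmetric [CompleteSpace H] {e : ℕ → H}
    (hind : LinearIndependent ℂ e) (htot : ∀ f, (∀ k, inner ℂ (e k) f = 0) → f = 0)
    {A : H →L[ℂ] H} {l : ℕ → ℝ}
    (hsymm : ∀ i j, inner ℂ (e i) (A (e j)) = inner ℂ (A (e i)) (e j))
    (htri : ∀ k, A (e k) - (l k : ℂ) • e k ∈ span ℂ (e '' Set.Iio k)) :
    ∃ b : HilbertBasis ℕ ℂ H, (∀ k, A (b k) = (l k : ℂ) • b k) ∧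
      ∀ n f, (∀ k < n, inner ℂ (e k) f = 0) ↔ ∀ k < n, inner ℂ (b k) f = 0 := by
  have hperp : ∀ (s : Set ℕ) (u : ℕ → H) (f : H), (∀ k ∈ s, inner ℂ (u k) f = 0) ↔
      f ∈ (span ℂ (u '' s))ᗮ := by
    intro s u f
    rw [mem_orthogonal]
    refine ⟨fun h x hx => ?_, fun h k hk => h _ (subset_span ⟨k, hk, rfl⟩)⟩
    induction hx using span_induction with
    | mem x hx => obtain ⟨i, hi, rfl⟩ := hx; exact h i hi
    | zero => simp
    | add x y _ _ hx hy => rw [inner_add_left, hx, hy, add_zero]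
    | smul a x _ hx => rw [inner_smul_left, hx, mul_zero]
  have hbot : (span ℂ (Set.range (gramSchmidtNormed ℂ e)))ᗮ = ⊥ := by
    rw [span_gramSchmidtNormed_range, span_gramSchmidt, Submodule.eq_bot_iff]
    intro f hf
    refine htot f fun k => ?_
    rw [← Set.image_univ, ← hperp] at hf
    exact hf k trivial
  have hb : ⇑(HilbertBasis.mkOfOrthogonalEqBot (gramSchmidtNormed_orthonormal hind) hbot) =
      gramSchmidtNormed ℂ e := HilbertBasis.coe_mkOfOrthogonalEqBot _ _
  refine ⟨HilbertBasis.mkOfOrthogonalEqBot (gramSchmidtNormed_orthonormal hind) hbot, fun k => ?_,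
    fun n f => ?_⟩
  · rw [hb, gramSchmidtNormed, map_smul, apply_gramSchmidt_of_symmetric hsymm htri, smul_comm]
  · rw [hb]
    have h1 := hperp (Set.Iio n) e f
    have h2 := hperp (Set.Iio n) (gramSchmidtNormed ℂ e) f
    rw [span_gramSchmidtNormed, span_gramSchmidt_Iio, ← h1] at h2
    exact h2.symm

end Triangular

/-! ### The Hermite weight -/

open scoped ENNReal

theorem hermiteWeight_pos (x : ℝ) : 0 < hermiteWeight x := Real.exp_pos _

theorem measurable_hermiteWeight : Measurable hermiteWeight := by
  unfold hermiteWeight; fun_prop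

theorem admissibleWeight_hermiteWeight : AdmissibleWeight hermiteWeight where
  measurable := measurable_hermiteWeight
  nonneg x := (hermiteWeight_pos x).le
  memLp_exp a := by
    have hm : Measurable fun x => Real.exp (a * |x|) / hermiteWeight x :=
      Measurable.div (by fun_prop) measurable_hermiteWeight
    rw [memLp_two_iff_integrable_sq hm.aestronglyMeasurable, weightMeasure,
      integrable_withDensity_iff_integrable_smul' measurable_hermiteWeight.ennreal_ofReal
      (by simp)]
    have hg : Integrable fun x : ℝ => Real.exp (4 * a ^ 2) * Real.exp (-(1 / 4) * x ^ 2) :=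
      (integrable_exp_neg_mul_sq (by norm_num)).const_mul _
    refine hg.mono ((measurable_hermiteWeight.ennreal_ofReal.ennreal_toReal.smul
      (hm.pow_const 2)).aestronglyMeasurable) (ae_of_all _ fun x => ?_)
    have e : (ENNReal.ofReal (hermiteWeight x)).toReal •
        (Real.exp (a * |x|) / hermiteWeight x) ^ 2 = Real.exp (2 * (a * |x|) - x ^ 2 / 2) := by
      rw [ENNReal.toReal_ofReal (hermiteWeight_pos x).le, smul_eq_mul, Real.exp_sub, two_mul,
        Real.exp_add, ← hermiteWeight]
      have := (hermiteWeight_pos x).ne'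
      field_simp
    rw [e, ← Real.exp_add, Real.norm_of_nonneg (Real.exp_pos _).le,
      Real.norm_of_nonneg (Real.exp_pos _).le, Real.exp_le_exp]
    -- `2a|x| - x²/2 ≤ 4a² - x²/4` is `(4a - |x|)² ≥ 0`.
    nlinarith [sq_nonneg (4 * a - |x|), sq_abs x]

theorem gaussianPDFReal_eq_div (x : ℝ) :
    gaussianPDFReal 0 1 x = (Real.sqrt (2 * Real.pi))⁻¹ / hermiteWeight x := by
  rw [gaussianPDFReal, hermiteWeight, div_eq_mul_inv _ (Real.exp _), ← Real.exp_neg]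
  simp [neg_div]

theorem gaussianReal_eq : gaussianReal 0 1 =
    volume.withDensity fun x => ENNReal.ofReal (gaussianPDFReal 0 1 x) :=
  gaussianReal_of_var_ne_zero 0 one_ne_zero

theorem isBasePoint_gaussian :
    AdmissibleWeight.IsBasePoint hermiteWeight (gaussianPDFReal 0 1) := by
  have hφ := admissibleWeight_hermiteWeight
  have hL : MemLp (fun x => (gaussianPDFReal 0 1 x : ℂ)) 2 (weightMeasure hermiteWeight) := by
    refine ((hφ.memLp_pow 0).const_mul ((Real.sqrt (2 * Real.pi))⁻¹ : ℂ)).congr_norm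
      (measurable_gaussianPDFReal 0 1).complex_ofReal.aestronglyMeasurable (ae_of_all _ fun x => ?_)
    rw [gaussianPDFReal_eq_div]
    push_cast
    rw [pow_zero, mul_one_div]
  refine ⟨measurable_gaussianPDFReal 0 1, gaussianPDFReal_nonneg 0 1, fun x => ?_, hL, ?_⟩
  · exact ⟨fun h => absurd h (gaussianPDFReal_pos 0 1 x one_ne_zero).ne',
      fun h => absurd h (hermiteWeight_pos x).ne'⟩
  · have hI := (hφ.inL2_withDensity (measurable_gaussianPDFReal 0 1) (gaussianPDFReal_nonneg 0 1)
      (fun x hx => absurd hx (hermiteWeight_pos x).ne') hL).1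
    rw [← gaussianReal_eq] at hI ⊢
    refine ⟨inferInstance, hI, integral_id_gaussianReal, ?_⟩
    have := variance_fun_id_gaussianReal (μ := 0) (v := 1)
    rw [variance_eq_integral measurable_id'.aemeasurable] at this
    simpa [integral_id_gaussianReal] using this

theorem classicalT_gaussianReal : classicalT (gaussianReal 0 1) = gaussianReal 0 1 := by
  rw [classicalT, gaussianReal_conv_gaussianReal, gaussianReal_map_div_const]
  congr 1
  · simp
  · ext
    push_cast
    rw [Real.sq_sqrt (by norm_num)]
    norm_num

/-! ### The rotation by which independent copies are added -/

/-- The involution `(x, y) ↦ ((x + y) / √2, (x - y) / √2)` of the plane. -/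
noncomputable def rotation (z : ℝ × ℝ) : ℝ × ℝ :=
  ((z.1 + z.2) / Real.sqrt 2, (z.1 - z.2) / Real.sqrt 2)

theorem measurable_rotation : Measurable rotation := by
  unfold rotation; fun_prop

theorem sqrt_two_mul_self : Real.sqrt 2 * Real.sqrt 2 = 2 := Real.mul_self_sqrt (by norm_num)

theorem rotation_rotation (z : ℝ × ℝ) : rotation (rotation z) = z := by
  have h := sqrt_two_mul_self
  have h0 : Real.sqrt 2 ≠ 0 := by positivity
  ext
  · simp only [rotation]
    rw [← add_div, div_div, h]; ring
  · simp only [rotation]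
    rw [← sub_div, div_div, h]; ring

theorem measurePreserving_rotation : MeasurePreserving rotation := by
  refine ⟨measurable_rotation, ?_⟩
  set s : ℝ := (Real.sqrt 2)⁻¹ with hs
  let L := Matrix.toLin (Module.Basis.finTwoProd ℝ) (Module.Basis.finTwoProd ℝ) !![s, s; s, -s]
  have hL : ⇑L = rotation := by
    funext z
    rw [Matrix.toLin_finTwoProd_apply, rotation]
    ext <;> simp only [hs] <;> ring
  have hdet : LinearMap.det L = -1 := by
    rw [LinearMap.det_toLin, Matrix.det_fin_two_of]
    have : s * s = 1 / 2 := by rw [hs, ← mul_inv, sqrt_two_mul_self]; norm_num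
    linarith
  rw [← hL, Measure.map_linearMap_addHaar_eq_smul_addHaar _ (by rw [hdet]; norm_num), hdet]
  simp

theorem measurableEmbedding_rotation : MeasurableEmbedding rotation :=
  (MeasurableEquiv.mk ⟨rotation, rotation, rotation_rotation, rotation_rotation⟩
    measurable_rotation measurable_rotation).measurableEmbedding

theorem hermiteWeight_rotation (z : ℝ × ℝ) :
    hermiteWeight (rotation z).1 * hermiteWeight (rotation z).2 =
      hermiteWeight z.1 * hermiteWeight z.2 := by
  simp only [hermiteWeight, rotation, ← Real.exp_add, div_pow, Real.sq_sqrt (zero_le_two (α := ℝ))]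
  congr 1; ring

theorem gaussianPDFReal_rotation (z : ℝ × ℝ) :
    gaussianPDFReal 0 1 (rotation z).1 * gaussianPDFReal 0 1 (rotation z).2 =
      gaussianPDFReal 0 1 z.1 * gaussianPDFReal 0 1 z.2 := by
  simp only [gaussianPDFReal, rotation]
  rw [mul_mul_mul_comm, ← Real.exp_add, mul_mul_mul_comm, ← Real.exp_add]
  congr 2
  simp only [sub_zero, div_pow, Real.sq_sqrt (zero_le_two (α := ℝ)), NNReal.coe_one, mul_one]
  ring

/-! ### The bilinear form of the classical central limit operator -/

/-- The density of `(X + Y) / √2` for independent `X` and `Y` with densities `f` and `g`. -/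
noncomputable def rotConv (f g : ℝ → ℂ) (u : ℝ) : ℂ :=
  ∫ v, f ((u + v) / Real.sqrt 2) * g ((u - v) / Real.sqrt 2)

theorem measurable_rotConv {f g : ℝ → ℂ} (hf : Measurable f) (hg : Measurable g) :
    Measurable (rotConv f g) := by
  have h : StronglyMeasurable fun z : ℝ × ℝ => f (rotation z).1 * g (rotation z).2 :=
    ((hf.comp measurable_rotation.fst).mul (hg.comp measurable_rotation.snd)).stronglyMeasurable
  exact (h.integral_prod_right' (ν := volume)).measurable

theorem lintegral_inv_hermiteWeight :
    ∫⁻ v : ℝ, ENNReal.ofReal (Real.exp (-(1 / 2) * v ^ 2)) =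
      ENNReal.ofReal (Real.sqrt (2 * Real.pi)) := by
  rw [← ofReal_integral_eq_lintegral_ofReal (integrable_exp_neg_mul_sq (by norm_num))
    (ae_of_all _ fun x => (Real.exp_pos _).le), integral_gaussian]
  congr 2
  ring

/-- The Cauchy-Schwarz inequality for the product of `a(v) e^{v²/4}` and `e^{-v²/4}`. -/
theorem sq_lintegral_le {a : ℝ → ℝ≥0∞} (ha : Measurable a) :
    (∫⁻ v, a v) ^ 2 ≤
      (∫⁻ v, a v ^ 2 * ENNReal.ofReal (hermiteWeight v)) *
        ENNReal.ofReal (Real.sqrt (2 * Real.pi)) := by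
  have hE : Measurable fun v : ℝ => ENNReal.ofReal (Real.exp (v ^ 2 / 4)) := by fun_prop
  have hE' : Measurable fun v : ℝ => ENNReal.ofReal (Real.exp (-(v ^ 2 / 4))) := by fun_prop
  have h := ENNReal.lintegral_mul_le_Lp_mul_Lq volume Real.HolderConjugate.two_two
    (ha.mul hE).aemeasurable hE'.aemeasurable
  have e1 : ∀ v : ℝ, ((fun v => a v * ENNReal.ofReal (Real.exp (v ^ 2 / 4))) *
      fun v => ENNReal.ofReal (Real.exp (-(v ^ 2 / 4)))) v = a v := by
    intro v
    simp only [Pi.mul_apply]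
    rw [mul_assoc, ← ENNReal.ofReal_mul (Real.exp_pos _).le, ← Real.exp_add, add_neg_cancel,
      Real.exp_zero, ENNReal.ofReal_one, mul_one]
  have e2 : ∀ v : ℝ, (a v * ENNReal.ofReal (Real.exp (v ^ 2 / 4))) ^ (2 : ℝ) =
      a v ^ 2 * ENNReal.ofReal (hermiteWeight v) := by
    intro v
    rw [ENNReal.rpow_two, mul_pow, ← ENNReal.ofReal_pow (Real.exp_pos _).le, ← Real.exp_nat_mul,
      hermiteWeight]
    congr 3; push_cast; ring
  have e3 : ∀ v : ℝ, ENNReal.ofReal (Real.exp (-(v ^ 2 / 4))) ^ (2 : ℝ) =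
      ENNReal.ofReal (Real.exp (-(1 / 2) * v ^ 2)) := by
    intro v
    rw [ENNReal.rpow_two, ← ENNReal.ofReal_pow (Real.exp_pos _).le, ← Real.exp_nat_mul]
    congr 2; push_cast; ring
  change (∫⁻ v, ((fun v => a v * ENNReal.ofReal (Real.exp (v ^ 2 / 4))) *
      fun v => ENNReal.ofReal (Real.exp (-(v ^ 2 / 4)))) v) ≤ _ at h
  simp_rw [e1, Pi.mul_apply, e2, e3, lintegral_inv_hermiteWeight] at h
  calc (∫⁻ v, a v) ^ 2 ≤ _ := pow_le_pow_left' h 2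
    _ = _ := by
      rw [mul_pow, ← ENNReal.rpow_two, ← ENNReal.rpow_two, ← ENNReal.rpow_mul, ← ENNReal.rpow_mul]
      norm_num

/-- The bound of the bilinear form. The Cauchy-Schwarz inequality in `v` brings in the weight
`φ(u) φ(v)`, which is invariant under the rotation; the rotation then separates the variables. -/
theorem lintegral_rotation_le {F G : ℝ → ℝ≥0∞} (hF : Measurable F) (hG : Measurable G) :
    ∫⁻ u, (∫⁻ v, F ((u + v) / Real.sqrt 2) * G ((u - v) / Real.sqrt 2)) ^ 2 *
        ENNReal.ofReal (hermiteWeight u) ≤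
      (∫⁻ x, F x ^ 2 * ENNReal.ofReal (hermiteWeight x)) *
        (∫⁻ x, G x ^ 2 * ENNReal.ofReal (hermiteWeight x)) *
          ENNReal.ofReal (Real.sqrt (2 * Real.pi)) := by
  have hW : Measurable fun x => ENNReal.ofReal (hermiteWeight x) :=
    measurable_hermiteWeight.ennreal_ofReal
  have hm : Measurable fun z : ℝ × ℝ => F (rotation z).1 * G (rotation z).2 :=
    (hF.comp measurable_rotation.fst).mul (hG.comp measurable_rotation.snd)
  set J : ℝ × ℝ → ℝ≥0∞ := fun z => (F z.1 ^ 2 * ENNReal.ofReal (hermiteWeight z.1)) *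
    (G z.2 ^ 2 * ENNReal.ofReal (hermiteWeight z.2)) with hJ
  have hJm : Measurable J := by
    refine Measurable.mul ?_ ?_
    · exact ((hF.pow_const 2).mul hW).comp measurable_fst
    · exact ((hG.pow_const 2).mul hW).comp measurable_snd
  have hpt : ∀ z : ℝ × ℝ, (F (rotation z).1 * G (rotation z).2) ^ 2 *
      ENNReal.ofReal (hermiteWeight z.2) * ENNReal.ofReal (hermiteWeight z.1) =
      J (rotation z) := by
    intro z
    have h := congrArg ENNReal.ofReal (hermiteWeight_rotation z)
    rw [ENNReal.ofReal_mul (hermiteWeight_pos _).le,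
      ENNReal.ofReal_mul (hermiteWeight_pos _).le] at h
    rw [mul_assoc, mul_comm (ENNReal.ofReal (hermiteWeight z.2)), ← h, hJ]
    ring
  calc _ ≤ ∫⁻ u, ((∫⁻ v, (F (rotation (u, v)).1 * G (rotation (u, v)).2) ^ 2 *
          ENNReal.ofReal (hermiteWeight v)) * ENNReal.ofReal (Real.sqrt (2 * Real.pi))) *
        ENNReal.ofReal (hermiteWeight u) := by
        refine lintegral_mono fun u => mul_le_mul_left ?_ _
        exact sq_lintegral_le (hm.comp measurable_prodMk_left)
    _ = (∫⁻ u, ∫⁻ v, J (rotation (u, v))) * ENNReal.ofReal (Real.sqrt (2 * Real.pi)) := by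
        rw [← lintegral_mul_const' _ _ ENNReal.ofReal_ne_top]
        refine lintegral_congr fun u => ?_
        rw [mul_right_comm, ← lintegral_mul_const' _ _ ENNReal.ofReal_ne_top]
        congr 1
        exact lintegral_congr fun v => hpt (u, v)
    _ = (∫⁻ z, J (rotation z)) * ENNReal.ofReal (Real.sqrt (2 * Real.pi)) := by
        rw [Measure.volume_eq_prod,
          lintegral_prod (fun z => J (rotation z)) (hJm.comp measurable_rotation).aemeasurable]
    _ = _ := by
        rw [measurePreserving_rotation.lintegral_comp hJm, Measure.volume_eq_prod,
          lintegral_prod_mul (f := fun x => F x ^ 2 * ENNReal.ofReal (hermiteWeight x))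
            (g := fun x => G x ^ 2 * ENNReal.ofReal (hermiteWeight x))
            ((hF.pow_const 2).mul hW).aemeasurable ((hG.pow_const 2).mul hW).aemeasurable]

theorem eLpNorm_two_sq {f : ℝ → ℂ} (hf : Measurable f) :
    eLpNorm f 2 (weightMeasure hermiteWeight) ^ 2 =
      ∫⁻ x, ‖f x‖ₑ ^ 2 * ENNReal.ofReal (hermiteWeight x) := by
  have h := eLpNorm_nnreal_pow_eq_lintegral (μ := weightMeasure hermiteWeight) (f := f)
    (p := 2) two_ne_zero
  simp only [NNReal.coe_ofNat, ENNReal.rpow_two, ENNReal.coe_ofNat] at h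
  rw [h, weightMeasure, lintegral_withDensity_eq_lintegral_mul _
    measurable_hermiteWeight.ennreal_ofReal (by fun_prop)]
  refine lintegral_congr fun x => ?_
  rw [Pi.mul_apply, mul_comm]

theorem eLpNorm_rotConv_le {f g : ℝ → ℂ} (hf : Measurable f) (hg : Measurable g) :
    eLpNorm (rotConv f g) 2 (weightMeasure hermiteWeight) ^ 2 ≤
      eLpNorm f 2 (weightMeasure hermiteWeight) ^ 2 *
        eLpNorm g 2 (weightMeasure hermiteWeight) ^ 2 *
          ENNReal.ofReal (Real.sqrt (2 * Real.pi)) := by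
  rw [eLpNorm_two_sq hf, eLpNorm_two_sq hg, eLpNorm_two_sq (measurable_rotConv hf hg)]
  refine le_trans (lintegral_mono fun u => ?_) (lintegral_rotation_le hf.enorm hg.enorm)
  gcongr
  refine (enorm_integral_le_lintegral_enorm _).trans (le_of_eq ?_)
  exact lintegral_congr fun v => enorm_mul _ _

theorem memLp_rotConv {f g : ℝ → ℂ} (hf : Measurable f) (hg : Measurable g)
    (hfL : MemLp f 2 (weightMeasure hermiteWeight))
    (hgL : MemLp g 2 (weightMeasure hermiteWeight)) :
    MemLp (rotConv f g) 2 (weightMeasure hermiteWeight) := by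
  refine ⟨(measurable_rotConv hf hg).aestronglyMeasurable, ?_⟩
  have h := eLpNorm_rotConv_le hf hg
  have : eLpNorm (rotConv f g) 2 (weightMeasure hermiteWeight) ^ 2 < ⊤ :=
    h.trans_lt (ENNReal.mul_lt_top (ENNReal.mul_lt_top (ENNReal.pow_lt_top hfL.2)
      (ENNReal.pow_lt_top hgL.2)) ENNReal.ofReal_lt_top)
  exact (ENNReal.pow_lt_top_iff.1 this).resolve_right (by norm_num)

/-! ### Moments of the bilinear form -/

section ConvForm

variable {f g : ℝ → ℂ}

theorem integrable_pow_mul_of_memLp (hg : MemLp g 2 (weightMeasure hermiteWeight)) (k : ℕ) :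
    Integrable fun x : ℝ => (x : ℂ) ^ k * g x :=
  admissibleWeight_hermiteWeight.integrable_pow_mul hg
    (fun x hx => absurd hx (hermiteWeight_pos x).ne') k

theorem l2Moment_eq_integral_of_ae {u : L2 hermiteWeight} (h : u =ᵐ[weightMeasure hermiteWeight] g)
    (k : ℕ) : l2Moment hermiteWeight u k = ∫ x : ℝ, (x : ℂ) ^ k * g x :=
  admissibleWeight_hermiteWeight.l2Moment_eq_integral h
    (fun x hx => absurd hx (hermiteWeight_pos x).ne') k

theorem add_div_sqrt_two_pow_mul (k : ℕ) (z : ℝ × ℝ) :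
    (((z.1 + z.2) / Real.sqrt 2 : ℝ) : ℂ) ^ k * (f z.1 * g z.2) =
      ∑ p ∈ Finset.HasAntidiagonal.antidiagonal k, ((Real.sqrt 2 : ℂ)⁻¹ ^ k * (k.choose p.1 : ℂ)) *
        (((z.1 : ℂ) ^ p.1 * f z.1) * ((z.2 : ℂ) ^ p.2 * g z.2)) := by
  rw [Complex.ofReal_div, Complex.ofReal_add, div_eq_inv_mul, mul_pow,
    (Commute.all (z.1 : ℂ) (z.2 : ℂ)).add_pow', Finset.mul_sum, Finset.sum_mul]
  refine Finset.sum_congr rfl fun p _ => ?_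
  rw [nsmul_eq_mul]
  ring

theorem integrable_add_pow_mul (hfL : MemLp f 2 (weightMeasure hermiteWeight))
    (hgL : MemLp g 2 (weightMeasure hermiteWeight)) (k : ℕ) :
    Integrable fun z : ℝ × ℝ =>
      (((z.1 + z.2) / Real.sqrt 2 : ℝ) : ℂ) ^ k * (f z.1 * g z.2) := by
  simp_rw [add_div_sqrt_two_pow_mul]
  refine integrable_finsetSum _ fun p _ => Integrable.const_mul ?_ _
  exact (integrable_pow_mul_of_memLp hfL p.1).mul_prod (integrable_pow_mul_of_memLp hgL p.2)

/-- The moments of `rotConv f g` as integrals over the plane, by the rotation of the plane. -/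
theorem integral_pow_mul_rotConv (hfL : MemLp f 2 (weightMeasure hermiteWeight))
    (hgL : MemLp g 2 (weightMeasure hermiteWeight)) (k : ℕ) :
    ∫ u : ℝ, (u : ℂ) ^ k * rotConv f g u =
      ∫ z : ℝ × ℝ, (((z.1 + z.2) / Real.sqrt 2 : ℝ) : ℂ) ^ k * (f z.1 * g z.2) := by
  have hH := integrable_add_pow_mul hfL hgL k
  set H : ℝ × ℝ → ℂ := fun z => (((z.1 + z.2) / Real.sqrt 2 : ℝ) : ℂ) ^ k * (f z.1 * g z.2) with hHd
  have hrot : ∀ z : ℝ × ℝ, H (rotation z) =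
      (z.1 : ℂ) ^ k * (f (rotation z).1 * g (rotation z).2) := by
    intro z
    have h : ((rotation z).1 + (rotation z).2) / Real.sqrt 2 = z.1 :=
      congrArg Prod.fst (rotation_rotation z)
    simp only [hHd, h]
  have hI : Integrable fun z : ℝ × ℝ => H (rotation z) :=
    (measurePreserving_rotation.integrable_comp_emb measurableEmbedding_rotation).2 hH
  rw [← measurePreserving_rotation.integral_comp measurableEmbedding_rotation,
    Measure.volume_eq_prod, integral_prod _ hI]
  refine integral_congr_ae (ae_of_all _ fun u => ?_)
  simp only [hrot]
  rw [integral_const_mul]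
  rfl

theorem integral_pow_mul_rotConv_eq_sum (hfL : MemLp f 2 (weightMeasure hermiteWeight))
    (hgL : MemLp g 2 (weightMeasure hermiteWeight)) (k : ℕ) :
    ∫ u : ℝ, (u : ℂ) ^ k * rotConv f g u = (Real.sqrt 2 : ℂ)⁻¹ ^ k *
      ∑ p ∈ Finset.HasAntidiagonal.antidiagonal k, (k.choose p.1 : ℂ) *
        ((∫ x : ℝ, (x : ℂ) ^ p.1 * f x) * ∫ x : ℝ, (x : ℂ) ^ p.2 * g x) := by
  rw [integral_pow_mul_rotConv hfL hgL]
  simp_rw [add_div_sqrt_two_pow_mul]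
  rw [integral_finsetSum, Finset.mul_sum]
  · refine Finset.sum_congr rfl fun p _ => ?_
    rw [integral_const_mul, Measure.volume_eq_prod,
      integral_prod_mul (fun x : ℝ => (x : ℂ) ^ p.1 * f x) fun x : ℝ => (x : ℂ) ^ p.2 * g x,
      mul_assoc]
  · intro p _
    refine Integrable.const_mul ?_ _
    exact (integrable_pow_mul_of_memLp hfL p.1).mul_prod (integrable_pow_mul_of_memLp hgL p.2)

end ConvForm

/-- The bounded bilinear form `(f, g) ↦ rotConv f g` on `L²(e^{x²/2} dx)`; the classical central
limit operator is its restriction to the diagonal. -/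
noncomputable def convForm (f g : L2 hermiteWeight) : L2 hermiteWeight :=
  (memLp_rotConv (Lp.stronglyMeasurable f).measurable (Lp.stronglyMeasurable g).measurable
    (Lp.memLp f) (Lp.memLp g)).toLp

theorem coeFn_convForm (f g : L2 hermiteWeight) :
    convForm f g =ᵐ[weightMeasure hermiteWeight] rotConv f g :=
  MemLp.coeFn_toLp _

/-- Moments are multiplied as those of a sum of independent variables. -/
theorem l2Moment_convForm (f g : L2 hermiteWeight) (k : ℕ) :
    l2Moment hermiteWeight (convForm f g) k = (Real.sqrt 2 : ℂ)⁻¹ ^ k *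
      ∑ p ∈ Finset.HasAntidiagonal.antidiagonal k, (k.choose p.1 : ℂ) *
        (l2Moment hermiteWeight f p.1 * l2Moment hermiteWeight g p.2) := by
  rw [l2Moment_eq_integral_of_ae (coeFn_convForm f g),
    integral_pow_mul_rotConv_eq_sum (Lp.memLp f) (Lp.memLp g)]
  simp_rw [l2Moment_eq_integral_of_ae (ae_eq_refl f), l2Moment_eq_integral_of_ae (ae_eq_refl g)]

/-- The bilinear form does not depend on the representatives; by determinacy it suffices to compare
moments. -/
theorem convForm_ae_eq {f g : L2 hermiteWeight} {f' g' : ℝ → ℂ} (hf' : Measurable f')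
    (hg' : Measurable g') (hf : f =ᵐ[weightMeasure hermiteWeight] f')
    (hg : g =ᵐ[weightMeasure hermiteWeight] g') :
    convForm f g =ᵐ[weightMeasure hermiteWeight] rotConv f' g' := by
  have hfL := (memLp_congr_ae hf).1 (Lp.memLp f)
  have hgL := (memLp_congr_ae hg).1 (Lp.memLp g)
  have hL := memLp_rotConv hf' hg' hfL hgL
  have : convForm f g = hL.toLp := by
    refine admissibleWeight_hermiteWeight.ext_l2Moment (funext fun k => ?_)
    rw [l2Moment_convForm, l2Moment_eq_integral_of_ae hL.coeFn_toLp,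
      integral_pow_mul_rotConv_eq_sum hfL hgL]
    simp_rw [l2Moment_eq_integral_of_ae hf, l2Moment_eq_integral_of_ae hg]
  rw [this]
  exact hL.coeFn_toLp

theorem convForm_comm (f g : L2 hermiteWeight) : convForm f g = convForm g f := by
  refine admissibleWeight_hermiteWeight.ext_l2Moment (funext fun k => ?_)
  rw [l2Moment_convForm, l2Moment_convForm, ← Finset.Nat.sum_antidiagonal_swap]
  congr 1
  refine Finset.sum_congr rfl fun p hp => ?_
  rw [Finset.HasAntidiagonal.mem_antidiagonal] at hp
  rw [Prod.fst_swap, Prod.snd_swap, Nat.choose_symm_of_eq_add (by omega : k = p.2 + p.1),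
    mul_comm (l2Moment _ f _)]

theorem convForm_add_left (f f' g : L2 hermiteWeight) :
    convForm (f + f') g = convForm f g + convForm f' g := by
  refine admissibleWeight_hermiteWeight.ext_l2Moment (funext fun k => ?_)
  rw [admissibleWeight_hermiteWeight.l2Moment_add, Pi.add_apply]
  simp_rw [l2Moment_convForm, admissibleWeight_hermiteWeight.l2Moment_add, Pi.add_apply]
  rw [← mul_add, ← Finset.sum_add_distrib]
  congr 1
  exact Finset.sum_congr rfl fun p _ => by ring

theorem convForm_smul_left (a : ℂ) (f g : L2 hermiteWeight) :
    convForm (a • f) g = a • convForm f g := by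
  refine admissibleWeight_hermiteWeight.ext_l2Moment (funext fun k => ?_)
  rw [admissibleWeight_hermiteWeight.l2Moment_smul, Pi.smul_apply]
  simp_rw [l2Moment_convForm, admissibleWeight_hermiteWeight.l2Moment_smul, Pi.smul_apply,
    smul_eq_mul]
  rw [mul_left_comm, Finset.mul_sum (a := a)]
  congr 1
  exact Finset.sum_congr rfl fun p _ => by ring

theorem convForm_add_self (c v : L2 hermiteWeight) :
    convForm (c + v) (c + v) = convForm c c + (2 : ℂ) • convForm v c + convForm v v := by
  rw [convForm_add_left, convForm_comm c, convForm_comm v (c + v), convForm_add_left,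
    convForm_add_left, convForm_comm c v, two_smul]
  abel

/-- A bound `(2π)^{1/4}` for the norm of the bilinear form `convForm`. -/
noncomputable def convBound : ℝ := Real.sqrt (Real.sqrt (2 * Real.pi))

theorem norm_convForm_le (f g : L2 hermiteWeight) :
    ‖convForm f g‖ ≤ convBound * ‖g‖ * ‖f‖ := by
  have h := eLpNorm_rotConv_le (Lp.stronglyMeasurable f).measurable
    (Lp.stronglyMeasurable g).measurable
  rw [← eLpNorm_congr_ae (coeFn_convForm f g)] at h
  have hf := Lp.eLpNorm_lt_top f
  have hg := Lp.eLpNorm_lt_top g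
  have h' := ENNReal.toReal_mono (ENNReal.mul_lt_top (ENNReal.mul_lt_top (ENNReal.pow_lt_top hf)
      (ENNReal.pow_lt_top hg)) ENNReal.ofReal_lt_top).ne h
  rw [ENNReal.toReal_mul, ENNReal.toReal_mul, ENNReal.toReal_pow, ENNReal.toReal_pow,
    ENNReal.toReal_pow, ENNReal.toReal_ofReal (Real.sqrt_nonneg _), ← Lp.norm_def, ← Lp.norm_def,
    ← Lp.norm_def] at h'
  have h0 : 0 ≤ convBound := Real.sqrt_nonneg _
  refine (sq_le_sq₀ (norm_nonneg _) (by positivity)).1 (h'.trans (le_of_eq ?_))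
  rw [mul_pow, mul_pow, convBound, Real.sq_sqrt (Real.sqrt_nonneg _)]
  ring

/-! ### The classical central limit operator on densities -/

/-- The image of a law with a density under the classical central limit operator. -/
theorem classicalT_withDensity {f : ℝ → ℝ} (hf : Measurable f) (h0 : ∀ x, 0 ≤ f x)
    (hi : Integrable f) :
    classicalT (volume.withDensity fun x => ENNReal.ofReal (f x)) =
      volume.withDensity fun u =>
        ENNReal.ofReal (∫ v, f ((u + v) / Real.sqrt 2) * f ((u - v) / Real.sqrt 2)) := by
  have hF : Measurable fun x => ENNReal.ofReal (f x) := hf.ennreal_ofReal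
  have hI : Integrable fun z : ℝ × ℝ => f (rotation z).1 * f (rotation z).2 :=
    (measurePreserving_rotation.integrable_comp_emb measurableEmbedding_rotation).2 (hi.mul_prod hi)
  have hae : ∀ᵐ u : ℝ, ∫⁻ v, ENNReal.ofReal (f (rotation (u, v)).1) *
      ENNReal.ofReal (f (rotation (u, v)).2) =
      ENNReal.ofReal (∫ v, f ((u + v) / Real.sqrt 2) * f ((u - v) / Real.sqrt 2)) := by
    rw [Measure.volume_eq_prod] at hI
    filter_upwards [hI.prod_right_ae] with u hu
    have := ofReal_integral_eq_lintegral_ofReal hu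
      (ae_of_all _ fun v => mul_nonneg (h0 _) (h0 _))
    simp only [rotation] at this ⊢
    rw [this]
    exact lintegral_congr fun v => (ENNReal.ofReal_mul (h0 _)).symm
  have hm1 : Measurable fun z : ℝ × ℝ => z.1 + z.2 := by fun_prop
  have hm2 : Measurable fun x : ℝ => x / Real.sqrt 2 := by fun_prop
  rw [← withDensity_congr_ae hae, classicalT, Measure.conv, Measure.map_map hm2 hm1,
    prod_withDensity hF hF, ← Measure.volume_eq_prod]
  have hG : Measurable fun z : ℝ × ℝ => ENNReal.ofReal (f z.1) * ENNReal.ofReal (f z.2) := by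
    fun_prop
  ext s hs
  have hs' : MeasurableSet ((fun z : ℝ × ℝ => z.1) ⁻¹' s) := measurable_fst hs
  have hpre : ((fun x : ℝ => x / Real.sqrt 2) ∘ fun z : ℝ × ℝ => z.1 + z.2) ⁻¹' s =
      rotation ⁻¹' ((fun z : ℝ × ℝ => z.1) ⁻¹' s) := rfl
  have hback : rotation ⁻¹' (rotation ⁻¹' ((fun z : ℝ × ℝ => z.1) ⁻¹' s)) =
      (fun z : ℝ × ℝ => z.1) ⁻¹' s := by
    ext z; simp only [Set.mem_preimage, rotation_rotation]
  rw [Measure.map_apply (hm2.comp hm1) hs, hpre,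
    withDensity_apply _ (measurable_rotation hs'), withDensity_apply _ hs,
    ← measurePreserving_rotation.setLIntegral_comp_preimage (measurable_rotation hs') hG, hback]
  have hset : (fun z : ℝ × ℝ => z.1) ⁻¹' s = s ×ˢ Set.univ := by ext z; simp
  rw [hset, Measure.volume_eq_prod, ← Measure.prod_restrict, Measure.restrict_univ,
    lintegral_prod (fun z => ENNReal.ofReal (f (rotation z).1) * ENNReal.ofReal (f (rotation z).2))
      (hG.comp measurable_rotation).aemeasurable]

/-- The classical central limit operator is the bilinear form on the diagonal. -/
theorem classicalT_mem_distributions {μ : Measure ℝ} (hμ : μ ∈ distributions hermiteWeight) :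
    classicalT μ ∈ distributions hermiteWeight ∧
      density hermiteWeight (classicalT μ) =
        convForm (density hermiteWeight μ) (density hermiteWeight μ) := by
  have hφ := admissibleWeight_hermiteWeight
  have hp : IsProbabilityMeasure μ := hμ.1
  obtain ⟨f, hf, h0, -, hμf, hL, hd⟩ := hφ.exists_density hμ.2.1
  have hi : Integrable f := by simpa using (integrable_pow_mul_of_memLp hL 0).re
  have hm := hφ.l2Moment_density hμ.2.1
  obtain ⟨m0, m1, m2⟩ := momentSeq_of_mem_distributions hμ
  have hs : ((Real.sqrt 2 : ℂ)⁻¹) ^ 2 = 2⁻¹ := by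
    rw [inv_pow, ← Complex.ofReal_pow, Real.sq_sqrt (by norm_num)]; norm_num
  have hT : classicalT μ = volume.withDensity fun u =>
      ENNReal.ofReal (∫ v, f ((u + v) / Real.sqrt 2) * f ((u - v) / Real.sqrt 2)) := by
    conv_lhs => rw [hμf]
    exact classicalT_withDensity hf h0 hi
  rw [hT]
  refine hφ.mem_distributions_of_l2Moment ?_ (fun u => ?_)
    (fun x hx => absurd hx (hermiteWeight_pos x).ne') ?_ ?_ ?_ ?_
  · have h : StronglyMeasurable fun z : ℝ × ℝ => f (rotation z).1 * f (rotation z).2 :=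
      ((hf.comp measurable_rotation.fst).mul (hf.comp measurable_rotation.snd)).stronglyMeasurable
    exact (h.integral_prod_right' (ν := volume)).measurable
  · exact integral_nonneg fun v => mul_nonneg (h0 _) (h0 _)
  · filter_upwards [convForm_ae_eq (by fun_prop) (by fun_prop) hd hd] with u hu
    rw [hu, rotConv, ← integral_complex_ofReal]
    push_cast
    rfl
  · rw [l2Moment_convForm, hm]
    simp [m0]
  · rw [l2Moment_convForm, hm, Finset.Nat.sum_antidiagonal_eq_sum_range_succ_mk]
    simp [Finset.sum_range_succ, m1]
  · rw [l2Moment_convForm, hm, Finset.Nat.sum_antidiagonal_eq_sum_range_succ_mk, hs]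
    simp [Finset.sum_range_succ, m0, m1, m2]
    norm_num

/-! ### The differential of the classical central limit operator -/

theorem l2Moment_monomialVec_comm (i j : ℕ) :
    l2Moment hermiteWeight (admissibleWeight_hermiteWeight.monomialVec i) j =
      l2Moment hermiteWeight (admissibleWeight_hermiteWeight.monomialVec j) i := by
  rw [l2Moment_eq_integral_of_ae (admissibleWeight_hermiteWeight.coeFn_monomialVec i),
    l2Moment_eq_integral_of_ae (admissibleWeight_hermiteWeight.coeFn_monomialVec j)]
  congr 1
  funext x
  ring

theorem density_gaussianReal_ae :
    density hermiteWeight (gaussianReal 0 1) =ᵐ[weightMeasure hermiteWeight]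
      fun x => (gaussianPDFReal 0 1 x : ℂ) := by
  rw [gaussianReal_eq]
  exact isBasePoint_gaussian.density_ae admissibleWeight_hermiteWeight

theorem gaussianReal_mem_distributions : gaussianReal 0 1 ∈ distributions hermiteWeight := by
  rw [gaussianReal_eq]
  exact isBasePoint_gaussian.mem_distributions

theorem mem_tangentSpace_gaussianReal_iff (v : L2 hermiteWeight) :
    v ∈ tangentSpace hermiteWeight (gaussianReal 0 1) ↔
      ∀ k < 3, l2Moment hermiteWeight v k = 0 := by
  rw [gaussianReal_eq]
  exact isBasePoint_gaussian.mem_tangentSpace_iff admissibleWeight_hermiteWeight v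

/-- The matrix coefficients of convolution with the Gaussian law as Gaussian integrals. -/
theorem l2Moment_convForm_monomialVec (j k : ℕ) :
    l2Moment hermiteWeight (convForm (admissibleWeight_hermiteWeight.monomialVec k)
      (density hermiteWeight (gaussianReal 0 1))) j =
      ((Real.sqrt (2 * Real.pi) * ∫ z : ℝ × ℝ, ((z.1 + z.2) / Real.sqrt 2) ^ j * z.1 ^ k *
        (gaussianPDFReal 0 1 z.1 * gaussianPDFReal 0 1 z.2) : ℝ) : ℂ) := by
  have hφ := admissibleWeight_hermiteWeight
  have hm := hφ.measurable
  rw [l2Moment_eq_integral_of_ae (convForm_ae_eq (f' := fun x : ℝ => (x : ℂ) ^ k / hermiteWeight x)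
    (by fun_prop) (isBasePoint_gaussian.measurable.complex_ofReal) (hφ.coeFn_monomialVec k)
    density_gaussianReal_ae), integral_pow_mul_rotConv (hφ.memLp_pow k) isBasePoint_gaussian.memLp,
    Complex.ofReal_mul, ← integral_complex_ofReal, ← integral_const_mul]
  congr 1
  funext z
  rw [gaussianPDFReal_eq_div z.1]
  have h1 : (hermiteWeight z.1 : ℂ) ≠ 0 := by exact_mod_cast (hermiteWeight_pos z.1).ne'
  have h2 : (Real.sqrt (2 * Real.pi) : ℂ) ≠ 0 := by
    exact_mod_cast (Real.sqrt_pos.2 (by positivity)).ne'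
  push_cast
  field_simp

/-- Convolution with the Gaussian law is symmetric on the vectors `x^k / φ`: the rotation exchanges
the two powers in the Gaussian integral of its matrix coefficients. -/
theorem l2Moment_convForm_monomialVec_comm (j k : ℕ) :
    l2Moment hermiteWeight (convForm (admissibleWeight_hermiteWeight.monomialVec k)
      (density hermiteWeight (gaussianReal 0 1))) j =
    l2Moment hermiteWeight (convForm (admissibleWeight_hermiteWeight.monomialVec j)
      (density hermiteWeight (gaussianReal 0 1))) k := by
  rw [l2Moment_convForm_monomialVec, l2Moment_convForm_monomialVec,
    ← measurePreserving_rotation.integral_comp measurableEmbedding_rotation]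
  congr 3
  funext z
  have h : ((rotation z).1 + (rotation z).2) / Real.sqrt 2 = z.1 :=
    congrArg Prod.fst (rotation_rotation z)
  rw [h, gaussianPDFReal_rotation]
  simp only [rotation]
  ring

/-- Convolution with the Gaussian law, followed by the dilation by `1 / √2`. In the Hilbert basis of
normalized Hermite functions it is diagonal with entries `2^{-k/2}`. -/
noncomputable def gaussianOp : L2 hermiteWeight →L[ℂ] L2 hermiteWeight :=
  LinearMap.mkContinuous
    { toFun := fun f => convForm f (density hermiteWeight (gaussianReal 0 1))
      map_add' := fun f f' => convForm_add_left f f' _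
      map_smul' := fun a f => convForm_smul_left a f _ }
    (convBound * ‖density hermiteWeight (gaussianReal 0 1)‖) fun f => norm_convForm_le f _

theorem gaussianOp_apply (f : L2 hermiteWeight) :
    gaussianOp f = convForm f (density hermiteWeight (gaussianReal 0 1)) := rfl

/-- Moving the operator to the other side of the inner product turns the moment formula of
`convForm` into an expansion of the image of `x^k / φ`. -/
theorem gaussianOp_monomialVec (k : ℕ) :
    gaussianOp (admissibleWeight_hermiteWeight.monomialVec k) =
      ∑ p ∈ Finset.HasAntidiagonal.antidiagonal k,
        ((Real.sqrt 2 : ℂ)⁻¹ ^ k * (k.choose p.1 : ℂ) * momentSeq (gaussianReal 0 1) p.2) •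
          admissibleWeight_hermiteWeight.monomialVec p.1 := by
  refine admissibleWeight_hermiteWeight.ext_l2Moment (funext fun j => ?_)
  rw [gaussianOp_apply, l2Moment_convForm_monomialVec_comm, l2Moment_convForm,
    admissibleWeight_hermiteWeight.l2Moment_density gaussianReal_mem_distributions.2.1,
    ← admissibleWeight_hermiteWeight.inner_monomialVec, inner_sum, Finset.mul_sum]
  refine Finset.sum_congr rfl fun p _ => ?_
  rw [inner_smul_right, admissibleWeight_hermiteWeight.inner_monomialVec,
    l2Moment_monomialVec_comm]
  ring

theorem gaussianOp_triangular (k : ℕ) :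
    gaussianOp (admissibleWeight_hermiteWeight.monomialVec k) -
        (((Real.sqrt 2)⁻¹ ^ k : ℝ) : ℂ) • admissibleWeight_hermiteWeight.monomialVec k ∈
      Submodule.span ℂ (admissibleWeight_hermiteWeight.monomialVec '' Set.Iio k) := by
  have hk : (k, 0) ∈ Finset.HasAntidiagonal.antidiagonal k := by
    rw [Finset.HasAntidiagonal.mem_antidiagonal, add_zero]
  rw [gaussianOp_monomialVec, ← Finset.add_sum_erase _ _ hk, Nat.choose_self,
    AdmissibleWeight.momentSeq_zero]
  push_cast
  rw [mul_one, mul_one, add_sub_cancel_left]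
  refine Submodule.sum_mem _ fun p hp => Submodule.smul_mem _ _
    (Submodule.subset_span ⟨p.1, ?_, rfl⟩)
  rw [Finset.mem_erase, Finset.HasAntidiagonal.mem_antidiagonal] at hp
  have : p.1 ≠ k := fun h => hp.1 (Prod.ext h (by omega))
  exact lt_of_le_of_ne (by omega) this

theorem inner_gaussianOp (i j : ℕ) :
    inner ℂ (admissibleWeight_hermiteWeight.monomialVec i)
        (gaussianOp (admissibleWeight_hermiteWeight.monomialVec j)) =
      inner ℂ (gaussianOp (admissibleWeight_hermiteWeight.monomialVec i))
        (admissibleWeight_hermiteWeight.monomialVec j) := by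
  rw [← inner_conj_symm (gaussianOp _), admissibleWeight_hermiteWeight.inner_monomialVec,
    admissibleWeight_hermiteWeight.inner_monomialVec, gaussianOp_apply, gaussianOp_apply,
    l2Moment_convForm_monomialVec_comm j, l2Moment_convForm_monomialVec, Complex.conj_ofReal]

theorem linearIndependent_monomialVec :
    LinearIndependent ℂ admissibleWeight_hermiteWeight.monomialVec := by
  have hφ := admissibleWeight_hermiteWeight
  have h := (Polynomial.basisMonomials ℂ).linearIndependent.map' hφ.polyVec (by
    rw [LinearMap.ker_eq_bot']
    intro p hp
    by_contra hp0
    have h1 := hφ.coeFn_polyVec p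
    rw [hp] at h1
    have h2 : ∀ᵐ x : ℝ, p.eval (x : ℂ) = 0 := by
      have h3 := hφ.ae_iff.1 ((Lp.coeFn_zero ℂ 2 (weightMeasure hermiteWeight)).symm.trans h1)
      filter_upwards [h3] with x hx
      have h0 := (hermiteWeight_pos x).ne'
      have := hx h0
      rw [Pi.zero_apply, eq_comm, div_eq_zero_iff] at this
      exact this.resolve_right (by exact_mod_cast h0)
    have h4 : {x : ℝ | p.eval (x : ℂ) = 0}.Finite :=
      (Polynomial.finite_setOfPred_isRoot hp0).preimage Complex.ofReal_injective.injOn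
    obtain ⟨x, hx, hx'⟩ :=
      (h2.and (measure_eq_zero_iff_ae_notMem.1 (h4.measure_zero volume))).exists
    exact hx' hx)
  have e : hφ.monomialVec = hφ.polyVec ∘ Polynomial.basisMonomials ℂ := by
    funext k
    simp [AdmissibleWeight.polyVec_monomial]
  rw [e]
  exact h

/-- The second order term `convForm v v` of the classical central limit operator at the Gaussian law
is `o(‖v‖)`, so the differential is twice `gaussianOp`. -/
theorem isDifferential_of_eq_gaussianOp
    {D : tangentSpace hermiteWeight (gaussianReal 0 1) →L[ℂ]
      tangentSpace hermiteWeight (gaussianReal 0 1)}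
    (hD : ∀ v, (D v : L2 hermiteWeight) = (2 : ℂ) • gaussianOp v) :
    IsDifferential hermiteWeight classicalT (gaussianReal 0 1) D := by
  intro ε hε
  have hK : 0 ≤ convBound := Real.sqrt_nonneg _
  refine ⟨ε / (convBound + 1), by positivity, fun μ hμ v hv hvδ => ?_⟩
  have hd : density hermiteWeight μ = density hermiteWeight (gaussianReal 0 1) + v := by
    rw [hv, add_sub_cancel]
  rw [(classicalT_mem_distributions hμ).2,
    (classicalT_mem_distributions gaussianReal_mem_distributions).2, hd, convForm_add_self, hD,
    gaussianOp_apply, add_assoc, add_sub_cancel_left, add_sub_cancel_left]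
  refine (norm_convForm_le _ _).trans ?_
  rw [Submodule.coe_norm]
  gcongr
  calc convBound * ‖(v : L2 hermiteWeight)‖ ≤ (convBound + 1) * (ε / (convBound + 1)) := by
        gcongr
        · linarith
        · exact hvδ
    _ = ε := by field_simp

/-- In the classical case the differential exists, and it is the restriction of an operator that is
diagonal in the Hilbert basis of Hermite functions. -/
theorem exists_classicalDifferential :
    ∃ D : tangentSpace hermiteWeight (gaussianReal 0 1) →L[ℂ]
        tangentSpace hermiteWeight (gaussianReal 0 1),
      (∀ D', IsDifferential hermiteWeight classicalT (gaussianReal 0 1) D' ↔ D' = D) ∧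
        spectrum ℂ D ⊆ Metric.ball 0 1 := by
  have hφ := admissibleWeight_hermiteWeight
  have hcl : IsClosed (tangentSpace hermiteWeight (gaussianReal 0 1) : Set (L2 hermiteWeight)) :=
    Submodule.isClosed_topologicalClosure _
  have : CompleteSpace (tangentSpace hermiteWeight (gaussianReal 0 1)) := hcl.completeSpace_coe
  obtain ⟨b, hb, hperp⟩ := exists_hilbertBasis_of_symmetric linearIndependent_monomialVec
    (fun f hf => hφ.eq_zero_of_l2Moment_eq_zero fun k => by rw [← hφ.inner_monomialVec, hf])
    inner_gaussianOp gaussianOp_triangular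
  have hA : ∀ k, ((2 : ℂ) • gaussianOp) (b k) = (2 / (Real.sqrt 2 : ℂ) ^ k) • b k := by
    intro k
    rw [smul_apply, hb, smul_smul]
    push_cast
    rw [inv_pow, div_eq_mul_inv]
  obtain ⟨D, hD, hspec⟩ := exists_restriction_of_diagonal hA (n := 3) (by positivity)
    inv_sqrt_two_lt_one (fun k hk => norm_two_div_sqrt_two_pow_le hk)
    (tangentSpace hermiteWeight (gaussianReal 0 1)) (fun v => by
      rw [mem_tangentSpace_gaussianReal_iff, ← hperp]
      simp_rw [hφ.inner_monomialVec])
  have hdiff := isDifferential_of_eq_gaussianOp hD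
  exact ⟨D, fun D' =>
    ⟨fun h => isBasePoint_gaussian.isDifferential_unique hφ gaussianReal_eq hdiff h,
      fun h => h ▸ hdiff⟩, hspec⟩

theorem semicircle_mem_distributions : semicircle ∈ distributions chebyshevWeight := by
  rw [semicircle_eq]
  exact isBasePoint_semicircle.mem_distributions

end CentralLimit

theorem mainTheorem3 :
    -- classical case
    ((∀ (f : CentralLimit.L2 CentralLimit.hermiteWeight) (k : ℕ),
        IntegrableOn (fun x : ℝ => (x : ℂ) ^ k * f x)
          (Function.support CentralLimit.hermiteWeight)) ∧
      gaussianReal 0 1 ∈ CentralLimit.distributions CentralLimit.hermiteWeight ∧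
      CentralLimit.classicalT (gaussianReal 0 1) = gaussianReal 0 1 ∧
      (∀ μ ∈ CentralLimit.distributions CentralLimit.hermiteWeight,
        CentralLimit.classicalT μ ∈ CentralLimit.distributions CentralLimit.hermiteWeight) ∧
      (∀ v : CentralLimit.L2 CentralLimit.hermiteWeight,
        v ∈ CentralLimit.tangentSpace CentralLimit.hermiteWeight (gaussianReal 0 1) ↔
          ∀ k < 3, CentralLimit.l2Moment CentralLimit.hermiteWeight v k = 0) ∧
      ∃ D : CentralLimit.tangentSpace CentralLimit.hermiteWeight (gaussianReal 0 1) →L[ℂ]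
          CentralLimit.tangentSpace CentralLimit.hermiteWeight (gaussianReal 0 1),
        (∀ D', CentralLimit.IsDifferential CentralLimit.hermiteWeight CentralLimit.classicalT
          (gaussianReal 0 1) D' ↔ D' = D) ∧
        spectrum ℂ D ⊆ Metric.ball 0 1) ∧
    -- free case
    ((∀ (f : CentralLimit.L2 CentralLimit.chebyshevWeight) (k : ℕ),
        IntegrableOn (fun x : ℝ => (x : ℂ) ^ k * f x)
          (Function.support CentralLimit.chebyshevWeight)) ∧
      (∀ m₁ m₂ : ℕ → ℂ, m₁ 0 = 1 → m₂ 0 = 1 →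
        ∀ m, CentralLimit.IsFreeConv m₁ m₂ m ↔ m = CentralLimit.freeConv m₁ m₂) ∧
      CentralLimit.semicircle ∈ CentralLimit.distributions CentralLimit.chebyshevWeight ∧
      CentralLimit.freeT (CentralLimit.momentSeq CentralLimit.semicircle) =
        CentralLimit.momentSeq CentralLimit.semicircle ∧
      (∀ v : CentralLimit.L2 CentralLimit.chebyshevWeight,
        v ∈ CentralLimit.tangentSpace CentralLimit.chebyshevWeight CentralLimit.semicircle ↔
          ∀ k < 3, CentralLimit.l2Moment CentralLimit.chebyshevWeight v k = 0) ∧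
      ∃ D : CentralLimit.tangentSpace CentralLimit.chebyshevWeight CentralLimit.semicircle →L[ℂ]
          CentralLimit.tangentSpace CentralLimit.chebyshevWeight CentralLimit.semicircle,
        (∀ D', CentralLimit.IsMomentDifferential CentralLimit.chebyshevWeight CentralLimit.freeT
          CentralLimit.semicircle D' ↔ D' = D) ∧
        spectrum ℂ D ⊆ Metric.ball 0 1) := by
  have hH := CentralLimit.admissibleWeight_hermiteWeight
  have hC := CentralLimit.admissibleWeight_chebyshevWeight
  refine ⟨⟨hH.integrableOn_pow_mul, CentralLimit.gaussianReal_mem_distributions,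
    CentralLimit.classicalT_gaussianReal,
    fun μ hμ => (CentralLimit.classicalT_mem_distributions hμ).1,
    CentralLimit.mem_tangentSpace_gaussianReal_iff, CentralLimit.exists_classicalDifferential⟩,
    hC.integrableOn_pow_mul,
    fun m₁ m₂ h₁ h₂ m => CentralLimit.isFreeConv_iff_eq_freeConv h₁ h₂ m,
    CentralLimit.semicircle_mem_distributions, ?_, fun v => ?_,
    CentralLimit.exists_freeDifferential⟩
  · rw [CentralLimit.momentSeq_semicircle]
    exact CentralLimit.freeT_momentsOfCumulants_semicircle
  · rw [CentralLimit.semicircle_eq]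
    exact CentralLimit.isBasePoint_semicircle.mem_tangentSpace_iff hC v
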